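/- Let $n\ge 3$, let $\Omega\subset\mathbb R^n$ be a bounded domain with smooth boundary, and put $p=\frac{n+2}{n-2}$. Equip $H^1_0(\Omega)$ with $\langle u,v\rangle=\int_\Omega\nabla u\cdot\nabla v$ and $\|u\|^2=\langle u,u\rangle$. For $\varepsilon>0$ let $$I_\varepsilon(u)=\frac12\int_\Omega|\nabla u|^2-\int_\Omega F_\varepsilon(u),\qquad F_\varepsilon(s)=\int_0^s f_\varepsilon(t)\,dt,\qquad f_\varepsilon(s)=\frac{|s|^{p-1}s}{[\ln(e+|s|)]^{\varepsilon}},$$ and let $\nabla I_\varepsilon$ be its gradient in the Hilbert space $H^1_0(\Omega)$. For $a\in\Omega$, $\lambda>0$ let $$\delta_{(a,\lambda)}(y)=\frac{c_0\lambda^{(n-2)/2}}{(1+\lambda^2|y-a|^2)^{(n-2)/2}},\qquad c_0=(n(n-2))^{(n-2)/4},$$ and let $P\delta_{(a,\lambda)}\in H^1_0(\Omega)$ be the weak solution of $-\Delta P\delta_{(a,\lambda)}=-\Delta\delta_{(a,\lambda)}$ in $\Omega$, $P\delta_{(a,\lambda)}=0$ on $\partial\Omega$. Let $$S_n=\inf\Big\{\|\nabla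 u\|_{L^2(\mathbb R^n)}^2\,\|u\|_{L^{2n/(n-2)}(\mathbb R^n)}^{-2}: u\not\equiv0,\ \nabla u\in L^2(\mathbb R^n)^n,\ u\in L^{2n/(n-2)}(\mathbb R^n)\Big\}$$ be the best Sobolev constant. Let $m\in\mathbb N$ and $\gamma_1,\dots,\gamma_m\in\{-1,1\}$. Then there are constants $\eta_0>0$ and $C>0$, depending only on $n,\Omega,m,\gamma$, such that the following holds for all $0<\eta\le\eta_0$ and all $\varepsilon>0$. Let $a_j\in\Omega$, $\lambda_j>\eta^{-1}$, $\alpha_j>0$ ($1\le j\le m$) and $v\in H^1_0(\Omega)$ satisfy, with $d_j=d(a_j,\partial\Omega)$ and $\varepsilon_{ij}=\big(\frac{\lambda_i}{\lambda_j}+\frac{\lambda_j}{\lambda_i}+\lambda_i\lambda_j|a_i-a_j|^2\big)^{(2-n)/2}$, $$\|v\|<\eta,\qquad |\alpha_j-1|<\eta,\qquad \lambda_jd_j>\eta^{-1}\ \ \forall j,\qquad \varepsilon_{ij}<\eta\ \ \forall i\ne j,$$ and put $P\delta_j=P\delta_{(a_j,\lambda_j)}$ and $u=\sum_{j=1}^m\alpha_j\gamma_jP\delta_j+v$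 (so that $u\in V(m,\eta)$, the set of all $u$ having such a representation). Then $I_\varepsilon$ is differentiable at $u$, and for every $i\in\{1,\dots,m\}$ $$\Big|\langle\nabla I_\varepsilon(u),P\delta_i\rangle-\gamma_i\alpha_i\big(1-\alpha_i^{p-1}\big)S_n^{n/2}\Big|\le C\Big(\varepsilon\ln(\ln\lambda_i)+\sum_{j=1}^m\frac1{(\lambda_jd_j)^{n-2}}+\sum_{j\ne i}\varepsilon_{ij}+\|v\|\Big).$$ -/

import Mathlib

open MeasureTheory Set
open scoped ENNReal NNReal ContDiff Gradient InnerProductSpace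

noncomputable section

namespace CriticalBubbles

/-- The Euclidean space `ℝⁿ`. -/
abbrev Euc (n : ℕ) : Type := EuclideanSpace ℝ (Fin n)

/-- A bounded domain (nonempty, open, connected, bounded) with smooth boundary: near each boundary
point it is the negativity set of a smooth function whose differential does not vanish there. -/
structure IsSmoothBoundedDomain {n : ℕ} (Ω : Set (Euc n)) : Prop where
  isOpen : IsOpen Ω
  isConnected : IsConnected Ω
  isBounded : Bornology.IsBounded Ω
  smooth_boundary : ∀ x ∈ frontier Ω, ∃ (U : Set (Euc n)) (ρ : Euc n → ℝ),
    IsOpen U ∧ x ∈ U ∧ ContDiff ℝ ∞ ρ ∧ fderiv ℝ ρ x ≠ 0 ∧ Ω ∩ U = {y ∈ U | ρ y < 0}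

/-- `φ ∈ C_c^∞(Ω)`. -/
structure IsTestFunction {n : ℕ} (Ω : Set (Euc n)) (φ : Euc n → ℝ) : Prop where
  contDiff : ContDiff ℝ ∞ φ
  hasCompactSupport : HasCompactSupport φ
  tsupport_subset : tsupport φ ⊆ Ω

theorem gradient_add_of_contDiff {n : ℕ} {φ ψ : Euc n → ℝ} (hφ : ContDiff ℝ ∞ φ)
    (hψ : ContDiff ℝ ∞ ψ) (x : Euc n) : ∇ (φ + ψ) x = ∇ φ x + ∇ ψ x := by
  have h1 : DifferentiableAt ℝ φ x := (hφ.differentiable (by simp)) x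
  have h2 : DifferentiableAt ℝ ψ x := (hψ.differentiable (by simp)) x
  simp only [gradient, fderiv_add h1 h2, map_add]

theorem gradient_smul_of_contDiff {n : ℕ} {φ : Euc n → ℝ} (hφ : ContDiff ℝ ∞ φ)
    (c : ℝ) (x : Euc n) : ∇ (c • φ) x = c • ∇ φ x := by
  have h1 : DifferentiableAt ℝ φ x := (hφ.differentiable (by simp)) x
  simp only [gradient, fderiv_const_smul h1]
  simp

/-- The space of pairs `(φ, ∇φ)`, `φ ∈ C_c^∞(Ω)`, in `L²(Ω) × L²(Ω; ℝⁿ)`. -/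
def testGraph {n : ℕ} (Ω : Set (Euc n)) :
    Submodule ℝ (Lp ℝ 2 (volume.restrict Ω) × Lp (Euc n) 2 (volume.restrict Ω)) where
  carrier := {w | ∃ φ, IsTestFunction Ω φ ∧ w.1 =ᵐ[volume.restrict Ω] φ ∧
    w.2 =ᵐ[volume.restrict Ω] ∇ φ}
  zero_mem' := by
    refine ⟨0, ⟨contDiff_const, HasCompactSupport.zero, by simp [tsupport]⟩, ?_, ?_⟩
    · exact Lp.coeFn_zero _ _ _
    · refine (Lp.coeFn_zero _ _ _).trans (Filter.Eventually.of_forall fun x => ?_)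
      have : (∇ (0 : Euc n → ℝ)) x = 0 := gradient_fun_const x (0 : ℝ)
      simp [this]
  add_mem' := by
    rintro w z ⟨φ, hφ, h1, h2⟩ ⟨ψ, hψ, h3, h4⟩
    refine ⟨φ + ψ, ⟨hφ.contDiff.add hψ.contDiff, hφ.hasCompactSupport.add hψ.hasCompactSupport,
      (tsupport_add φ ψ).trans (union_subset hφ.tsupport_subset hψ.tsupport_subset)⟩, ?_, ?_⟩
    · exact (Lp.coeFn_add _ _).trans (h1.add h3)
    · refine (Lp.coeFn_add _ _).trans ((h2.add h4).trans (Filter.Eventually.of_forall fun x => ?_))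
      exact (gradient_add_of_contDiff hφ.contDiff hψ.contDiff x).symm
  smul_mem' := by
    rintro c w ⟨φ, hφ, h1, h2⟩
    refine ⟨c • φ, ⟨hφ.contDiff.const_smul c, hφ.hasCompactSupport.smul_left (f := fun _ => c),
      (closure_mono (Function.support_const_smul_subset c φ)).trans hφ.tsupport_subset⟩, ?_, ?_⟩
    · exact (Lp.coeFn_smul _ _).trans (h1.const_smul c)
    · refine (Lp.coeFn_smul _ _).trans ((h2.const_smul c).trans
        (Filter.Eventually.of_forall fun x => ?_))
      exact (gradient_smul_of_contDiff hφ.contDiff c x).symm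

/-- Poincaré's inequality, on the closure of the test functions in `H¹(Ω)`. -/
theorem poincare {n : ℕ} (hn : 3 ≤ n) {Ω : Set (Euc n)} (hΩ : Bornology.IsBounded Ω) :
    ∃ C : ℝ≥0, ∀ w ∈ (testGraph Ω).topologicalClosure, ‖w.1‖ ≤ C * ‖w.2‖ := by
  refine ⟨eLpNormLESNormFDerivOfLeConst ℝ (volume : Measure (Euc n)) Ω 2 2, fun w hw => ?_⟩
  have hcl : IsClosed {w : Lp ℝ 2 (volume.restrict Ω) × Lp (Euc n) 2 (volume.restrict Ω) |
      ‖w.1‖ ≤ eLpNormLESNormFDerivOfLeConst ℝ (volume : Measure (Euc n)) Ω 2 2 * ‖w.2‖} :=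
    isClosed_le (by fun_prop) (by fun_prop)
  refine closure_minimal ?_ hcl hw
  rintro z ⟨φ, hφ, h1, h2⟩
  have hs : Function.support φ ⊆ Ω := (subset_tsupport φ).trans hφ.tsupport_subset
  have hs' : Function.support (∇ φ) ⊆ Ω := by
    refine Subset.trans (fun x hx => ?_)
      (((subset_tsupport _).trans (tsupport_fderiv_subset ℝ)).trans hφ.tsupport_subset)
    intro h0
    exact hx (by simp [gradient, h0])
  have key := eLpNorm_le_eLpNorm_fderiv (F := ℝ) (volume : Measure (Euc n)) (u := φ)
    (hφ.contDiff.of_le (by simp)) hs (p := 2) (by norm_num)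
    (by rw [finrank_euclideanSpace_fin]; exact_mod_cast (show 2 < n by omega)) hΩ
  have e1 : eLpNorm z.1 2 (volume.restrict Ω) = eLpNorm φ 2 volume := by
    rw [eLpNorm_congr_ae h1, eLpNorm_restrict_eq_of_support_subset hs]
  have e2 : eLpNorm z.2 2 (volume.restrict Ω) = eLpNorm (fderiv ℝ φ) 2 volume := by
    rw [eLpNorm_congr_ae h2, eLpNorm_restrict_eq_of_support_subset hs']
    refine eLpNorm_congr_norm_ae (Filter.Eventually.of_forall fun x => ?_)
    simp [gradient]
  have key' : eLpNorm z.1 2 (volume.restrict Ω) ≤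
      eLpNormLESNormFDerivOfLeConst ℝ (volume : Measure (Euc n)) Ω 2 2 *
        eLpNorm z.2 2 (volume.restrict Ω) := by
    rw [e1, e2]; exact_mod_cast key
  have := ENNReal.toReal_mono (ENNReal.mul_ne_top ENNReal.coe_ne_top (Lp.eLpNorm_ne_top z.2)) key'
  simpa [Lp.norm_def, ENNReal.toReal_mul] using this

/-- The Sobolev space `H¹₀(Ω)`, the closure of `C_c^∞(Ω)` in `H¹(Ω)`. An element is a pair
consisting of a function in `L²(Ω)` and its weak gradient in `L²(Ω; ℝⁿ)`. -/
def H10 {n : ℕ} (_hn : 3 ≤ n) {Ω : Set (Euc n)} (_hΩ : IsSmoothBoundedDomain Ω) : Type :=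
  (testGraph Ω).topologicalClosure

section H10

variable {n : ℕ} {hn : 3 ≤ n} {Ω : Set (Euc n)} {hΩ : IsSmoothBoundedDomain Ω}

instance : AddCommGroup (H10 hn hΩ) :=
  inferInstanceAs (AddCommGroup (testGraph Ω).topologicalClosure)

instance : Module ℝ (H10 hn hΩ) :=
  inferInstanceAs (Module ℝ (testGraph Ω).topologicalClosure)

/-- The function underlying an element of `H¹₀(Ω)`. -/
def H10.fn : H10 hn hΩ →ₗ[ℝ] Lp ℝ 2 (volume.restrict Ω) :=
  (LinearMap.fst ℝ _ _).comp (testGraph Ω).topologicalClosure.subtype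

/-- The weak gradient of an element of `H¹₀(Ω)`. -/
def H10.grad : H10 hn hΩ →ₗ[ℝ] Lp (Euc n) 2 (volume.restrict Ω) :=
  (LinearMap.snd ℝ _ _).comp (testGraph Ω).topologicalClosure.subtype

theorem H10.norm_fn_le : ∃ C : ℝ≥0, ∀ u : H10 hn hΩ, ‖H10.fn u‖ ≤ C * ‖H10.grad u‖ := by
  obtain ⟨C, hC⟩ := poincare hn hΩ.isBounded
  exact ⟨C, fun u => hC u.1 u.2⟩

theorem H10.grad_injective : Function.Injective (H10.grad (hn := hn) (hΩ := hΩ)) := by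
  rw [← LinearMap.ker_eq_bot, LinearMap.ker_eq_bot']
  intro u hu
  obtain ⟨C, hC⟩ := H10.norm_fn_le (hn := hn) (hΩ := hΩ)
  have h := hC u
  rw [hu, norm_zero, mul_zero] at h
  exact Subtype.ext (Prod.ext (norm_le_zero_iff.1 h) hu)

/-- `‖u‖ = (∫_Ω |∇u|²)^{1/2}`. -/
instance : NormedAddCommGroup (H10 hn hΩ) :=
  NormedAddCommGroup.induced _ _ H10.grad H10.grad_injective

theorem H10.norm_eq (u : H10 hn hΩ) : ‖u‖ = ‖H10.grad u‖ := rfl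

/-- `⟨u, v⟩ = ∫_Ω ∇u · ∇v`. -/
instance : InnerProductSpace ℝ (H10 hn hΩ) where
  norm_smul_le c u := by simp only [H10.norm_eq, map_smul]; exact norm_smul_le _ _
  inner u v := ∫ x in Ω, ⟪H10.grad u x, H10.grad v x⟫_ℝ
  norm_sq_eq_re_inner u := by
    rw [H10.norm_eq, norm_sq_eq_re_inner (𝕜 := ℝ), L2.inner_def]
  conj_inner_symm u v := by
    have := inner_conj_symm (𝕜 := ℝ) (H10.grad u) (H10.grad v)
    simpa only [L2.inner_def] using this
  add_left u v w := by
    have := inner_add_left (𝕜 := ℝ) (H10.grad u) (H10.grad v) (H10.grad w)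
    rw [← map_add] at this
    simpa only [L2.inner_def] using this
  smul_left u v c := by
    have := inner_smul_left (𝕜 := ℝ) (H10.grad u) (H10.grad v) c
    rw [← map_smul] at this
    simpa only [L2.inner_def] using this

theorem H10.inner_def (u v : H10 hn hΩ) :
    ⟪u, v⟫_ℝ = ∫ x in Ω, ⟪H10.grad u x, H10.grad v x⟫_ℝ := rfl

instance : CompleteSpace (H10 hn hΩ) := by
  have hiso : Isometry (H10.grad (hn := hn) (hΩ := hΩ)) :=
    AddMonoidHomClass.isometry_of_norm _ fun _ => rfl
  rw [completeSpace_iff_isComplete_range hiso.isUniformInducing]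
  refine IsClosed.isComplete (isSeqClosed_iff_isClosed.1 ?_)
  intro g G hg hG
  choose u hu using hg
  obtain rfl : (fun k => H10.grad (u k)) = g := funext hu
  obtain ⟨C, hC⟩ := H10.norm_fn_le (hn := hn) (hΩ := hΩ)
  have hcau : CauchySeq fun k => H10.fn (u k) := by
    have hlip : LipschitzWith C (fun v : H10 hn hΩ => H10.fn v) :=
      AddMonoidHomClass.lipschitz_of_bound_nnnorm H10.fn C hC
    exact hlip.uniformContinuous.comp_cauchySeq
      (hiso.isUniformInducing.cauchy_map_iff.1 hG.cauchySeq)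
  obtain ⟨F, hF⟩ := cauchySeq_tendsto_of_complete hcau
  have hmem : (F, G) ∈ (testGraph Ω).topologicalClosure :=
    (testGraph Ω).isClosed_topologicalClosure.mem_of_tendsto (hF.prodMk_nhds hG)
      (Filter.Eventually.of_forall fun k => (u k).2)
  exact ⟨⟨(F, G), hmem⟩, rfl⟩

end H10

/-- `c₀ = (n(n-2))^{(n-2)/4}`. -/
def c₀ (n : ℕ) : ℝ := ((n : ℝ) * ((n : ℝ) - 2)) ^ (((n : ℝ) - 2) / 4)

/-- The bubble `δ_{(a,λ)}`. -/
def bubble {n : ℕ} (a : Euc n) (l : ℝ) (y : Euc n) : ℝ :=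
  c₀ n * l ^ (((n : ℝ) - 2) / 2) / (1 + l ^ 2 * ‖y - a‖ ^ 2) ^ (((n : ℝ) - 2) / 2)

theorem contDiff_bubble {n : ℕ} (a : Euc n) (l : ℝ) : ContDiff ℝ ∞ (bubble a l) := by
  have hpos : ∀ y : Euc n, 0 < 1 + l ^ 2 * ‖y - a‖ ^ 2 := fun y => by positivity
  unfold bubble
  refine contDiff_const.div (ContDiff.rpow_const_of_ne ?_ fun y => (hpos y).ne') fun y =>
    (Real.rpow_pos_of_pos (hpos y) _).ne'
  exact contDiff_const.add (contDiff_const.mul ((contDiff_id.sub contDiff_const).norm_sq ℝ))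

theorem memLp_gradient_bubble {n : ℕ} {Ω : Set (Euc n)} (hΩ : Bornology.IsBounded Ω)
    (a : Euc n) (l : ℝ) : MemLp (∇ (bubble a l)) 2 (volume.restrict Ω) := by
  have hcont : Continuous (∇ (bubble a l)) :=
    (InnerProductSpace.toDual ℝ (Euc n)).symm.continuous.comp
      ((contDiff_bubble a l).continuous_fderiv (by simp))
  have hK : IsCompact (closure Ω) := hΩ.isCompact_closure
  obtain ⟨B, hB⟩ := hK.exists_bound_of_continuousOn hcont.continuousOn
  have h : MemLp (∇ (bubble a l)) 2 (volume.restrict (closure Ω)) := by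
    have : IsFiniteMeasure (volume.restrict (closure Ω)) :=
      isFiniteMeasure_restrict.2 hK.measure_ne_top
    exact MemLp.of_bound hcont.aestronglyMeasurable B
      ((ae_restrict_iff' isClosed_closure.measurableSet).2 (Filter.Eventually.of_forall hB))
  exact h.mono_measure (Measure.restrict_mono subset_closure le_rfl)

section Projection

variable {n : ℕ} (hn : 3 ≤ n) {Ω : Set (Euc n)} (hΩ : IsSmoothBoundedDomain Ω)

/-- The projection `Pδ_{(a,λ)}` of the bubble onto `H¹₀(Ω)`, i.e. the weak solution of
`-Δ Pδ = -Δ δ` in `Ω`, `Pδ = 0` on `∂Ω`. It is the Riesz representative of the functional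
`v ↦ ∫_Ω ∇δ · ∇v`; see `inner_projBubble`. -/
def projBubble (a : Euc n) (l : ℝ) : H10 hn hΩ :=
  (InnerProductSpace.toDual ℝ (H10 hn hΩ)).symm
    (LinearMap.mkContinuous
      ((innerₛₗ ℝ (memLp_gradient_bubble hΩ.isBounded a l).toLp).comp H10.grad)
      ‖(memLp_gradient_bubble hΩ.isBounded a l).toLp‖ fun v =>
        norm_inner_le_norm (𝕜 := ℝ) (memLp_gradient_bubble hΩ.isBounded a l).toLp (H10.grad v))

theorem inner_projBubble (a : Euc n) (l : ℝ) (v : H10 hn hΩ) :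
    ⟪projBubble hn hΩ a l, v⟫_ℝ = ∫ x in Ω, ⟪∇ (bubble a l) x, H10.grad v x⟫_ℝ := by
  have hcoe := (memLp_gradient_bubble hΩ.isBounded a l).coeFn_toLp
  rw [projBubble, InnerProductSpace.toDual_symm_apply]
  change ⟪(memLp_gradient_bubble hΩ.isBounded a l).toLp, H10.grad v⟫_ℝ = _
  rw [L2.inner_def]
  refine integral_congr_ae ?_
  filter_upwards [hcoe] with x hx
  rw [hx]

end Projection

/-- `g` is the weak gradient of `u` on `ℝⁿ`. -/
def IsWeakGradient {n : ℕ} (u : Euc n → ℝ) (g : Euc n → Euc n) : Prop :=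
  ∀ φ : Euc n → ℝ, IsTestFunction univ φ → ∫ x, u x • ∇ φ x = -∫ x, φ x • g x

/-- The best Sobolev constant
`S_n = inf {‖∇u‖²_{L²} ‖u‖⁻²_{L^{2n/(n-2)}} : u ≢ 0, ∇u ∈ L², u ∈ L^{2n/(n-2)}}` of `ℝⁿ`. -/
def sobolevConst (n : ℕ) : ℝ :=
  sInf {r | ∃ (u : Euc n → ℝ) (g : Euc n → Euc n),
    MemLp u (ENNReal.ofReal (2 * n / ((n : ℝ) - 2))) volume ∧ ¬ (u =ᵐ[volume] 0) ∧
    IsWeakGradient u g ∧ MemLp g 2 volume ∧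
    r = (eLpNorm g 2 volume).toReal ^ 2 /
      (eLpNorm u (ENNReal.ofReal (2 * n / ((n : ℝ) - 2))) volume).toReal ^ 2}

/-- The critical exponent `p = (n+2)/(n-2)`. -/
def critExp (n : ℕ) : ℝ := ((n : ℝ) + 2) / ((n : ℝ) - 2)

/-- The nonlinearity `f_ε(s) = |s|^{p-1} s / [ln(e+|s|)]^ε`. -/
def nonlin (n : ℕ) (ε s : ℝ) : ℝ :=
  |s| ^ (critExp n - 1) * s / Real.log (Real.exp 1 + |s|) ^ ε

/-- The primitive `F_ε(s) = ∫_0^s f_ε`. -/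
def nonlinPrim (n : ℕ) (ε s : ℝ) : ℝ := ∫ t in (0 : ℝ)..s, nonlin n ε t

/-- The energy `I_ε(u) = ½ ∫_Ω |∇u|² - ∫_Ω F_ε(u)` on `H¹₀(Ω)`. -/
def energy {n : ℕ} {hn : 3 ≤ n} {Ω : Set (Euc n)} {hΩ : IsSmoothBoundedDomain Ω} (ε : ℝ)
    (u : H10 hn hΩ) : ℝ :=
  1 / 2 * (∫ x in Ω, ‖H10.grad u x‖ ^ 2) - (∫ x in Ω, nonlinPrim n ε (H10.fn u x))

/-- `ε_{ij} = (λ_i/λ_j + λ_j/λ_i + λ_i λ_j |a_i - a_j|²)^{(2-n)/2}`. -/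
def interaction {n : ℕ} (ai aj : Euc n) (li lj : ℝ) : ℝ :=
  (li / lj + lj / li + li * lj * ‖ai - aj‖ ^ 2) ^ ((2 - (n : ℝ)) / 2)

/-- The distance `d(a, ∂Ω)`. -/
def bdist {n : ℕ} (Ω : Set (Euc n)) (a : Euc n) : ℝ := Metric.infDist a (frontier Ω)

/-- `u = ∑ α_j γ_j Pδ_{(a_j,λ_j)} + v` is a representation of `u` with the parameters and the
remainder allowed in the definition of the set `V(m,η)` (for the signs `γ`). -/
structure IsVRepresentation {n : ℕ} {hn : 3 ≤ n} {Ω : Set (Euc n)}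
    {hΩ : IsSmoothBoundedDomain Ω} {m : ℕ} (γ : Fin m → ℝ) (η : ℝ) (u : H10 hn hΩ)
    (α l : Fin m → ℝ) (a : Fin m → Euc n) (v : H10 hn hΩ) : Prop where
  eq_add : u = ∑ j, (α j * γ j) • projBubble hn hΩ (a j) (l j) + v
  norm_lt : ‖v‖ < η
  mem : ∀ j, a j ∈ Ω
  conc : ∀ j, η⁻¹ < l j
  coeff_pos : ∀ j, 0 < α j
  coeff : ∀ j, |α j - 1| < η
  dist : ∀ j, η⁻¹ < l j * bdist Ω (a j)
  inter : ∀ i j, i ≠ j → interaction (a i) (a j) (l i) (l j) < η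

/-- The set `V(m,η)` (for the signs `γ`). -/
def V {n : ℕ} (hn : 3 ≤ n) {Ω : Set (Euc n)} (hΩ : IsSmoothBoundedDomain Ω) {m : ℕ}
    (γ : Fin m → ℝ) (η : ℝ) : Set (H10 hn hΩ) :=
  {u | ∃ α l a v, IsVRepresentation γ η u α l a v}

end CriticalBubbles

end

open CriticalBubbles

noncomputable section

namespace CriticalBubbles

/-! Pairing the gradient with Pδ_i gives ⟨u, Pδ_i⟩ − ∫ f_ε(u) Pδ_i. Let A = ∫ δ^{p+1} over ℝⁿ, which
depends neither on the centre nor on λ. Up to the permitted errors only the i-th bubble contributes: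
the first term is α_i γ_i ‖Pδ_i‖² ≈ α_i γ_i A, and the second is γ_i α_i^p ∫ (Pδ_i)^{p+1} ≈ γ_i
α_i^p A.

The errors have four sources. The projection: by the maximum principle 0 ≤ Pδ ≤ δ, and δ − Pδ is at
most the value of δ at distance d/2 from its centre; multiplied by ∫ δ^p this is O((λd)^{2−n})
(`le_norm_sq_projBubble`, `le_integral_fn_projBubble_rpow`). The other bubbles: ⟨Pδ_i, Pδ_j⟩ is at
most ∫ δ_i^p δ_j = O(ε_ij), by a pointwise estimate at the scale of the more concentrated bubble
(`rpow_mul_bubbleJap_le`); the cross terms in f_ε(u) reduce to the same products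
(`abs_integral_nonlin_sum_sub_le`). The remainder v: f_ε is locally Lipschitz with constant
p|s|^{p−1} for every ε ≥ 0, so Hölder and Sobolev give O(‖v‖) (`abs_integral_nonlin_add_sub_le`).
The logarithm: 1 − [ln(e+s)]^{−ε} ≤ ε ln ln(e+s), and s = O(λ^{(n−2)/2}) makes this O(ε ln ln λ)
(`abs_integral_nonlin_projBubble_sub_le`).

It remains to see that A = S_n^{n/2}, that is, to compute the best Sobolev constant
(`sobolevConst_eq`). The sharp inequality is proved by mass transport. A positive f with ∫
f^{2n/(n−2)} = ∫ (1+|y|²)^{−n} is carried by Knothe's triangular map T onto the density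
(1+|y|²)^{−n}. The arithmetic-geometric mean inequality for the diagonal derivatives of T,
integration by parts in each coordinate and Young's inequality give the lower bound for ∫ |∇f|²
(`sobolev_of_integral_eq`), with equality throughout for the bubble. Regularisation, cutoffs and
mollification extend it to all competitors in the definition of S_n, and a bubble attains it. -/

/-! ### Integration by parts on the line against a monotone function -/

open Filter Topology in
/-- If `U ≥ 0`, `V` is nondecreasing and `UV`, `U'V` are integrable near `+∞`, so is `UV'`. -/
theorem integrableOn_Ioi_mul_deriv_of_nonneg {U V U' V' : ℝ → ℝ}
    (hU : ∀ x, HasDerivAt U (U' x) x) (hV : ∀ x, HasDerivAt V (V' x) x)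
    (hU'c : Continuous U') (hU0 : ∀ x, 0 ≤ U x) (hV0 : ∀ x, 0 ≤ V' x)
    (hUV : Integrable fun x => U x * V x) (hU'V : Integrable fun x => U' x * V x) :
    IntegrableOn (fun x => U x * V' x) (Ioi 0) := by
  have hVc : Continuous V := continuous_iff_continuousAt.2 fun x => (hV x).continuousAt
  set S : ℝ → ℝ := fun x => ∫ t in (0 : ℝ)..x, U' t * V t with hS
  have hSd : ∀ x, HasDerivAt S (U' x * V x) x := fun x =>
    intervalIntegral.integral_hasDerivAt_right (hU'V.intervalIntegrable)
      ((hU'c.mul hVc).stronglyMeasurableAtFilter _ _) (hU'c.mul hVc).continuousAt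
  have hW : ∀ x, HasDerivAt (fun x => U x * V x - S x) (U x * V' x) x := fun x => by
    have := ((hU x).mul (hV x)).sub (hSd x)
    refine this.congr_deriv ?_
    ring
  -- The derivative of UV − S is UV' ≥ 0, so integrability of UV' amounts to convergence of this
  -- monotone function.
  have hmono : Monotone fun x => U x * V x - S x :=
    monotone_of_deriv_nonneg (fun x => (hW x).differentiableAt) fun x => by
      rw [(hW x).deriv]; exact mul_nonneg (hU0 x) (hV0 x)
  have hSlim : Tendsto S atTop (𝓝 (∫ t in Ioi (0 : ℝ), U' t * V t)) :=
    intervalIntegral_tendsto_integral_Ioi 0 hU'V.integrableOn tendsto_id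
  rcases tendsto_atTop_of_monotone hmono with h | ⟨l, hl⟩
  -- Since S converges, blow-up would force UV → ∞, against the integrability of UV.
  · exfalso
    have h2 : Tendsto (fun x => U x * V x) atTop atTop := by
      have := h.atTop_add hSlim
      simpa using this
    obtain ⟨a, ha⟩ := (h2.eventually_ge_atTop 1).exists_forall_of_atTop
    have hi : IntegrableOn (fun _ : ℝ => (1 : ℝ)) (Ioi a) := by
      refine Integrable.mono' (hUV.integrableOn (s := Ioi a)) (by fun_prop) ?_
      filter_upwards [ae_restrict_mem measurableSet_Ioi] with x hx
      simpa using ha x (le_of_lt hx)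
    rw [integrableOn_const_iff] at hi
    simp at hi
  · exact integrableOn_Ioi_deriv_of_nonneg' (fun x _ => hW x)
      (fun x _ => mul_nonneg (hU0 x) (hV0 x)) hl

/-- Integration by parts on `ℝ` against a nondecreasing function. -/
theorem integral_mul_deriv_of_nonneg {U V U' V' : ℝ → ℝ}
    (hU : ∀ x, HasDerivAt U (U' x) x) (hV : ∀ x, HasDerivAt V (V' x) x)
    (hU'c : Continuous U') (hU0 : ∀ x, 0 ≤ U x) (hV0 : ∀ x, 0 ≤ V' x)
    (hUV : Integrable fun x => U x * V x) (hU'V : Integrable fun x => U' x * V x) :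
    Integrable (fun x => U x * V' x) ∧ ∫ x, U x * V' x = -∫ x, U' x * V x := by
  have h1 := integrableOn_Ioi_mul_deriv_of_nonneg hU hV hU'c hU0 hV0 hUV hU'V
  -- The left half-line is reflected onto the right one; the sign in −V(−x) keeps the second factor
  -- nondecreasing.
  have h2 : IntegrableOn (fun x => U (-x) * V' (-x)) (Ioi 0) := by
    refine integrableOn_Ioi_mul_deriv_of_nonneg (U := fun x => U (-x)) (V := fun x => -V (-x))
      (U' := fun x => -U' (-x)) (V' := fun x => V' (-x)) (fun x => ?_) (fun x => ?_)
      (by fun_prop) (fun x => hU0 _) (fun x => hV0 _) ?_ ?_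
    · simpa [Function.comp_def] using (hU (-x)).scomp x (hasDerivAt_neg x)
    · simpa [Function.comp_def] using ((hV (-x)).scomp x (hasDerivAt_neg x)).fun_neg
    · simpa using hUV.comp_neg.neg
    · simpa using hU'V.comp_neg
  have h3 : IntegrableOn (fun x => U x * V' x) (Iic 0) := by
    have h4 := (integrableOn_Ici_iff_integrableOn_Ioi).2 h2
    have := (Measure.measurePreserving_neg (volume : Measure ℝ)).integrableOn_comp_preimage
      (MeasurableEquiv.neg ℝ).measurableEmbedding (f := fun x => U x * V' x) (s := Iic 0)
    rw [← this]
    simpa [Function.comp_def] using h4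
  have h5 : Integrable fun x => U x * V' x := by
    rw [← integrableOn_univ, ← Iic_union_Ioi (a := (0 : ℝ))]
    exact h3.union h1
  exact ⟨h5, integral_mul_deriv_eq_deriv_mul_of_integrable (fun x _ => hU x) (fun x _ => hV x)
    h5 hU'V hUV⟩

/-! ### Monotone rearrangement of densities on the line -/

theorem integral_pos_of_pos {α : Type*} [MeasurableSpace α] {μ : Measure α} [NeZero μ]
    {f : α → ℝ} (hf0 : ∀ x, 0 < f x) (hfi : Integrable f μ) : 0 < ∫ x, f x ∂μ := by
  rw [integral_pos_iff_support_of_nonneg (fun x => (hf0 x).le) hfi,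
    eq_univ_of_forall (s := Function.support f) fun x => (hf0 x).ne']
  exact NeZero.pos _

/-- The normalised distribution function of a density on `ℝ`. -/
def distrib (f : ℝ → ℝ) (t : ℝ) : ℝ := (∫ x in Iic t, f x) / ∫ x, f x

section distrib

variable {f g : ℝ → ℝ}


theorem hasDerivAt_distrib (hfc : Continuous f) (hfi : Integrable f) (t : ℝ) :
    HasDerivAt (distrib f) (f t / ∫ x, f x) t := by
  have h : ∀ s, ∫ x in Iic s, f x = (∫ x in (0 : ℝ)..s, f x) + ∫ x in Iic 0, f x := fun s => by
    rw [← intervalIntegral.integral_Iic_sub_Iic hfi.integrableOn hfi.integrableOn]; ring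
  have h1 : HasDerivAt (fun s => ∫ x in Iic s, f x) (f t) t := by
    rw [funext h]
    exact (intervalIntegral.integral_hasDerivAt_right hfi.intervalIntegrable
      (hfc.stronglyMeasurableAtFilter _ _) hfc.continuousAt).add_const _
  exact h1.div_const _

theorem strictMono_distrib (hfc : Continuous f) (hf0 : ∀ x, 0 < f x) (hfi : Integrable f) :
    StrictMono (distrib f) :=
  strictMono_of_deriv_pos fun t => by
    rw [(hasDerivAt_distrib hfc hfi t).deriv]
    exact div_pos (hf0 t) (integral_pos_of_pos hf0 hfi)

/-- Both distribution functions increase strictly and continuously from 0 to 1, so a value of one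
lies strictly between 0 and 1 and is taken by the other. -/
theorem exists_distrib_eq (hgc : Continuous g) (hg0 : ∀ x, 0 < g x) (hgi : Integrable g)
    (hfc : Continuous f) (hf0 : ∀ x, 0 < f x) (hfi : Integrable f) (t : ℝ) :
    ∃ s, distrib g s = distrib f t := by
  have htop : ∀ {f : ℝ → ℝ}, Continuous f → (∀ x, 0 < f x) → Integrable f →
      Filter.Tendsto (distrib f) Filter.atTop (nhds 1) := fun {f} hfc hf0 hfi => by
    have hi := integral_pos_of_pos hf0 hfi
    have h := tendsto_setIntegral_of_monotone (μ := volume) (f := f) (s := fun t : ℝ => Iic t)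
      (fun _ => measurableSet_Iic) (fun a b hab => Iic_subset_Iic.2 hab) hfi.integrableOn
    have h2 : (⋃ n : ℝ, Iic n) = univ := iUnion_Iic
    rw [h2, setIntegral_univ] at h
    have := h.div_const (∫ x, f x)
    rwa [div_self hi.ne'] at this
  have hbot : ∀ {f : ℝ → ℝ}, Filter.Tendsto (distrib f) Filter.atBot (nhds 0) := fun {f} => by
    have := (tendsto_integral_Iic_zero (μ := volume) (f := f)
      (Filter.tendsto_id (x := Filter.atBot))).div_const (∫ x, f x)
    rwa [zero_div] at this
  have hsm := strictMono_distrib hfc hf0 hfi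
  have h1 : distrib f t < 1 := (hsm (lt_add_one t)).trans_le
    (hsm.monotone.ge_of_tendsto (htop hfc hf0 hfi) _)
  have h0 : 0 < distrib f t := (hsm.monotone.le_of_tendsto hbot _).trans_lt (hsm (sub_one_lt t))
  have hc : Continuous (distrib g) :=
    continuous_iff_continuousAt.2 fun x => (hasDerivAt_distrib hgc hgi x).continuousAt
  exact mem_range_of_exists_le_of_exists_ge hc
    ((hbot.eventually (gt_mem_nhds h0)).exists.imp fun _ h => h.le)
    (((htop hgc hg0 hgi).eventually (lt_mem_nhds h1)).exists.imp fun _ h => h.le)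

/-- The monotone rearrangement of the density `f` into the density `g`. -/
theorem hasDerivAt_of_distrib_eq (hgc : Continuous g) (hg0 : ∀ x, 0 < g x) (hgi : Integrable g)
    (hfc : Continuous f) (hf0 : ∀ x, 0 < f x) (hfi : Integrable f) {τ : ℝ → ℝ}
    (hτ : ∀ t, distrib g (τ t) = distrib f t) (t : ℝ) :
    HasDerivAt τ ((f t / ∫ x, f x) / (g (τ t) / ∫ x, g x)) t := by
  have hmf := strictMono_distrib hfc hf0 hfi
  have hmg := strictMono_distrib hgc hg0 hgi
  have hmono : StrictMono τ := fun a b hab => by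
    rw [← hmg.lt_iff_lt, hτ, hτ]; exact hmf hab
  have hsurj : Function.Surjective τ := fun s => by
    obtain ⟨t, ht⟩ := exists_distrib_eq hfc hf0 hfi hgc hg0 hgi s
    exact ⟨t, hmg.injective (by rw [hτ, ht])⟩
  -- A monotone surjection has no jumps. Continuity lets the slope of the distribution function of g
  -- be evaluated along τ.
  have hcont : Continuous τ := hmono.monotone.continuous_of_surjective hsurj
  have hG := hasDerivAt_distrib hgc hgi (τ t)
  have hF := hasDerivAt_distrib hfc hfi t
  have hne : g (τ t) / ∫ x, g x ≠ 0 :=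
    (div_pos (hg0 _) (integral_pos_of_pos hg0 hgi)).ne'
  -- difference quotients
  rw [hasDerivAt_iff_tendsto_slope] at hF ⊢
  rw [hasDerivAt_iff_tendsto_slope] at hG
  have h1 : Filter.Tendsto τ (nhdsWithin t {t}ᶜ) (nhdsWithin (τ t) {τ t}ᶜ) :=
    tendsto_nhdsWithin_of_tendsto_nhds_of_eventually_within _
      (hcont.continuousAt.tendsto.mono_left nhdsWithin_le_nhds)
      (by filter_upwards [self_mem_nhdsWithin] with s hs h
          exact hs (hmono.injective h))
  refine (hF.div (hG.comp h1) hne).congr' ?_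
  filter_upwards [self_mem_nhdsWithin] with s hs
  have hs' : s - t ≠ 0 := sub_ne_zero.2 hs
  have hd : distrib f s - distrib f t ≠ 0 := sub_ne_zero.2 fun h => hs (hmf.injective h)
  have hτs : τ s - τ t ≠ 0 := sub_ne_zero.2 fun h => hs (hmono.injective h)
  simp only [slope_def_field, Function.comp_apply, hτ, Pi.div_apply]
  field_simp

/-- Change of variables along the increasing bijection τ, whose derivative is the quotient of the
normalised densities. No measurability of h is involved. -/
theorem lintegral_comp_of_distrib_eq (hgc : Continuous g) (hg0 : ∀ x, 0 < g x)
    (hgi : Integrable g) (hfc : Continuous f) (hf0 : ∀ x, 0 < f x) (hfi : Integrable f)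
    {τ : ℝ → ℝ} (hτ : ∀ t, distrib g (τ t) = distrib f t) (h : ℝ → ℝ≥0∞) :
    ∫⁻ t, h (τ t) * ENNReal.ofReal (f t / ∫ x, f x) =
      ∫⁻ s, h s * ENNReal.ofReal (g s / ∫ x, g x) := by
  have hd := hasDerivAt_of_distrib_eq hgc hg0 hgi hfc hf0 hfi hτ
  have hmf := strictMono_distrib hfc hf0 hfi
  have hmg := strictMono_distrib hgc hg0 hgi
  have hinj : Function.Injective τ := fun a b hab => hmf.injective (by rw [← hτ, ← hτ, hab])
  have hsurj : Function.Surjective τ := fun s => by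
    obtain ⟨t, ht⟩ := exists_distrib_eq hfc hf0 hfi hgc hg0 hgi s
    exact ⟨t, hmg.injective (by rw [hτ, ht])⟩
  have key := lintegral_image_eq_lintegral_abs_deriv_mul MeasurableSet.univ
    (fun x _ => (hd x).hasDerivWithinAt) hinj.injOn
    (fun s => h s * ENNReal.ofReal (g s / ∫ x, g x))
  rw [image_univ, hsurj.range_eq, setLIntegral_univ, setLIntegral_univ] at key
  rw [key]
  refine lintegral_congr fun t => ?_
  have hF : 0 < f t / ∫ x, f x := div_pos (hf0 _) (integral_pos_of_pos hf0 hfi)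
  have hG : 0 < g (τ t) / ∫ x, g x :=
    div_pos (hg0 _) (integral_pos_of_pos hg0 hgi)
  rw [abs_of_pos (div_pos hF hG), mul_left_comm, ← ENNReal.ofReal_mul (div_pos hF hG).le,
    div_mul_cancel₀ _ hG.ne']

end distrib

/-! ### Fubini's theorem with one coordinate singled out -/

section insertNth

variable {n : ℕ} (i : Fin (n + 1))

theorem measurePreserving_insertNth :
    MeasurePreserving (fun z : (Fin n → ℝ) × ℝ => (i.insertNth z.2 z.1 : Fin (n + 1) → ℝ)) :=
  ((volume_preserving_piFinSuccAbove (fun _ => ℝ) i).symm _).comp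
    Measure.measurePreserving_swap

theorem measurableEmbedding_insertNth :
    MeasurableEmbedding (fun z : (Fin n → ℝ) × ℝ => (i.insertNth z.2 z.1 : Fin (n + 1) → ℝ)) :=
  ((MeasurableEquiv.prodComm).trans
    (MeasurableEquiv.piFinSuccAbove (fun _ : Fin (n + 1) => ℝ) i).symm).measurableEmbedding

theorem lintegral_insertNth {h : (Fin (n + 1) → ℝ) → ℝ≥0∞} (hh : Measurable h) :
    ∫⁻ x, h x = ∫⁻ x', ∫⁻ t, h (i.insertNth t x') := by
  rw [← (measurePreserving_insertNth i).lintegral_comp hh, Measure.volume_eq_prod]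
  exact lintegral_prod _ (hh.comp (measurePreserving_insertNth i).measurable).aemeasurable

theorem integrable_insertNth_iff {h : (Fin (n + 1) → ℝ) → ℝ} :
    Integrable (fun z : (Fin n → ℝ) × ℝ => h (i.insertNth z.2 z.1)) (volume.prod volume) ↔
      Integrable h :=
  (measurePreserving_insertNth i).integrable_comp_emb (measurableEmbedding_insertNth i)

theorem integral_insertNth {h : (Fin (n + 1) → ℝ) → ℝ} (hh : Integrable h) :
    ∫ x, h x = ∫ x', ∫ t, h (i.insertNth t x') := by
  rw [← (measurePreserving_insertNth i).integral_comp (measurableEmbedding_insertNth i),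
    Measure.volume_eq_prod, integral_prod _ ((integrable_insertNth_iff i).2 hh)]

end insertNth

/-! ### Densities of Cauchy decay and their marginals -/

/-- A positive continuous density on `ℝⁿ`, bounded by a product of Cauchy densities. -/
structure IsCauchyBounded {n : ℕ} (F : (Fin n → ℝ) → ℝ) : Prop where
  continuous : Continuous F
  pos : ∀ x, 0 < F x
  bound : ∃ C, ∀ x, F x ≤ C * ∏ i, (1 + x i ^ 2)⁻¹

namespace IsCauchyBounded

theorem integrable {n : ℕ} {F : (Fin n → ℝ) → ℝ} (hF : IsCauchyBounded F) : Integrable F := by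
  obtain ⟨C, hC⟩ := hF.bound
  refine Integrable.mono' (((Integrable.fintype_prod (f := fun (_ : Fin n) (t : ℝ) => (1 + t ^ 2)⁻¹)
    fun _ => integrable_inv_one_add_sq)).const_mul C) hF.continuous.aestronglyMeasurable
    (Filter.Eventually.of_forall fun x => ?_)
  rw [Real.norm_of_nonneg (hF.pos x).le]
  exact hC x

variable {n : ℕ} {F : (Fin (n + 1) → ℝ) → ℝ}

theorem exists_bound_cons (hF : IsCauchyBounded F) : ∃ C, 0 ≤ C ∧ ∀ t x,
    F (Fin.cons t x) ≤ C * (1 + t ^ 2)⁻¹ * ∏ i, (1 + x i ^ 2)⁻¹ := by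
  obtain ⟨C, hC⟩ := hF.bound
  refine ⟨C, ?_, fun t x => ?_⟩
  · have h1 := (hF.pos 0).trans_le (hC 0)
    simp at h1
    exact h1.le
  · have := hC (Fin.cons t x)
    rw [Fin.prod_univ_succ] at this
    simpa [mul_assoc] using this

theorem continuous_cons (hF : IsCauchyBounded F) :
    Continuous fun z : (Fin n → ℝ) × ℝ => F (Fin.cons z.2 z.1) :=
  hF.continuous.comp (Continuous.finCons (A := fun _ => ℝ) continuous_snd continuous_fst)

theorem continuous_slice (hF : IsCauchyBounded F) (x : Fin n → ℝ) :
    Continuous fun t => F (Fin.cons t x) :=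
  hF.continuous_cons.comp (by fun_prop : Continuous fun t : ℝ => (x, t))

theorem prod_le_one (x : Fin n → ℝ) : ∏ i, (1 + x i ^ 2)⁻¹ ≤ 1 :=
  Finset.prod_le_one (fun i _ => by positivity) fun i _ =>
    inv_le_one_of_one_le₀ (by nlinarith [sq_nonneg (x i)])

theorem slice_le (hF : IsCauchyBounded F) : ∃ C, ∀ t x, F (Fin.cons t x) ≤ C * (1 + t ^ 2)⁻¹ := by
  obtain ⟨C, hC0, hC⟩ := hF.exists_bound_cons
  exact ⟨C, fun t x => (hC t x).trans (mul_le_of_le_one_right (by positivity) (prod_le_one x))⟩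

theorem integrable_slice (hF : IsCauchyBounded F) (x : Fin n → ℝ) :
    Integrable fun t => F (Fin.cons t x) := by
  obtain ⟨C, hC⟩ := hF.slice_le
  refine Integrable.mono' (integrable_inv_one_add_sq.const_mul C)
    (hF.continuous_slice x).aestronglyMeasurable (Filter.Eventually.of_forall fun t => ?_)
  rw [Real.norm_of_nonneg (hF.pos _).le]
  exact hC t x

/-- The product form of the bound survives integration over one coordinate, so this class of
densities is stable under the induction that builds the Knothe map. Continuity is dominated
convergence with the Cauchy density as majorant. -/
theorem marginal (hF : IsCauchyBounded F) :
    IsCauchyBounded fun x : Fin n → ℝ => ∫ t, F (Fin.cons t x) where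
  continuous := by
    obtain ⟨C, hC⟩ := hF.slice_le
    refine continuous_of_dominated (fun x => (hF.continuous_slice x).aestronglyMeasurable)
      (fun x => Filter.Eventually.of_forall fun t => ?_) (integrable_inv_one_add_sq.const_mul C)
      (Filter.Eventually.of_forall fun t => hF.continuous_cons.comp
        (by fun_prop : Continuous fun x : Fin n → ℝ => (x, t)))
    rw [Real.norm_of_nonneg (hF.pos _).le]
    exact hC t x
  pos x := integral_pos_of_pos (fun t => hF.pos _) (hF.integrable_slice x)
  bound := by
    obtain ⟨C, hC0, hC⟩ := hF.exists_bound_cons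
    refine ⟨C * ∫ t : ℝ, (1 + t ^ 2)⁻¹, fun x => ?_⟩
    have := integral_mono (hF.integrable_slice x)
      ((integrable_inv_one_add_sq.const_mul C).mul_const (∏ i, (1 + x i ^ 2)⁻¹)) (fun t => hC t x)
    rwa [integral_mul_const, integral_const_mul] at this

theorem integral_marginal (hF : IsCauchyBounded F) :
    ∫ x : Fin n → ℝ, ∫ t, F (Fin.cons t x) = ∫ x, F x := by
  rw [integral_insertNth 0 hF.integrable]
  simp only [Fin.insertNth_zero']

/-- Joint measurability in the slice and the endpoint, which the Knothe map inherits; it comes from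
writing the integral over the moving half-line with an indicator. -/
theorem measurable_distrib_slice (hF : IsCauchyBounded F) :
    Measurable fun z : (Fin n → ℝ) × ℝ => distrib (fun t => F (Fin.cons t z.1)) z.2 := by
  have h1 : StronglyMeasurable fun z : (Fin n → ℝ) × ℝ =>
      ∫ t, (Iic z.2).indicator (fun t => F (Fin.cons t z.1)) t := by
    refine StronglyMeasurable.integral_prod_right (f := fun (z : (Fin n → ℝ) × ℝ) t =>
      (Iic z.2).indicator (fun t => F (Fin.cons t z.1)) t) ?_
    have hm : MeasurableSet {w : ((Fin n → ℝ) × ℝ) × ℝ | w.2 ≤ w.1.2} :=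
      measurableSet_le (by fun_prop) (by fun_prop)
    have hc : Continuous fun w : ((Fin n → ℝ) × ℝ) × ℝ => F (Fin.cons w.2 w.1.1) :=
      hF.continuous_cons.comp (by fun_prop : Continuous fun w : ((Fin n → ℝ) × ℝ) × ℝ =>
        (w.1.1, w.2))
    exact hc.stronglyMeasurable.indicator hm
  have h2 : Measurable fun z : (Fin n → ℝ) × ℝ => ∫ t, F (Fin.cons t z.1) :=
    hF.marginal.continuous.measurable.comp measurable_fst
  simp only [integral_indicator measurableSet_Iic] at h1
  exact h1.measurable.div h2

end IsCauchyBounded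

/-! ### The Knothe map -/

/-- The Knothe rearrangement of `F` into `G`: a triangular map, monotone in the diagonal
directions, with diagonal derivatives `D`. -/
structure IsKnotheMap {n : ℕ} (F G : (Fin n → ℝ) → ℝ) (T D : (Fin n → ℝ) → Fin n → ℝ) : Prop where
  measurable_map : Measurable T
  measurable_deriv : Measurable D
  lintegral_comp : ∀ h : (Fin n → ℝ) → ℝ≥0∞, Measurable h →
    ∫⁻ x, h (T x) * ENNReal.ofReal (F x) = ∫⁻ y, h y * ENNReal.ofReal (G y)
  deriv_pos : ∀ x i, 0 < D x i
  eq_prod : ∀ x, F x = G (T x) * ∏ i, D x i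
  hasDerivAt : ∀ x i, HasDerivAt (fun t => T (Function.update x i t) i) (D x i) (x i)

/-- Induction on the dimension: the marginals in all coordinates but the first are transported by
hypothesis, and over each tail the conditional density of F in the first coordinate is rearranged
monotonically into that of G over the image of the tail. The resulting map is triangular, and only
its diagonal derivatives are tracked; nothing is claimed about regularity in the other directions,
and the divergence structure used later does not need it. -/
theorem exists_knotheMap : ∀ {n : ℕ} {F G : (Fin n → ℝ) → ℝ}, IsCauchyBounded F →
    IsCauchyBounded G → ∫ x, F x = ∫ x, G x → ∃ T D, IsKnotheMap F G T D := by
  intro n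
  induction n with
  | zero =>
    intro F G hF hG hFG
    -- ℝ⁰ is a single point of mass one, so equal integrals mean equal densities.
    have h0 : F default = G default := by
      rw [Measure.volume_pi_eq_dirac default, integral_dirac, integral_dirac] at hFG
      exact hFG
    refine ⟨id, fun _ _ => 1, measurable_id, measurable_const, fun h hh => ?_,
      fun _ i => i.elim0, fun x => ?_, fun _ i => i.elim0⟩
    · refine lintegral_congr fun x => ?_
      rw [Subsingleton.elim x default, h0, id]
    · rw [Subsingleton.elim x default]
      simpa using h0
  | succ n ih =>
    intro F G hF hG hFG
    obtain ⟨T, D, hTD⟩ := ih hF.marginal hG.marginal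
      (by rw [hF.integral_marginal, hG.integral_marginal, hFG])
    have hex : ∀ (x : Fin n → ℝ) (t : ℝ), ∃ s,
        distrib (fun s => G (Fin.cons s (T x))) s = distrib (fun t => F (Fin.cons t x)) t :=
      fun x t => exists_distrib_eq (hG.continuous_slice _) (fun _ => hG.pos _)
        (hG.integrable_slice _) (hF.continuous_slice _) (fun _ => hF.pos _)
        (hF.integrable_slice _) t
    choose τ hτ using hex
    -- Strict monotonicity of the distribution function of G turns {τ ≤ c} into an inequality
    -- between two jointly measurable functions.
    have hτm : Measurable fun z : (Fin n → ℝ) × ℝ => τ z.1 z.2 := by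
      refine measurable_of_Iic fun c => ?_
      have : (fun z : (Fin n → ℝ) × ℝ => τ z.1 z.2) ⁻¹' Iic c = {z |
          distrib (fun t => F (Fin.cons t z.1)) z.2 ≤
            distrib (fun s => G (Fin.cons s (T z.1))) c} := by
        ext z
        simp only [mem_preimage, mem_Iic, mem_ofPred_eq, ← hτ]
        exact (strictMono_distrib (hG.continuous_slice _) (fun _ => hG.pos _)
          (hG.integrable_slice _)).le_iff_le.symm
      rw [this]
      exact measurableSet_le hF.measurable_distrib_slice
        (hG.measurable_distrib_slice.comp
          ((hTD.measurable_map.comp measurable_fst).prodMk measurable_const))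
    set F₁ : (Fin n → ℝ) → ℝ := fun x => ∫ t, F (Fin.cons t x) with hF₁
    set G₁ : (Fin n → ℝ) → ℝ := fun x => ∫ t, G (Fin.cons t x) with hG₁
    have hpair : Measurable fun x : Fin (n + 1) → ℝ => (Fin.tail x, x 0) :=
      (measurable_pi_lambda _ fun i => measurable_pi_apply _).prodMk (measurable_pi_apply _)
    have hcons : ∀ {a : (Fin (n + 1) → ℝ) → ℝ} {b : (Fin (n + 1) → ℝ) → Fin n → ℝ},
        Measurable a → Measurable b → Measurable fun x => (Fin.cons (a x) (b x) : Fin (n + 1) → ℝ) :=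
      fun ha hb => measurable_pi_lambda _ fun i => by
        refine Fin.cases ?_ (fun j => ?_) i
        · simpa using ha
        · simpa [Function.comp_def] using (measurable_pi_apply j).comp hb
    have htm : Measurable fun x : Fin (n + 1) → ℝ => Fin.tail x := measurable_fst.comp hpair
    have hTm : Measurable fun x : Fin (n + 1) → ℝ =>
        (Fin.cons (τ (Fin.tail x) (x 0)) (T (Fin.tail x)) : Fin (n + 1) → ℝ) :=
      hcons (hτm.comp hpair) (hTD.measurable_map.comp htm)
    have hgpos : ∀ x t, 0 < G (Fin.cons (τ x t) (T x)) / G₁ (T x) :=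
      fun x t => div_pos (hG.pos _) (hG.marginal.pos _)
    have hfpos : ∀ x t, 0 < F (Fin.cons t x) / F₁ x :=
      fun x t => div_pos (hF.pos _) (hF.marginal.pos _)
    -- The new diagonal derivative is the quotient of the two conditional densities, each normalised
    -- by its marginal.
    refine ⟨fun x => Fin.cons (τ (Fin.tail x) (x 0)) (T (Fin.tail x)),
      fun x => Fin.cons ((F x / F₁ (Fin.tail x)) /
        (G (Fin.cons (τ (Fin.tail x) (x 0)) (T (Fin.tail x))) / G₁ (T (Fin.tail x))))
        (D (Fin.tail x)), hTm, ?_, ?_, ?_, ?_, ?_⟩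
    · exact hcons ((hF.continuous.measurable.div (hF.marginal.continuous.measurable.comp htm)).div
        ((hG.continuous.measurable.comp hTm).div
          (hG.marginal.continuous.measurable.comp (hTD.measurable_map.comp htm))))
        (hTD.measurable_deriv.comp htm)
    · intro h hh
      rw [lintegral_insertNth 0 (h := fun x => h (Fin.cons (τ (Fin.tail x) (x 0))
          (T (Fin.tail x))) * ENNReal.ofReal (F x))
          ((hh.comp hTm).mul hF.continuous.measurable.ennreal_ofReal),
        lintegral_insertNth 0 (h := fun x => h x * ENNReal.ofReal (G x))
          (hh.mul hG.continuous.measurable.ennreal_ofReal)]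
      simp only [Fin.insertNth_zero', Fin.tail_cons, Fin.cons_zero]
      have e1 : ∀ x : Fin n → ℝ, ∫⁻ t, h (Fin.cons (τ x t) (T x)) * ENNReal.ofReal (F (Fin.cons t x))
          = (∫⁻ s, h (Fin.cons s (T x)) *
            ENNReal.ofReal (G (Fin.cons s (T x)) / G₁ (T x))) * ENNReal.ofReal (F₁ x) := fun x => by
        rw [← lintegral_comp_of_distrib_eq (hG.continuous_slice _) (fun _ => hG.pos _)
          (hG.integrable_slice _) (hF.continuous_slice _) (fun _ => hF.pos _)
          (hF.integrable_slice _) (hτ x) (fun s => h (Fin.cons s (T x))),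
          ← lintegral_mul_const' _ _ ENNReal.ofReal_ne_top]
        refine lintegral_congr fun t => ?_
        rw [mul_assoc, ← ENNReal.ofReal_mul (hfpos x t).le,
          div_mul_cancel₀ _ (hF.marginal.pos x).ne']
      simp only [e1]
      have hmeas : Measurable fun y : Fin n → ℝ => ∫⁻ s, h (Fin.cons s y) *
            ENNReal.ofReal (G (Fin.cons s y) / G₁ y) := by
        refine Measurable.lintegral_prod_right' (f := fun (z : (Fin n → ℝ) × ℝ) =>
          h (Fin.cons z.2 z.1) * ENNReal.ofReal (G (Fin.cons z.2 z.1) / G₁ z.1)) ?_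
        exact (hh.comp (continuous_snd.finCons continuous_fst).measurable).mul
          (hG.continuous_cons.measurable.div
            (hG.marginal.continuous.measurable.comp measurable_fst)).ennreal_ofReal
      rw [hTD.lintegral_comp _ hmeas]
      refine lintegral_congr fun y => ?_
      rw [← lintegral_mul_const' _ _ ENNReal.ofReal_ne_top]
      refine lintegral_congr fun s => ?_
      rw [mul_assoc, ← ENNReal.ofReal_mul (div_pos (hG.pos _) (hG.marginal.pos _)).le,
        div_mul_cancel₀ _ (hG.marginal.pos y).ne']
    · intro x i
      refine Fin.cases ?_ (fun j => ?_) i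
      · simpa using div_pos (by simpa using hfpos (Fin.tail x) (x 0)) (hgpos (Fin.tail x) (x 0))
      · simpa using hTD.deriv_pos _ j
    · intro x
      have h1 := hTD.eq_prod (Fin.tail x)
      have h2 : G₁ (T (Fin.tail x)) ≠ 0 := (hG.marginal.pos (T (Fin.tail x))).ne'
      have h3 : F₁ (Fin.tail x) ≠ 0 := (hF.marginal.pos (Fin.tail x)).ne'
      have h4 := (hG.pos (Fin.cons (τ (Fin.tail x) (x 0)) (T (Fin.tail x)))).ne'
      rw [Fin.prod_univ_succ]
      simp only [Fin.cons_zero, Fin.cons_succ]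
      -- By induction the remaining derivatives multiply to the quotient of the marginals, which
      -- cancels the normalisations in the first one.
      have h5 : ∏ i, D (Fin.tail x) i = F₁ (Fin.tail x) / G₁ (T (Fin.tail x)) := by
        rw [eq_div_iff h2, mul_comm]; exact h1.symm
      rw [h5]
      field_simp
    · intro x i
      refine Fin.cases ?_ (fun j => ?_) i
      · have h := hasDerivAt_of_distrib_eq (hG.continuous_slice _) (fun _ => hG.pos _)
          (hG.integrable_slice _) (hF.continuous_slice _) (fun _ => hF.pos _)
          (hF.integrable_slice _) (hτ (Fin.tail x)) (x 0)
        simp only [Fin.cons_self_tail] at h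
        simpa using h
      · have h := hTD.hasDerivAt (Fin.tail x) j
        simpa [Fin.tail_update_succ, Fin.tail] using h

/-! ### Integration by parts in one coordinate of ℝⁿ -/

/-- Integration by parts in the direction of a coordinate, against a function that is monotone in
that direction. -/
theorem integral_rpow_mul_partialDeriv {n : ℕ} (i : Fin n) {r C : ℝ}
    {f f' T D : (Fin n → ℝ) → ℝ} (hf : Continuous f) (hf' : Continuous f')
    (hf0 : ∀ x, 0 < f x) (hfC : ∀ x, f x ^ 2 ≤ C * (1 + x i ^ 2)⁻¹)
    (hfd : ∀ x, HasDerivAt (fun t => f (Function.update x i t)) (f' x) (x i))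
    (hf'2 : Integrable fun x => f' x ^ 2)
    (hTm : Measurable T) (hDm : Measurable D) (hD : ∀ x, 0 ≤ D x)
    (hTd : ∀ x, HasDerivAt (fun t => T (Function.update x i t)) (D x) (x i))
    (hfT : Integrable fun x => (f x ^ r * T x) ^ 2) :
    Integrable (fun x => f x ^ (r + 1) * D x) ∧
      ∫ x, f x ^ (r + 1) * D x = -((r + 1) * ∫ x, f' x * (f x ^ r * T x)) := by
  obtain _ | n := n
  · exact i.elim0
  have hins : Continuous fun z : (Fin n → ℝ) × ℝ => (i.insertNth z.2 z.1 : Fin (n + 1) → ℝ) :=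
    Continuous.finInsertNth (A := fun _ => ℝ) i continuous_snd continuous_fst
  have hline : ∀ x' : Fin n → ℝ, Continuous fun t => (i.insertNth t x' : Fin (n + 1) → ℝ) :=
    fun x' => hins.comp (by fun_prop : Continuous fun t : ℝ => (x', t))
  -- Both factors are square integrable, and |ab| ≤ a² + b².
  have hmul : Integrable fun x => f' x * (f x ^ r * T x) := by
    refine Integrable.mono' (hf'2.add hfT) (hf'.measurable.mul
      ((hf.measurable.pow_const r).mul hTm)).aestronglyMeasurable (Filter.Eventually.of_forall fun x => ?_)
    rw [Real.norm_eq_abs, abs_le, Pi.add_apply]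
    constructor <;> nlinarith [sq_nonneg (f' x + f x ^ r * T x), sq_nonneg (f' x - f x ^ r * T x),
      sq_nonneg (f' x), sq_nonneg (f x ^ r * T x)]
  have hU'V := (integrable_insertNth_iff i).2 (hmul.const_mul (r + 1))
  have hsq := (integrable_insertNth_iff i).2 hfT
  have hae : ∀ᵐ x' : Fin n → ℝ,
      (Integrable fun t => f (i.insertNth t x') ^ (r + 1) * D (i.insertNth t x')) ∧
      ∫ t, f (i.insertNth t x') ^ (r + 1) * D (i.insertNth t x') =
        -∫ t, (r + 1) * (f' (i.insertNth t x') *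
          (f (i.insertNth t x') ^ r * T (i.insertNth t x'))) := by
    filter_upwards [hU'V.prod_right_ae, hsq.prod_right_ae] with x' h1 h2
    have hd1 : ∀ t, HasDerivAt (fun t => f (i.insertNth t x') ^ (r + 1))
        ((r + 1) * f (i.insertNth t x') ^ r * f' (i.insertNth t x')) t := fun t => by
      have h := hfd (i.insertNth t x')
      simp only [Fin.update_insertNth, Fin.insertNth_apply_same] at h
      have := h.rpow_const (p := r + 1) (Or.inl (hf0 _).ne')
      refine this.congr_deriv ?_
      rw [add_sub_cancel_right]; ring
    have hd2 : ∀ t, HasDerivAt (fun t => T (i.insertNth t x')) (D (i.insertNth t x')) t :=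
      fun t => by
        have h := hTd (i.insertNth t x')
        simpa only [Fin.update_insertNth, Fin.insertNth_apply_same] using h
    have hTl : Continuous fun t => T (i.insertNth t x') :=
      continuous_iff_continuousAt.2 fun t => (hd2 t).continuousAt
    have hfl : Continuous fun t => f (i.insertNth t x') := hf.comp (hline x')
    have hfl' : Continuous fun t => f' (i.insertNth t x') := hf'.comp (hline x')
    have hpow : ∀ s : ℝ, Continuous fun t => f (i.insertNth t x') ^ s := fun s =>
      hfl.rpow_const fun t => Or.inl (hf0 _).ne'
    -- The product is f · (f^r T): the first factor is square integrable on every line by `hfC`, the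
    -- second on almost every line by Fubini.
    have hUV : Integrable fun t => f (i.insertNth t x') ^ (r + 1) * T (i.insertNth t x') := by
      refine Integrable.mono' ((integrable_inv_one_add_sq.const_mul C).add h2)
        ((hpow _).mul hTl).aestronglyMeasurable (Filter.Eventually.of_forall fun t => ?_)
      have hC := hfC (i.insertNth t x')
      rw [Fin.insertNth_apply_same] at hC
      rw [Real.rpow_add_one (hf0 _).ne', Real.norm_eq_abs, abs_le, Pi.add_apply]
      set a := f (i.insertNth t x')
      set b := a ^ r * T (i.insertNth t x')
      have e : a ^ r * a * T (i.insertNth t x') = a * b := by ring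
      rw [e]
      constructor <;> nlinarith [sq_nonneg (a + b), sq_nonneg (a - b), sq_nonneg a, sq_nonneg b]
    have hUV' : Integrable fun t => (r + 1) * f (i.insertNth t x') ^ r * f' (i.insertNth t x') *
        T (i.insertNth t x') :=
      h1.congr (Filter.Eventually.of_forall fun t => by ring)
    obtain ⟨h3, h4⟩ := integral_mul_deriv_of_nonneg hd1 hd2
      ((continuous_const.mul (hpow r)).mul hfl')
      (fun t => (Real.rpow_pos_of_pos (hf0 _) _).le) (fun t => hD _) hUV hUV'
    refine ⟨h3, h4.trans (congrArg Neg.neg (integral_congr_ae ?_))⟩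
    exact Filter.Eventually.of_forall fun t => by ring
  have hi1 : Integrable fun x => f x ^ (r + 1) * D x := by
    rw [← integrable_insertNth_iff i]
    have hm : Measurable fun x => f x ^ (r + 1) * D x := (hf.measurable.pow_const _).mul hDm
    refine (integrable_prod_iff (hm.comp hins.measurable).aestronglyMeasurable).2
      ⟨hae.mono fun x' h => h.1, ?_⟩
    -- As the integrand is nonnegative, the line integrals of its norm are the line integrals
    -- themselves. By parts they equal a function already known to be integrable, so Tonelli
    -- applies.
    refine (hU'V.integral_prod_left.neg).congr (hae.mono fun x' h => ?_)
    simp only [Pi.neg_apply]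
    rw [← h.2]
    refine integral_congr_ae (Filter.Eventually.of_forall fun t => ?_)
    exact (Real.norm_of_nonneg (mul_nonneg (Real.rpow_pos_of_pos (hf0 _) _).le (hD _))).symm
  refine ⟨hi1, ?_⟩
  rw [integral_insertNth i hi1, ← integral_const_mul, integral_insertNth i (hmul.const_mul _),
    ← integral_neg]
  exact integral_congr_ae (hae.mono fun x' h => h.2)

/-! ### Powers of 1 + |x|² -/

/-- `1 + |x|²` in coordinates. -/
def japSq {n : ℕ} (x : Fin n → ℝ) : ℝ := 1 + ∑ i, x i ^ 2

theorem japSq_eq_norm {n : ℕ} (x : Fin n → ℝ) : japSq x = 1 + ‖WithLp.toLp 2 x‖ ^ 2 := by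
  simp [japSq, EuclideanSpace.norm_sq_eq]

theorem one_le_japSq {n : ℕ} (x : Fin n → ℝ) : 1 ≤ japSq x :=
  le_add_of_nonneg_right (Finset.sum_nonneg fun _ _ => sq_nonneg _)

theorem japSq_pos {n : ℕ} (x : Fin n → ℝ) : 0 < japSq x := one_pos.trans_le (one_le_japSq x)

theorem one_add_sq_le_japSq {n : ℕ} (x : Fin n → ℝ) (i : Fin n) : 1 + x i ^ 2 ≤ japSq x := by
  have := Finset.single_le_sum (f := fun i => x i ^ 2) (fun _ _ => sq_nonneg _) (Finset.mem_univ i)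
  simpa [japSq] using this

@[fun_prop]
theorem continuous_japSq {n : ℕ} : Continuous (japSq (n := n)) := by
  unfold japSq; fun_prop

theorem continuous_japSq_rpow {n : ℕ} (s : ℝ) : Continuous fun x : Fin n → ℝ => japSq x ^ s :=
  continuous_japSq.rpow_const fun x => Or.inl (japSq_pos x).ne'

theorem integrable_japSq_rpow {n : ℕ} {s : ℝ} (hs : n < 2 * s) :
    Integrable fun x : Fin n → ℝ => japSq x ^ (-s) := by
  have h := integrable_rpow_neg_one_add_norm_sq (E := EuclideanSpace ℝ (Fin n))
    (μ := volume) (r := 2 * s) (by simpa using hs)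
  have h2 := ((PiLp.volume_preserving_toLp (Fin n)).integrable_comp
    h.aestronglyMeasurable).2 h
  refine h2.congr (Filter.Eventually.of_forall fun x => ?_)
  simp only [Function.comp_apply, japSq_eq_norm]
  congr 1; ring

/-- Each of the n factors 1 + x_i² is at most 1 + |x|². This is the target density of the transport.
-/
theorem isCauchyBounded_japSq_rpow {n : ℕ} :
    IsCauchyBounded fun x : Fin n → ℝ => japSq x ^ (-(n : ℝ)) where
  continuous := continuous_japSq_rpow _
  pos x := Real.rpow_pos_of_pos (japSq_pos x) _
  bound := by
    refine ⟨1, fun x => ?_⟩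
    rw [one_mul, Real.rpow_neg (japSq_pos x).le, Real.rpow_natCast, Finset.prod_inv_distrib]
    refine inv_anti₀ (Finset.prod_pos fun i _ => by positivity) ?_
    calc ∏ i, (1 + x i ^ 2) ≤ ∏ _i : Fin n, japSq x :=
          Finset.prod_le_prod (fun i _ => by positivity) fun i _ => one_add_sq_le_japSq x i
      _ = japSq x ^ n := by simp

theorem hasDerivAt_japSq_rpow {n : ℕ} (s : ℝ) (x : Fin n → ℝ) (i : Fin n) :
    HasDerivAt (fun t => japSq (Function.update x i t) ^ s) (s * japSq x ^ (s - 1) * (2 * x i))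
      (x i) := by
  have h1 : HasDerivAt (fun t => japSq (Function.update x i t)) (2 * x i) (x i) := by
    have : ∀ t, japSq (Function.update x i t) = t ^ 2 + (1 + ∑ j ∈ Finset.univ.erase i, x j ^ 2) :=
      fun t => by
        rw [japSq, ← Finset.add_sum_erase _ _ (Finset.mem_univ i), Function.update_self,
          Finset.sum_congr rfl fun j hj => by
            rw [Function.update_of_ne (Finset.ne_of_mem_erase hj)]]
        ring
    rw [funext this]
    simpa using (hasDerivAt_pow 2 (x i)).add_const (1 + ∑ j ∈ Finset.univ.erase i, x j ^ 2)
  have := h1.rpow_const (p := s) (Or.inl (japSq_pos _).ne')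
  simp only [Function.update_eq_self] at this
  exact this.congr_deriv (by ring)

/-! ### The transport inequality for positive functions -/

section Sobolev

variable {n : ℕ}

theorem integrable_japSq_mul_sq (hn : 3 ≤ n) (i : Fin n) :
    Integrable fun x : Fin n → ℝ => japSq x ^ (-(n : ℝ)) * x i ^ 2 := by
  have hn' : (3 : ℝ) ≤ n := by exact_mod_cast hn
  refine Integrable.mono' (integrable_japSq_rpow (n := n) (s := n - 1) (by linarith))
    ((continuous_japSq_rpow _).mul (by fun_prop)).aestronglyMeasurable
    (Filter.Eventually.of_forall fun x => ?_)
  have hp := Real.rpow_pos_of_pos (japSq_pos x) (-(n : ℝ))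
  rw [Real.norm_of_nonneg (by positivity), show -((n : ℝ) - 1) = -(n : ℝ) + 1 by ring,
    Real.rpow_add_one (japSq_pos x).ne']
  exact mul_le_mul_of_nonneg_left ((le_add_of_nonneg_left zero_le_one).trans
    (one_add_sq_le_japSq x i)) hp.le

/-- `n ∫ (1+|y|²)^{1-n} = 2(n-1) ∫ (1+|y|²)^{-n} |y|²`. -/
theorem integral_japSq_rpow_identity (hn : 3 ≤ n) :
    n * ∫ x : Fin n → ℝ, japSq x ^ (-((n : ℝ) - 1)) =
      2 * ((n : ℝ) - 1) * ∑ i, ∫ x : Fin n → ℝ, japSq x ^ (-(n : ℝ)) * x i ^ 2 := by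
  have hn' : (3 : ℝ) ≤ n := by exact_mod_cast hn
  have key : ∀ i : Fin n, ∫ x : Fin n → ℝ, japSq x ^ (-((n : ℝ) - 1)) =
      2 * ((n : ℝ) - 1) * ∫ x : Fin n → ℝ, japSq x ^ (-(n : ℝ)) * x i ^ 2 := fun i => by
    have hn2 : (n : ℝ) - 2 ≠ 0 := by linarith
    set k : ℝ := ((n : ℝ) - 2) / 2 with hk
    have hkpos : 0 < k := by rw [hk]; linarith
    have hkr : k * ((n : ℝ) / (n - 2)) = n / 2 := by rw [hk]; field_simp
    have hpw : ∀ (x : Fin n → ℝ) (s : ℝ), (japSq x ^ (-k)) ^ s = japSq x ^ (-(k * s)) :=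
      fun x s => by rw [← Real.rpow_mul (japSq_pos x).le, neg_mul]
    -- The coordinate integration by parts with the identity as transport map: f is the extremal
    -- profile (1+|x|²)^{−k}, for which f^{r+1} = (1+|x|²)^{1−n} and f^r = (1+|x|²)^{−n/2}.
    have h := integral_rpow_mul_partialDeriv i (r := n / (n - 2)) (C := 1)
      (f := fun x => japSq x ^ (-k)) (f' := fun x => -k * japSq x ^ (-k - 1) * (2 * x i))
      (T := fun x => x i) (D := fun _ => 1)
      (continuous_japSq_rpow _)
      ((continuous_const.mul (continuous_japSq_rpow _)).mul (by fun_prop))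
      (fun x => Real.rpow_pos_of_pos (japSq_pos x) _) (fun x => ?_)
      (fun x => hasDerivAt_japSq_rpow _ x i) ?_ (measurable_pi_apply i) measurable_const
      (fun _ => zero_le_one) (fun x => ?_) ?_
    · have h2 := h.2
      simp only [hpw, mul_one] at h2
      rw [show k * ((n : ℝ) / (n - 2) + 1) = n - 1 by
        rw [mul_add, hkr, hk]; ring, hkr] at h2
      rw [h2, ← integral_const_mul, ← integral_neg, ← integral_const_mul]
      refine integral_congr_ae (Filter.Eventually.of_forall fun x => ?_)
      simp only []
      have e : japSq x ^ (-(n : ℝ)) = japSq x ^ (-k - 1) * japSq x ^ (-((n : ℝ) / 2)) := by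
        rw [← Real.rpow_add (japSq_pos x)]; congr 1; rw [hk]; ring
      have e2 : ((n : ℝ) / (n - 2) + 1) * k = n - 1 := by
        rw [add_mul, mul_comm, hkr, hk]; ring
      rw [e, ← e2]
      ring
    · rw [one_mul, ← Real.rpow_natCast, hpw, Real.rpow_neg (japSq_pos x).le]
      refine inv_anti₀ (by positivity) ((one_add_sq_le_japSq x i).trans ?_)
      refine Real.self_le_rpow_of_one_le (one_le_japSq x) ?_
      rw [hk]; push_cast; linarith
    · refine ((integrable_japSq_mul_sq hn i).const_mul (4 * k ^ 2)).congr
        (Filter.Eventually.of_forall fun x => ?_)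
      have e : japSq x ^ (-(n : ℝ)) = (japSq x ^ (-k - 1)) ^ 2 := by
        rw [← Real.rpow_natCast, ← Real.rpow_mul (japSq_pos x).le]; congr 1; rw [hk]; push_cast; ring
      simp only [e]; ring
    · simpa using hasDerivAt_id' (x i)
    · refine (integrable_japSq_mul_sq hn i).congr (Filter.Eventually.of_forall fun x => ?_)
      simp only [hpw, mul_pow]
      rw [← Real.rpow_natCast (japSq x ^ _) 2, ← Real.rpow_mul (japSq_pos x).le]
      congr 2; rw [hkr]; push_cast; ring
  have hs := Finset.sum_congr (rfl : (Finset.univ : Finset (Fin n)) = Finset.univ)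
    fun i _ => key i
  rw [Finset.sum_const, Finset.card_univ, Fintype.card_fin, nsmul_eq_mul, ← Finset.mul_sum] at hs
  exact hs

/-- Young's inequality with a free weight c; it is an equality when a = −cb. -/
theorem neg_integral_mul_le {α : Type*} [MeasurableSpace α] {μ : Measure α} {a b : α → ℝ} {c : ℝ}
    (hc : 0 < c) (ha : Integrable (fun x => a x ^ 2) μ) (hb : Integrable (fun x => b x ^ 2) μ) :
    -∫ x, a x * b x ∂μ ≤ 1 / 2 * (1 / c * (∫ x, a x ^ 2 ∂μ) + c * ∫ x, b x ^ 2 ∂μ) := by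
  refine (neg_le_abs _).trans ((abs_integral_le_integral_abs).trans ?_)
  rw [← integral_const_mul, ← integral_const_mul, ← integral_add (ha.const_mul _)
    (hb.const_mul _), ← integral_const_mul]
  refine integral_mono_of_nonneg (Filter.Eventually.of_forall fun x => abs_nonneg _)
    (((ha.const_mul _).add (hb.const_mul _)).const_mul _) (Filter.Eventually.of_forall fun x => ?_)
  have h1 : 1 / c * a x ^ 2 + c * b x ^ 2 - 2 * (a x * b x) = 1 / c * (a x - c * b x) ^ 2 := by
    field_simp; ring
  have h2 : 1 / c * a x ^ 2 + c * b x ^ 2 + 2 * (a x * b x) = 1 / c * (a x + c * b x) ^ 2 := by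
    field_simp; ring
  have h3 : 0 ≤ 1 / c * (a x - c * b x) ^ 2 := by positivity
  have h4 : 0 ≤ 1 / c * (a x + c * b x) ^ 2 := by positivity
  show |a x * b x| ≤ 1 / 2 * (1 / c * a x ^ 2 + c * b x ^ 2)
  rw [abs_le]
  constructor <;> linarith

/-- Write J = 1 + |y|², r = n/(n−2), and let T be the Knothe map from f^{2r} to J^{−n}. The Jacobian
equation reads ∏ D_i = (f^{r−1} J(T))^n, so the mean inequality gives f^{2r} J(T) ≤ n^{−1} ∑ f^{r+1}
D_i. The left side integrates to ∫ J^{1−n}. The right side, integrated by parts, becomes −((r+1)/n)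
∑ ∫ ∂_i f · f^r T_i, and Young's inequality splits it into ∫ |∇f|² and ∫ f^{2r} |T|² = ∫ J^{−n}
|y|². The identity between ∫ J^{1−n} and this last integral then isolates ∫ |∇f|². -/
theorem sobolev_of_integral_eq (hn : 3 ≤ n) {f : (Fin n → ℝ) → ℝ} {f' : Fin n → (Fin n → ℝ) → ℝ}
    {C : ℝ} (hf : Continuous f) (hf' : ∀ i, Continuous (f' i)) (hf0 : ∀ x, 0 < f x)
    (hfC : ∀ x, f x ≤ C * japSq x ^ (-(((n : ℝ) - 2) / 2)))
    (hfd : ∀ i x, HasDerivAt (fun t => f (Function.update x i t)) (f' i x) (x i))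
    (hf'2 : ∀ i, Integrable fun x => f' i x ^ 2)
    (heq : ∫ x, f x ^ (2 * n / ((n : ℝ) - 2)) = ∫ x : Fin n → ℝ, japSq x ^ (-(n : ℝ))) :
    ((n : ℝ) - 2) ^ 2 * ∑ i, ∫ x : Fin n → ℝ, japSq x ^ (-(n : ℝ)) * x i ^ 2 ≤
      ∑ i, ∫ x, f' i x ^ 2 := by
  have hn' : (3 : ℝ) ≤ n := by exact_mod_cast hn
  have hn2 : (0 : ℝ) < n - 2 := by linarith
  set r : ℝ := n / (n - 2) with hr
  have hrpos : 0 < r := div_pos (by linarith) hn2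
  have h2r : 2 * n / ((n : ℝ) - 2) = 2 * r := by rw [hr]; ring
  rw [h2r] at heq
  have hC : 0 < C := by
    have := (hf0 0).trans_le (hfC 0)
    exact pos_of_mul_pos_left this (Real.rpow_pos_of_pos (japSq_pos _) _).le
  have hfpow : ∀ x (s : ℝ), 0 < f x ^ s := fun x s => Real.rpow_pos_of_pos (hf0 x) s
  have hF : IsCauchyBounded fun x => f x ^ (2 * r) := by
    refine ⟨hf.rpow_const fun x => Or.inl (hf0 x).ne', fun x => hfpow x _, ?_⟩
    obtain ⟨C', hC'⟩ := (isCauchyBounded_japSq_rpow (n := n)).bound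
    refine ⟨C ^ (2 * r) * C', fun x => ?_⟩
    calc f x ^ (2 * r) ≤ (C * japSq x ^ (-(((n : ℝ) - 2) / 2))) ^ (2 * r) :=
          Real.rpow_le_rpow (hf0 x).le (hfC x) (by positivity)
      _ = C ^ (2 * r) * japSq x ^ (-(n : ℝ)) := by
          rw [Real.mul_rpow hC.le (Real.rpow_nonneg (japSq_pos x).le _),
            ← Real.rpow_mul (japSq_pos x).le]
          congr 2
          rw [hr]; field_simp
      _ ≤ C ^ (2 * r) * (C' * ∏ i, (1 + x i ^ 2)⁻¹) := by gcongr; exact hC' x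
      _ = _ := by ring
  have hG := isCauchyBounded_japSq_rpow (n := n)
  obtain ⟨T, D, hTD⟩ := exists_knotheMap hF hG heq
  have hTi : ∀ i, Measurable fun x => T x i := fun i => measurable_pi_iff.1 hTD.measurable_map i
  have hDi : ∀ i, Measurable fun x => D x i := fun i => measurable_pi_iff.1 hTD.measurable_deriv i
  have hFm : Measurable fun x => f x ^ (2 * r) := hF.continuous.measurable
  -- transport of nonnegative functions
  have htrans : ∀ h : (Fin n → ℝ) → ℝ, Continuous h → (∀ y, 0 ≤ h y) →
      Integrable (fun y => japSq y ^ (-(n : ℝ)) * h y) →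
      Integrable (fun x => f x ^ (2 * r) * h (T x)) ∧
        ∫ x, f x ^ (2 * r) * h (T x) = ∫ y, japSq y ^ (-(n : ℝ)) * h y := by
    intro h hh hh0 hi
    have h1 := hTD.lintegral_comp (fun y => ENNReal.ofReal (h y)) hh.measurable.ennreal_ofReal
    have h2 : ∀ x, ENNReal.ofReal (h (T x)) * ENNReal.ofReal (f x ^ (2 * r)) =
        ENNReal.ofReal (f x ^ (2 * r) * h (T x)) := fun x => by
      rw [ENNReal.ofReal_mul (hfpow x _).le, mul_comm]
    have h3 : ∀ y : Fin n → ℝ, ENNReal.ofReal (h y) * ENNReal.ofReal (japSq y ^ (-(n : ℝ))) =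
        ENNReal.ofReal (japSq y ^ (-(n : ℝ)) * h y) := fun y => by
      rw [ENNReal.ofReal_mul (Real.rpow_nonneg (japSq_pos y).le _), mul_comm]
    simp only [h2, h3] at h1
    have hm : Measurable fun x => f x ^ (2 * r) * h (T x) :=
      hFm.mul (hh.measurable.comp hTD.measurable_map)
    have h0 : ∀ x, 0 ≤ f x ^ (2 * r) * h (T x) := fun x => mul_nonneg (hfpow x _).le (hh0 _)
    have h0' : ∀ y : Fin n → ℝ, 0 ≤ japSq y ^ (-(n : ℝ)) * h y := fun y =>
      mul_nonneg (Real.rpow_nonneg (japSq_pos y).le _) (hh0 _)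
    have hfin := (hasFiniteIntegral_iff_ofReal (Filter.Eventually.of_forall h0')).1 hi.2
    refine ⟨⟨hm.aestronglyMeasurable,
      (hasFiniteIntegral_iff_ofReal (Filter.Eventually.of_forall h0)).2 (h1 ▸ hfin)⟩, ?_⟩
    rw [integral_eq_lintegral_of_nonneg_ae (Filter.Eventually.of_forall h0)
      hm.aestronglyMeasurable, integral_eq_lintegral_of_nonneg_ae
      (Filter.Eventually.of_forall h0') hi.1, h1]
  have hsqT : ∀ x i, (f x ^ r * T x i) ^ 2 = f x ^ (2 * r) * T x i ^ 2 := fun x i => by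
    rw [mul_pow, ← Real.rpow_natCast, ← Real.rpow_mul (hf0 x).le, mul_comm r]; norm_num
  have hT2 := fun i => htrans (fun y => y i ^ 2) (by fun_prop) (fun _ => sq_nonneg _)
    (integrable_japSq_mul_sq hn i)
  have hW1 : ∀ y : Fin n → ℝ, japSq y ^ (-(n : ℝ)) * japSq y = japSq y ^ (-((n : ℝ) - 1)) :=
    fun y => by rw [← Real.rpow_add_one (japSq_pos y).ne']; congr 1; ring
  have hTj := htrans japSq continuous_japSq (fun y => (japSq_pos y).le) (by
    simp only [hW1]
    exact integrable_japSq_rpow (by linarith))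
  simp only [hW1] at hTj
  have hparts := fun i => integral_rpow_mul_partialDeriv i (r := r) (C := C ^ 2) hf (hf' i) hf0
    (fun x => by
      calc f x ^ 2 ≤ (C * japSq x ^ (-(((n : ℝ) - 2) / 2))) ^ 2 :=
            pow_le_pow_left₀ (hf0 x).le (hfC x) 2
        _ = C ^ 2 * (japSq x ^ ((n : ℝ) - 2))⁻¹ := by
            rw [mul_pow, ← Real.rpow_natCast (japSq x ^ _) 2, ← Real.rpow_mul (japSq_pos x).le,
              ← Real.rpow_neg (japSq_pos x).le]
            congr 2; push_cast; ring
        _ ≤ C ^ 2 * (1 + x i ^ 2)⁻¹ := by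
            refine mul_le_mul_of_nonneg_left (inv_anti₀ (by positivity)
              ((one_add_sq_le_japSq x i).trans ?_)) (sq_nonneg C)
            exact Real.self_le_rpow_of_one_le (one_le_japSq x) (by linarith))
    (hfd i) (hf'2 i) (hTi i) (hDi i) (fun x => (hTD.deriv_pos x i).le)
    (fun x => hTD.hasDerivAt x i) (by simpa only [hsqT] using (hT2 i).1)
  -- arithmetic-geometric mean inequality
  have hamgm : ∀ x, f x ^ (2 * r) * japSq (T x) ≤ (n : ℝ)⁻¹ * ∑ i, f x ^ (r + 1) * D x i := by
    intro x
    have hJ := japSq_pos (T x)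
    -- The relation (r−1)n = 2r makes the Jacobian an exact n-th power, ready for the geometric
    -- mean.
    have h1 : ∏ i, D x i = (f x ^ (r - 1) * japSq (T x)) ^ (n : ℝ) := by
      have h2 := hTD.eq_prod x
      rw [Real.mul_rpow (hfpow x _).le hJ.le, ← Real.rpow_mul (hf0 x).le]
      have h3 : (r - 1) * n = 2 * r := by rw [hr]; field_simp; ring
      rw [h3, h2, Real.rpow_neg hJ.le]
      have := (Real.rpow_pos_of_pos hJ (n : ℝ)).ne'
      field_simp
    have h4 := Real.geom_mean_le_arith_mean_weighted Finset.univ (fun _ : Fin n => (n : ℝ)⁻¹)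
      (D x) (fun _ _ => by positivity) (by simp; field_simp) (fun i _ => (hTD.deriv_pos x i).le)
    rw [Real.finsetProd_rpow _ _ (fun i _ => (hTD.deriv_pos x i).le), h1, ← Real.rpow_mul
      (mul_pos (hfpow x _) hJ).le, mul_inv_cancel₀ (by linarith), Real.rpow_one,
      ← Finset.mul_sum] at h4
    rw [← Finset.mul_sum]
    calc f x ^ (2 * r) * japSq (T x) = f x ^ (r + 1) * (f x ^ (r - 1) * japSq (T x)) := by
          rw [← mul_assoc, ← Real.rpow_add (hf0 x)]; congr 2; ring
      _ ≤ f x ^ (r + 1) * ((n : ℝ)⁻¹ * ∑ i, D x i) :=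
          mul_le_mul_of_nonneg_left h4 (hfpow x _).le
      _ = _ := by ring
  have hint := integral_mono hTj.1
    ((integrable_finsetSum Finset.univ fun i _ => (hparts i).1).const_mul (n : ℝ)⁻¹) hamgm
  rw [hTj.2, integral_const_mul, integral_finsetSum _ fun i _ => (hparts i).1] at hint
  -- The weight n − 2 loses nothing at the extremal (1+|x|²)^{−(n−2)/2}: there T is the identity and
  -- ∂_i f = −(n−2) f^r x_i.
  have hbd : ∀ i, ∫ x, f x ^ (r + 1) * D x i ≤ (r + 1) * (1 / 2) *
      ((1 / (n - 2)) * (∫ x, f' i x ^ 2) +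
        (n - 2) * ∫ y : Fin n → ℝ, japSq y ^ (-(n : ℝ)) * y i ^ 2) := by
    intro i
    have hT2' : Integrable fun x => (f x ^ r * T x i) ^ 2 := by simpa only [hsqT] using (hT2 i).1
    have := neg_integral_mul_le hn2 (hf'2 i) hT2'
    simp only [hsqT, (hT2 i).2] at this
    rw [(hparts i).2, ← mul_neg, mul_assoc]
    exact mul_le_mul_of_nonneg_left this (by positivity)
  have hid := integral_japSq_rpow_identity hn
  set B := ∑ i, ∫ x : Fin n → ℝ, japSq x ^ (-(n : ℝ)) * x i ^ 2 with hB
  set E := ∑ i, ∫ x, f' i x ^ 2 with hE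
  have hsum := Finset.sum_le_sum fun i (_ : i ∈ Finset.univ) => hbd i
  rw [← Finset.mul_sum, Finset.sum_add_distrib, ← Finset.mul_sum, ← Finset.mul_sum, ← hB,
    ← hE] at hsum
  have hn0 : (0 : ℝ) < n := by linarith
  have h5 : n * ∫ x : Fin n → ℝ, japSq x ^ (-((n : ℝ) - 1)) ≤ (r + 1) * (1 / 2) *
      (1 / (n - 2) * E + (n - 2) * B) := by
    refine le_trans ?_ hsum
    have := mul_le_mul_of_nonneg_left hint hn0.le
    rwa [mul_inv_cancel_left₀ hn0.ne'] at this
  rw [hid] at h5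
  have h6 : r + 1 = 2 * (n - 1) / (n - 2) := by rw [hr]; field_simp; ring
  have h7 : 2 * ((n : ℝ) - 1) * B ≤ ((n - 1) / (n - 2) ^ 2) * (E + (n - 2) ^ 2 * B) := by
    refine h5.trans (le_of_eq ?_)
    rw [h6]; field_simp
  have h8 : 2 * ((n : ℝ) - 1) * B * (n - 2) ^ 2 ≤ (n - 1) * (E + (n - 2) ^ 2 * B) := by
    have := mul_le_mul_of_nonneg_right h7 (sq_nonneg ((n : ℝ) - 2))
    refine this.trans (le_of_eq ?_)
    field_simp
  nlinarith [h8]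

end Sobolev

/-! ### The sharp Sobolev inequality for smooth compactly supported functions -/

section SharpSobolev

variable {n : ℕ}

/-- Splitting (1+|x|²)^{1−n} into (1+|x|²)^{−n}(1 + |x|²) in `integral_japSq_rpow_identity`
expresses the transport lower bound through ∫ (1+|x|²)^{−n} alone. -/
theorem sum_integral_japSq_mul_sq (hn : 3 ≤ n) :
    ((n : ℝ) - 2) ^ 2 * ∑ i, ∫ x : Fin n → ℝ, japSq x ^ (-(n : ℝ)) * x i ^ 2 =
      n * (n - 2) * ∫ x : Fin n → ℝ, japSq x ^ (-(n : ℝ)) := by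
  have hn' : (3 : ℝ) ≤ n := by exact_mod_cast hn
  have h := integral_japSq_rpow_identity hn
  have h2 : ∫ x : Fin n → ℝ, japSq x ^ (-((n : ℝ) - 1)) =
      (∫ x : Fin n → ℝ, japSq x ^ (-(n : ℝ))) +
        ∑ i, ∫ x : Fin n → ℝ, japSq x ^ (-(n : ℝ)) * x i ^ 2 := by
    rw [← integral_finsetSum _ fun i _ => integrable_japSq_mul_sq hn i,
      ← integral_add (integrable_japSq_rpow (by linarith))
        (integrable_finsetSum _ fun i _ => integrable_japSq_mul_sq hn i)]
    refine integral_congr_ae (Filter.Eventually.of_forall fun x => ?_)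
    simp only []
    rw [← Finset.mul_sum, ← mul_one_add, ← japSq, ← Real.rpow_add_one (japSq_pos x).ne']
    congr 1; ring
  rw [h2] at h
  linear_combination (-((n : ℝ) - 2)) * h

theorem integral_japSq_rpow_pos : 0 < ∫ x : Fin n → ℝ, japSq x ^ (-(n : ℝ)) :=
  integral_pos_of_pos isCauchyBounded_japSq_rpow.pos isCauchyBounded_japSq_rpow.integrable

/-- The transport inequality needs a positive function of the decay of the profile w =
(1+|x|²)^{−(n−2)/2}. It is applied to a normalised multiple of √(g² + τ²w²), whose energy exceeds
that of g by at most τ² times that of w; then τ → 0. -/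
theorem sharp_sobolev_coord (hn : 3 ≤ n) {g : (Fin n → ℝ) → ℝ} {g' : Fin n → (Fin n → ℝ) → ℝ}
    (hg : Continuous g) (hg' : ∀ i, Continuous (g' i)) (hgs : HasCompactSupport g)
    (hgd : ∀ i x, HasDerivAt (fun t => g (Function.update x i t)) (g' i x) (x i))
    (hg'2 : ∀ i, Integrable fun x => g' i x ^ 2) :
    n * (n - 2) * (∫ x : Fin n → ℝ, japSq x ^ (-(n : ℝ))) ^ (2 / (n : ℝ)) *
      (∫ x, |g x| ^ (2 * n / ((n : ℝ) - 2))) ^ (((n : ℝ) - 2) / n) ≤ ∑ i, ∫ x, g' i x ^ 2 := by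
  have hn' : (3 : ℝ) ≤ n := by exact_mod_cast hn
  have hn2 : (0 : ℝ) < n - 2 := by linarith
  have hn0 : (0 : ℝ) < n := by linarith
  set q : ℝ := 2 * n / ((n : ℝ) - 2) with hq
  have hq0 : 0 < q := by positivity
  set A := ∫ x : Fin n → ℝ, japSq x ^ (-(n : ℝ)) with hA
  have hApos : 0 < A := integral_japSq_rpow_pos
  set N := ∫ x, |g x| ^ q with hN
  have hE0 : 0 ≤ ∑ i, ∫ x, g' i x ^ 2 :=
    Finset.sum_nonneg fun i _ => integral_nonneg fun x => sq_nonneg _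
  have hNi : Integrable fun x => |g x| ^ q := by
    refine Continuous.integrable_of_hasCompactSupport
      (hg.abs.rpow_const fun x => Or.inr hq0.le) ?_
    refine hgs.mono fun x hx => ?_
    contrapose! hx
    simp [Function.notMem_support.1 hx, hq0.ne']
  have hN0 : 0 ≤ N := integral_nonneg fun x => Real.rpow_nonneg (abs_nonneg _) _
  rcases hN0.eq_or_lt with h0 | hNpos
  · rw [← h0, Real.zero_rpow (by positivity), mul_zero]
    exact hE0
  set w : (Fin n → ℝ) → ℝ := fun x => japSq x ^ (-(((n : ℝ) - 2) / 2)) with hw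
  set w' : Fin n → (Fin n → ℝ) → ℝ := fun i x =>
    -(((n : ℝ) - 2) / 2) * japSq x ^ (-(((n : ℝ) - 2) / 2) - 1) * (2 * x i) with hw'
  have hwc : Continuous w := continuous_japSq_rpow _
  have hw0 : ∀ x, 0 < w x := fun x => Real.rpow_pos_of_pos (japSq_pos x) _
  have hwd : ∀ i x, HasDerivAt (fun t => w (Function.update x i t)) (w' i x) (x i) :=
    fun i x => hasDerivAt_japSq_rpow _ x i
  have hw'c : ∀ i, Continuous (w' i) := fun i =>
    (continuous_const.mul (continuous_japSq_rpow _)).mul (by fun_prop)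
  have hw'2 : ∀ i, Integrable fun x => w' i x ^ 2 := fun i => by
    refine ((integrable_japSq_mul_sq hn i).const_mul (((n : ℝ) - 2) ^ 2)).congr
      (Filter.Eventually.of_forall fun x => ?_)
    have e : japSq x ^ (-(n : ℝ)) = (japSq x ^ (-(((n : ℝ) - 2) / 2) - 1)) ^ 2 := by
      rw [← Real.rpow_natCast, ← Real.rpow_mul (japSq_pos x).le]; congr 1; push_cast; ring
    simp only [e, hw']; ring
  obtain ⟨M, hM⟩ : ∃ M, ∀ x, |g x| ≤ M * w x := by
    have hs : HasCompactSupport fun x => g x / w x := hgs.mono fun x hx => by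
      contrapose! hx
      simp [Function.notMem_support.1 hx]
    obtain ⟨M, hM⟩ := hs.exists_bound_of_continuous (hg.div hwc fun x => (hw0 x).ne')
    refine ⟨M, fun x => ?_⟩
    have := hM x
    rwa [norm_div, Real.norm_eq_abs, Real.norm_of_nonneg (hw0 x).le, div_le_iff₀ (hw0 x)] at this
  have key : ∀ τ : ℝ, 0 < τ → n * (n - 2) * A ≤ (A / N) ^ (2 / q) *
      ((∑ i, ∫ x, g' i x ^ 2) + τ ^ 2 * ∑ i, ∫ x, w' i x ^ 2) := by
    intro τ hτ
    set s : (Fin n → ℝ) → ℝ := fun x => Real.sqrt (g x ^ 2 + τ ^ 2 * w x ^ 2) with hs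
    have hs2 : ∀ x, 0 < g x ^ 2 + τ ^ 2 * w x ^ 2 := fun x => by have := hw0 x; positivity
    have hs0 : ∀ x, 0 < s x := fun x => Real.sqrt_pos.2 (hs2 x)
    have hsc : Continuous s := by fun_prop
    have hgs' : ∀ x, |g x| ≤ s x := fun x => Real.abs_le_sqrt (by nlinarith [hs2 x, sq_nonneg (τ * w x)])
    have hsM : ∀ x, s x ≤ Real.sqrt (M ^ 2 + τ ^ 2) * w x := fun x => by
      have e : Real.sqrt (M ^ 2 + τ ^ 2) * w x = Real.sqrt ((M ^ 2 + τ ^ 2) * w x ^ 2) := by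
        rw [Real.sqrt_mul (by positivity), Real.sqrt_sq (hw0 x).le]
      rw [e]
      refine Real.sqrt_le_sqrt ?_
      have := pow_le_pow_left₀ (abs_nonneg _) (hM x) 2
      rw [sq_abs] at this
      nlinarith
    have hwq : ∀ x, w x ^ q = japSq x ^ (-(n : ℝ)) := fun x => by
      rw [hw, ← Real.rpow_mul (japSq_pos x).le]; congr 1; rw [hq]; field_simp
    have hsi : Integrable fun x => s x ^ q := by
      refine Integrable.mono' ((integrable_japSq_rpow (n := n) (s := n) (by linarith)).const_mul
        (Real.sqrt (M ^ 2 + τ ^ 2) ^ q)) (hsc.rpow_const fun x => Or.inr hq0.le).aestronglyMeasurable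
        (Filter.Eventually.of_forall fun x => ?_)
      rw [Real.norm_of_nonneg (Real.rpow_nonneg (hs0 x).le _), ← hwq,
        ← Real.mul_rpow (Real.sqrt_nonneg _) (hw0 x).le]
      exact Real.rpow_le_rpow (hs0 x).le (hsM x) hq0.le
    set Nτ := ∫ x, s x ^ q with hNτ
    have hNN : N ≤ Nτ := integral_mono hNi hsi fun x =>
      Real.rpow_le_rpow (abs_nonneg _) (hgs' x) hq0.le
    have hNτ0 : 0 < Nτ := hNpos.trans_le hNN
    set c : ℝ := (A / Nτ) ^ (1 / q) with hc
    have hc0 : 0 < c := Real.rpow_pos_of_pos (by positivity) _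
    have hsd : ∀ i x, HasDerivAt (fun t => s (Function.update x i t))
        ((g x * g' i x + τ ^ 2 * (w x * w' i x)) / s x) (x i) := fun i x => by
      have h1 := ((hgd i x).fun_pow 2).add (((hwd i x).fun_pow 2).const_mul (τ ^ 2))
      have h2 := h1.sqrt (by simpa using (hs2 x).ne')
      simp only [Function.update_eq_self, Pi.add_apply] at h2
      refine h2.congr_deriv ?_
      have := (hs0 x).ne'
      show _ / (2 * s x) = _
      field_simp
      push_cast
      ring
    -- Cauchy–Schwarz for the vectors (g, τw) and (∂_i g, τ∂_i w).
    have hs'sq : ∀ i x, ((g x * g' i x + τ ^ 2 * (w x * w' i x)) / s x) ^ 2 ≤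
        g' i x ^ 2 + τ ^ 2 * w' i x ^ 2 := fun i x => by
      rw [div_pow, Real.sq_sqrt (hs2 x).le, div_le_iff₀ (hs2 x)]
      nlinarith [mul_nonneg (sq_nonneg τ) (sq_nonneg (g x * w' i x - w x * g' i x))]
    have hs'c : ∀ i, Continuous fun x => (g x * g' i x + τ ^ 2 * (w x * w' i x)) / s x := fun i =>
      ((hg.mul (hg' i)).add (continuous_const.mul (hwc.mul (hw'c i)))).div hsc
        fun x => (hs0 x).ne'
    have hs'2 : ∀ i, Integrable fun x => ((g x * g' i x + τ ^ 2 * (w x * w' i x)) / s x) ^ 2 :=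
      fun i => Integrable.mono' ((hg'2 i).add ((hw'2 i).const_mul (τ ^ 2)))
        ((hs'c i).pow 2).aestronglyMeasurable (Filter.Eventually.of_forall fun x => by
          rw [Real.norm_of_nonneg (sq_nonneg _)]; exact hs'sq i x)
    have hmain := sobolev_of_integral_eq hn (f := fun x => c * s x)
      (f' := fun i x => c * ((g x * g' i x + τ ^ 2 * (w x * w' i x)) / s x))
      (C := c * Real.sqrt (M ^ 2 + τ ^ 2)) (continuous_const.mul hsc)
      (fun i => continuous_const.mul (hs'c i)) (fun x => mul_pos hc0 (hs0 x))
      (fun x => by rw [mul_assoc]; exact mul_le_mul_of_nonneg_left (hsM x) hc0.le)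
      (fun i x => (hsd i x).const_mul c)
      (fun i => by simpa only [mul_pow] using (hs'2 i).const_mul (c ^ 2)) (by
        rw [← hq]
        have : ∀ x, (c * s x) ^ q = A / Nτ * s x ^ q := fun x => by
          rw [Real.mul_rpow hc0.le (hs0 x).le, hc, ← Real.rpow_mul (by positivity),
            one_div_mul_cancel hq0.ne', Real.rpow_one]
        simp only [this, integral_const_mul]
        rw [← hNτ, div_mul_cancel₀ _ hNτ0.ne'])
    rw [sum_integral_japSq_mul_sq hn] at hmain
    refine hmain.trans ?_
    -- Since |g| ≤ s the mass of s is at least that of g, which bounds the normalisation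
    -- independently of τ.
    have hc2 : c ^ 2 ≤ (A / N) ^ (2 / q) := by
      rw [hc, ← Real.rpow_natCast, ← Real.rpow_mul (by positivity),
        show 1 / q * ((2 : ℕ) : ℝ) = 2 / q by push_cast; ring]
      exact Real.rpow_le_rpow (by positivity) (div_le_div_of_nonneg_left hApos.le hNpos hNN)
        (by positivity)
    simp only [mul_pow, integral_const_mul]
    rw [← Finset.mul_sum]
    refine mul_le_mul hc2 ?_ (Finset.sum_nonneg fun i _ => integral_nonneg fun x => sq_nonneg _)
      (by positivity)
    rw [Finset.mul_sum, ← Finset.sum_add_distrib]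
    refine Finset.sum_le_sum fun i _ => ?_
    rw [← integral_const_mul, ← integral_add (hg'2 i) ((hw'2 i).const_mul _)]
    exact integral_mono (hs'2 i) ((hg'2 i).add ((hw'2 i).const_mul _)) fun x => hs'sq i x
  have hlim : n * (n - 2) * A ≤ (A / N) ^ (2 / q) * ∑ i, ∫ x, g' i x ^ 2 := by
    have hcont : Filter.Tendsto (fun τ : ℝ => (A / N) ^ (2 / q) *
        ((∑ i, ∫ x, g' i x ^ 2) + τ ^ 2 * ∑ i, ∫ x, w' i x ^ 2)) (nhdsWithin 0 (Ioi 0))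
        (nhds ((A / N) ^ (2 / q) * ((∑ i, ∫ x, g' i x ^ 2) + 0 ^ 2 * ∑ i, ∫ x, w' i x ^ 2))) :=
      (((continuous_const.add ((continuous_pow 2).mul continuous_const)).const_mul _).tendsto
        0).mono_left nhdsWithin_le_nhds
    have := ge_of_tendsto hcont (by
      filter_upwards [self_mem_nhdsWithin] with τ hτ using key τ hτ)
    simpa using this
  have h2q : 2 / q = ((n : ℝ) - 2) / n := by rw [hq]; field_simp
  rw [h2q, Real.div_rpow hApos.le hN0, div_mul_eq_mul_div, le_div_iff₀
    (Real.rpow_pos_of_pos hNpos _)] at hlim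
  have hAA : A = A ^ (((n : ℝ) - 2) / n) * A ^ (2 / (n : ℝ)) := by
    rw [← Real.rpow_add hApos, show ((n : ℝ) - 2) / n + 2 / n = 1 by field_simp; ring,
      Real.rpow_one]
  have hAp : 0 < A ^ (((n : ℝ) - 2) / n) := Real.rpow_pos_of_pos hApos _
  refine le_of_mul_le_mul_left ?_ hAp
  calc A ^ (((n : ℝ) - 2) / n) * (n * (n - 2) * A ^ (2 / (n : ℝ)) * N ^ (((n : ℝ) - 2) / n))
      = n * (n - 2) * (A ^ (((n : ℝ) - 2) / n) * A ^ (2 / (n : ℝ))) * N ^ (((n : ℝ) - 2) / n) := by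
        ring
    _ ≤ _ := by rw [← hAA]; exact hlim

theorem hasDerivAt_comp_update {φ : Euc n → ℝ} (hφ : Differentiable ℝ φ) (x : Fin n → ℝ)
    (i : Fin n) : HasDerivAt (fun t => φ (WithLp.toLp 2 (Function.update x i t)))
      (∇ φ (WithLp.toLp 2 x) i) (x i) := by
  have h1 : HasDerivAt (fun t => (WithLp.toLp 2 (Function.update x i t) : Euc n))
      (EuclideanSpace.single i 1) (x i) :=
    ((PiLp.continuousLinearEquiv 2 ℝ (fun _ : Fin n => ℝ)).symm.toContinuousLinearMap.hasFDerivAt).comp_hasDerivAt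
      (x i) (hasDerivAt_update x i (x i))
  have h2 : HasFDerivAt φ (fderiv ℝ φ (WithLp.toLp 2 x))
      (WithLp.toLp 2 (Function.update x i (x i))) := by
    rw [Function.update_eq_self]; exact (hφ _).hasFDerivAt
  refine (h2.comp_hasDerivAt (x i) h1).congr_deriv ?_
  have : ∇ φ (WithLp.toLp 2 x) i = ⟪∇ φ (WithLp.toLp 2 x), EuclideanSpace.single i 1⟫_ℝ := by
    rw [EuclideanSpace.inner_single_right]; simp
  rw [this, gradient, InnerProductSpace.toDual_symm_apply]

theorem continuous_gradient {φ : Euc n → ℝ} (hφ : ContDiff ℝ ∞ φ) : Continuous (∇ φ) :=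
  (InnerProductSpace.toDual ℝ (Euc n)).symm.continuous.comp (hφ.continuous_fderiv (by simp))

theorem tsupport_gradient_subset (φ : Euc n → ℝ) : tsupport (∇ φ) ⊆ tsupport φ := by
  refine (closure_mono fun x hx h0 => ?_).trans (tsupport_fderiv_subset ℝ (f := φ))
  exact hx (by simp [gradient, h0])

theorem hasCompactSupport_gradient {φ : Euc n → ℝ} (hφ : HasCompactSupport φ) :
    HasCompactSupport (∇ φ) :=
  hφ.of_isClosed_subset (isClosed_tsupport _) (tsupport_gradient_subset φ)

theorem integral_comp_toLp {E : Type*} [NormedAddCommGroup E] [NormedSpace ℝ E] (h : Euc n → E) :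
    ∫ x : Fin n → ℝ, h (WithLp.toLp 2 x) = ∫ y, h y :=
  (PiLp.volume_preserving_toLp (Fin n)).integral_comp
    (MeasurableEquiv.toLp 2 (Fin n → ℝ)).measurableEmbedding h

theorem sharp_sobolev_of_contDiff (hn : 3 ≤ n) {φ : Euc n → ℝ} (hφ : ContDiff ℝ ∞ φ)
    (hφs : HasCompactSupport φ) :
    n * (n - 2) * (∫ y : Euc n, (1 + ‖y‖ ^ 2) ^ (-(n : ℝ))) ^ (2 / (n : ℝ)) *
      (∫ y, |φ y| ^ (2 * n / ((n : ℝ) - 2))) ^ (((n : ℝ) - 2) / n) ≤ ∫ y, ‖∇ φ y‖ ^ 2 := by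
  have hgc := continuous_gradient hφ
  have hcoord : ∀ i, Continuous fun y => ∇ φ y i := fun i => by fun_prop
  have hi : ∀ i, Integrable fun y => (∇ φ y i) ^ 2 := fun i => by
    refine ((hcoord i).pow 2).integrable_of_hasCompactSupport
      ((hasCompactSupport_gradient hφs).mono fun x hx h0 => hx ?_)
    simp [h0]
  have hto : Continuous fun x : Fin n → ℝ => (WithLp.toLp 2 x : Euc n) := by fun_prop
  have key := sharp_sobolev_coord hn (g := fun x => φ (WithLp.toLp 2 x))
    (g' := fun i x => ∇ φ (WithLp.toLp 2 x) i) (hφ.continuous.comp hto)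
    (fun i => (hcoord i).comp hto)
    (hφs.comp_homeomorph (PiLp.homeomorph 2 (fun _ : Fin n => ℝ)).symm)
    (fun i x => hasDerivAt_comp_update (hφ.differentiable (by simp)) x i)
    (fun i => (PiLp.volume_preserving_toLp (Fin n)).integrable_comp_of_integrable (hi i))
  simp only [japSq_eq_norm] at key
  rw [integral_comp_toLp (fun y : Euc n => (1 + ‖y‖ ^ 2) ^ (-(n : ℝ))),
    integral_comp_toLp (fun y : Euc n => |φ y| ^ (2 * n / ((n : ℝ) - 2)))] at key
  refine key.trans (le_of_eq ?_)
  simp only [EuclideanSpace.norm_sq_eq, Real.norm_eq_abs, sq_abs]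
  rw [integral_finsetSum _ fun i _ => hi i]
  exact Finset.sum_congr rfl fun i _ => integral_comp_toLp (fun y => (∇ φ y i) ^ 2)

end SharpSobolev

/-! ### Removal of the compact support by cutoffs -/

section Approximation

variable {n : ℕ}

/-- `n(n-2) (∫ (1+|y|²)^{-n})^{2/n}`, the value of the best Sobolev constant. -/
def sharpConst (n : ℕ) : ℝ :=
  n * (n - 2) * (∫ y : Euc n, (1 + ‖y‖ ^ 2) ^ (-(n : ℝ))) ^ (2 / (n : ℝ))

theorem integral_one_add_norm_sq_pos : 0 < ∫ y : Euc n, (1 + ‖y‖ ^ 2) ^ (-(n : ℝ)) := by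
  rw [← integral_comp_toLp]
  simp only [← japSq_eq_norm]
  exact integral_japSq_rpow_pos

theorem sharpConst_pos (hn : 3 ≤ n) : 0 < sharpConst n := by
  have hn' : (3 : ℝ) ≤ n := by exact_mod_cast hn
  have hn2 : (0 : ℝ) < n - 2 := by linarith
  have := Real.rpow_pos_of_pos (integral_one_add_norm_sq_pos (n := n)) (2 / (n : ℝ))
  unfold sharpConst
  positivity

/-- The critical exponent `2n/(n-2)`. -/
def sobExp (n : ℕ) : ℝ≥0∞ := ENNReal.ofReal (2 * n / ((n : ℝ) - 2))

theorem two_le_exp (hn : 3 ≤ n) : (2 : ℝ) ≤ 2 * n / ((n : ℝ) - 2) := by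
  have hn' : (3 : ℝ) ≤ n := by exact_mod_cast hn
  rw [le_div_iff₀ (by linarith)]; linarith

theorem toReal_sobExp (hn : 3 ≤ n) : (sobExp n).toReal = 2 * n / ((n : ℝ) - 2) :=
  ENNReal.toReal_ofReal (by linarith [two_le_exp hn])

theorem sobExp_ne_zero (hn : 3 ≤ n) : sobExp n ≠ 0 := by
  rw [sobExp, Ne, ENNReal.ofReal_eq_zero, not_le]; linarith [two_le_exp hn]

theorem sobExp_ne_top : sobExp n ≠ ⊤ := ENNReal.ofReal_ne_top

theorem one_le_sobExp (hn : 3 ≤ n) : 1 ≤ sobExp n := by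
  rw [sobExp, ← ENNReal.ofReal_one]
  exact ENNReal.ofReal_le_ofReal (by linarith [two_le_exp hn])

theorem holderTriple_sobExp (hn : 3 ≤ n) : ENNReal.HolderTriple (n : ℝ≥0∞) (sobExp n) 2 := by
  have hn' : (3 : ℝ) ≤ n := by exact_mod_cast hn
  have hn2 : (0 : ℝ) < n - 2 := by linarith
  constructor
  rw [sobExp, ← ENNReal.ofReal_natCast n, ← ENNReal.ofReal_inv_of_pos (by linarith),
    ← ENNReal.ofReal_inv_of_pos (by positivity), ← ENNReal.ofReal_add (by positivity)
    (by positivity), show (2 : ℝ≥0∞) = ENNReal.ofReal 2 by simp,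
    ← ENNReal.ofReal_inv_of_pos two_pos]
  congr 1
  field_simp
  ring

theorem eLpNorm_le_gradient_of_contDiff (hn : 3 ≤ n) {φ : Euc n → ℝ} (hφ : ContDiff ℝ ∞ φ)
    (hφs : HasCompactSupport φ) : eLpNorm φ (sobExp n) volume ≤
      ENNReal.ofReal (sharpConst n ^ (-(1 / 2) : ℝ)) * eLpNorm (∇ φ) 2 volume := by
  have hn' : (3 : ℝ) ≤ n := by exact_mod_cast hn
  have hn2 : (0 : ℝ) < n - 2 := by linarith
  have hK := sharpConst_pos hn
  have h1 : MemLp φ (sobExp n) volume := hφ.continuous.memLp_of_hasCompactSupport hφs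
  have h2 : MemLp (∇ φ) 2 volume :=
    (continuous_gradient hφ).memLp_of_hasCompactSupport (hasCompactSupport_gradient hφs)
  have key := sharp_sobolev_of_contDiff hn hφ hφs
  rw [← sharpConst] at key
  rw [h1.eLpNorm_eq_integral_rpow_norm (sobExp_ne_zero hn) sobExp_ne_top,
    h2.eLpNorm_eq_integral_rpow_norm two_ne_zero ENNReal.ofNat_ne_top, toReal_sobExp hn,
    ← ENNReal.ofReal_mul (by positivity)]
  refine ENNReal.ofReal_le_ofReal ?_
  simp only [ENNReal.toReal_ofNat, Real.rpow_two, Real.norm_eq_abs]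
  set N := ∫ y, |φ y| ^ (2 * n / ((n : ℝ) - 2)) with hN
  set E := ∫ y, ‖∇ φ y‖ ^ 2 with hE
  have hN0 : 0 ≤ N := integral_nonneg fun x => by positivity
  have hE0 : 0 ≤ E := integral_nonneg fun x => by positivity
  have e1 : N ^ (2 * n / ((n : ℝ) - 2))⁻¹ = (N ^ (((n : ℝ) - 2) / n)) ^ (1 / 2 : ℝ) := by
    rw [← Real.rpow_mul hN0]; congr 1; field_simp
  rw [e1, Real.rpow_neg hK.le, inv_mul_eq_div, ← one_div, ← Real.div_rpow hE0 hK.le]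
  refine Real.rpow_le_rpow (by positivity) ?_ (by norm_num)
  rw [le_div_iff₀' hK]
  exact key

theorem gradient_mul_of_contDiff {χ φ : Euc n → ℝ} (hχ : ContDiff ℝ ∞ χ) (hφ : ContDiff ℝ ∞ φ)
    (x : Euc n) : ∇ (fun y => χ y * φ y) x = χ x • ∇ φ x + φ x • ∇ χ x := by
  have h1 : DifferentiableAt ℝ χ x := (hχ.differentiable (by simp)) x
  have h2 : DifferentiableAt ℝ φ x := (hφ.differentiable (by simp)) x
  simp only [gradient, fderiv_fun_mul h1 h2, map_add, map_smul]

/-- Continuity from above of the finite measure |f|^p dx along the complements of balls. -/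
theorem tendsto_eLpNorm_restrict_compl_ball {f : Euc n → ℝ} {p : ℝ≥0∞} (hp0 : p ≠ 0) (hp : p ≠ ⊤)
    (hf : MemLp f p volume) : Filter.Tendsto
      (fun k : ℕ => eLpNorm f p (volume.restrict {x | (k : ℝ) ≤ ‖x‖})) Filter.atTop (nhds 0) := by
  have hm : ∀ k : ℕ, MeasurableSet {x : Euc n | (k : ℝ) ≤ ‖x‖} := fun k =>
    measurableSet_le measurable_const measurable_norm
  set μ := (volume : Measure (Euc n)).withDensity fun x => ‖f x‖ₑ ^ p.toReal with hμ
  have hfin : μ univ ≠ ⊤ := by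
    rw [hμ, withDensity_apply _ MeasurableSet.univ, setLIntegral_univ]
    exact (lintegral_rpow_enorm_lt_top_of_eLpNorm_lt_top hp0 hp hf.2).ne
  have hanti : Antitone fun k : ℕ => {x : Euc n | (k : ℝ) ≤ ‖x‖} := fun a b hab x hx =>
    le_trans (Nat.cast_le.2 hab : (a : ℝ) ≤ b) (hx : (b : ℝ) ≤ ‖x‖)
  have h := tendsto_measure_iInter_atTop (μ := μ) (fun k => (hm k).nullMeasurableSet) hanti
    ⟨0, ne_top_of_le_ne_top hfin (measure_mono (subset_univ _))⟩
  have hempty : (⋂ k : ℕ, {x : Euc n | (k : ℝ) ≤ ‖x‖}) = ∅ := by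
    ext x
    simp only [mem_iInter, mem_ofPred_eq, mem_empty_iff_false, iff_false, not_forall, not_le]
    exact exists_nat_gt ‖x‖
  rw [hempty, measure_empty] at h
  have h2 := h.ennrpow_const (1 / p.toReal)
  rw [ENNReal.zero_rpow_of_pos (by have := ENNReal.toReal_pos hp0 hp; positivity)] at h2
  refine h2.congr fun k => ?_
  rw [Function.comp_apply, hμ, withDensity_apply _ (hm k),
    eLpNorm_eq_lintegral_rpow_enorm_toReal hp0 hp]

/-- Smooth cutoff functions at scale `k`. -/
theorem exists_cutoff : ∃ C : ℝ, ∀ k : ℕ, 0 < k → ∃ χ : Euc n → ℝ, ContDiff ℝ ∞ χ ∧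
    HasCompactSupport χ ∧ (∀ x, |χ x| ≤ 1) ∧ (∀ x, ‖x‖ ≤ k → χ x = 1) ∧
    (∀ x, ‖∇ χ x‖ ≤ C / k) ∧ (∀ x, ‖x‖ < k → ∇ χ x = 0) ∧ ∀ x, 3 * k ≤ ‖x‖ → ∇ χ x = 0 := by
  let b : ContDiffBump (0 : Euc n) := ⟨1, 2, one_pos, by norm_num⟩
  have hbc : ContDiff ℝ ∞ b := b.contDiff
  obtain ⟨C, hC⟩ := (hasCompactSupport_gradient b.hasCompactSupport).exists_bound_of_continuous
    (continuous_gradient hbc)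
  refine ⟨C, fun k hk => ?_⟩
  have hk0 : (0 : ℝ) < k := by exact_mod_cast hk
  have hsm : ContDiff ℝ ∞ fun x : Euc n => b ((k : ℝ)⁻¹ • x) :=
    hbc.comp (contDiff_const_smul _)
  have hnorm : ∀ x : Euc n, ‖(k : ℝ)⁻¹ • x‖ = ‖x‖ / k := fun x => by
    rw [norm_smul, norm_inv, Real.norm_of_nonneg hk0.le, inv_mul_eq_div]
  have hzero : ∀ x : Euc n, 2 * k ≤ ‖x‖ → b ((k : ℝ)⁻¹ • x) = 0 := fun x hx =>
    b.zero_of_le_dist (by rw [dist_zero_right, hnorm]; exact (le_div_iff₀ hk0).2 hx)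
  have hone : ∀ x : Euc n, ‖x‖ ≤ k → b ((k : ℝ)⁻¹ • x) = 1 := fun x hx =>
    b.one_of_mem_closedBall (by
      rw [mem_closedBall_zero_iff, hnorm]; exact (div_le_iff₀ hk0).2 (by rw [one_mul]; exact hx))
  have hgrad : ∀ x : Euc n, ∇ (fun x : Euc n => b ((k : ℝ)⁻¹ • x)) x =
      (k : ℝ)⁻¹ • ∇ b ((k : ℝ)⁻¹ • x) := fun x => by
    have h1 : HasFDerivAt (fun x : Euc n => b ((k : ℝ)⁻¹ • x))
        ((fderiv ℝ b ((k : ℝ)⁻¹ • x)).comp ((k : ℝ)⁻¹ • ContinuousLinearMap.id ℝ (Euc n))) x :=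
      ((hbc.differentiable (by simp)) _).hasFDerivAt.comp x
        ((hasFDerivAt_id x).const_smul (k : ℝ)⁻¹)
    rw [gradient, h1.fderiv, gradient, ← map_smul]
    congr 1
    ext v
    simp
  refine ⟨fun x => b ((k : ℝ)⁻¹ • x), hsm, ?_, fun x => ?_, hone, fun x => ?_, fun x hx => ?_,
    fun x hx => ?_⟩
  · refine HasCompactSupport.of_support_subset_isCompact
      (isCompact_closedBall (0 : Euc n) (2 * k)) fun x hx => ?_
    rw [mem_closedBall_zero_iff]
    by_contra h
    exact hx (hzero x (not_le.1 h).le)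
  · rw [abs_of_nonneg b.nonneg]; exact b.le_one
  · rw [hgrad, norm_smul, norm_inv, Real.norm_of_nonneg hk0.le, inv_mul_eq_div]
    gcongr
    exact hC _
  · have : (fun x : Euc n => b ((k : ℝ)⁻¹ • x)) =ᶠ[nhds x] fun _ => 1 := by
      filter_upwards [(isOpen_lt continuous_norm continuous_const).mem_nhds hx] with y hy
      exact hone y (le_of_lt hy)
    rw [gradient, this.fderiv_eq]
    simp
  -- The scaled bump vanishes from radius 2k on; the margin up to 3k provides a neighbourhood of x
  -- on which it is zero.
  · have : (fun x : Euc n => b ((k : ℝ)⁻¹ • x)) =ᶠ[nhds x] fun _ => 0 := by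
      filter_upwards [(isOpen_lt continuous_const continuous_norm).mem_nhds
        (show 2 * (k : ℝ) < ‖x‖ by linarith)] with y hy
      exact hzero y (le_of_lt hy)
    rw [gradient, this.fderiv_eq]
    simp

/-- The sharp Sobolev inequality for smooth functions in `L^{2n/(n-2)}`. -/
theorem eLpNorm_le_gradient_of_memLp (hn : 3 ≤ n) {f : Euc n → ℝ} (hf : ContDiff ℝ ∞ f)
    (hfp : MemLp f (sobExp n) volume) : eLpNorm f (sobExp n) volume ≤
      ENNReal.ofReal (sharpConst n ^ (-(1 / 2) : ℝ)) * eLpNorm (∇ f) 2 volume := by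
  have : Nontrivial (Euc n) := by
    have : Nonempty (Fin n) := ⟨⟨0, by omega⟩⟩
    infer_instance
  have := holderTriple_sobExp hn
  obtain ⟨C, hC⟩ := exists_cutoff (n := n)
  -- The cutoff with index k has scale k + 1, so that the scale is positive also for k = 0.
  choose χ hχ hχs hχ1 hχone hχC hχin hχout using fun k : ℕ => hC (k + 1) k.succ_pos
  set S := ENNReal.ofReal (sharpConst n ^ (-(1 / 2) : ℝ)) with hS
  have hgm := (continuous_gradient hf).aestronglyMeasurable (μ := volume)
  -- the gradients of the cutoff functions are bounded in `Lⁿ`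
  set M : ℝ≥0∞ := volume (Metric.ball (0 : Euc n) 1) ^ (n : ℝ)⁻¹ * ENNReal.ofReal (3 * C) with hM
  have hMtop : M ≠ ⊤ := ENNReal.mul_ne_top
    (ENNReal.rpow_ne_top_of_nonneg (by positivity) measure_ball_lt_top.ne) ENNReal.ofReal_ne_top
  have hnn : (0 : ℝ) < n := by exact_mod_cast (by omega : 0 < n)
  have hχn : ∀ k, eLpNorm (∇ (χ k)) n volume ≤ M := fun k => by
    have hk0 : (0 : ℝ) < (k + 1 : ℕ) := by positivity
    have hs : Function.support (∇ (χ k)) ⊆ Metric.ball 0 (3 * (k + 1 : ℕ)) := fun x hx => by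
      rw [mem_ball_zero_iff]
      by_contra h
      exact hx (hχout k x (not_lt.1 h))
    rw [← eLpNorm_restrict_eq_of_support_subset hs]
    -- A gradient of size C/(k+1) on a ball of radius 3(k+1): in Lⁿ the scale cancels, leaving the
    -- constant M.
    refine (eLpNorm_le_of_ae_bound (Filter.Eventually.of_forall (hχC k))).trans (le_of_eq ?_)
    rw [Measure.restrict_apply_univ, Measure.addHaar_ball _ _ (by positivity),
      finrank_euclideanSpace_fin, ENNReal.toReal_natCast, ENNReal.mul_rpow_of_nonneg _ _
      (by positivity), ENNReal.ofReal_rpow_of_nonneg (by positivity) (by positivity),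
      ← Real.rpow_natCast, ← Real.rpow_mul (by positivity), mul_inv_cancel₀ hnn.ne', Real.rpow_one,
      mul_right_comm, ← ENNReal.ofReal_mul (by positivity), mul_comm, hM]
    congr 2
    field_simp
  have hbound : ∀ k, eLpNorm (fun x => χ k x * f x) (sobExp n) volume ≤
      S * (eLpNorm (∇ f) 2 volume +
        M * eLpNorm f (sobExp n) (volume.restrict {x | (k : ℝ) ≤ ‖x‖})) := fun k => by
    refine (eLpNorm_le_gradient_of_contDiff hn ((hχ k).mul hf) (hχs k).mul_right).trans ?_
    gcongr
    have e : ∇ (fun x => χ k x * f x) = (fun x => χ k x • ∇ f x) + fun x => f x • ∇ (χ k) x :=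
      funext fun x => gradient_mul_of_contDiff (hχ k) hf x
    have hm1 : AEStronglyMeasurable (fun x => χ k x • ∇ f x) volume :=
      ((hχ k).continuous.smul (continuous_gradient hf)).aestronglyMeasurable
    have hm2 : AEStronglyMeasurable (fun x => f x • ∇ (χ k) x) volume :=
      (hf.continuous.smul (continuous_gradient (hχ k))).aestronglyMeasurable
    rw [e]
    refine (eLpNorm_add_le hm1 hm2 (by norm_num)).trans (add_le_add ?_ ?_)
    · refine eLpNorm_mono fun x => ?_
      rw [norm_smul]
      exact mul_le_of_le_one_left (norm_nonneg _) (hχ1 k x)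
    · have hms : MeasurableSet {x : Euc n | (k : ℝ) ≤ ‖x‖} :=
        measurableSet_le measurable_const measurable_norm
      have hs : Function.support (fun x => f x • ∇ (χ k) x) ⊆ {x : Euc n | (k : ℝ) ≤ ‖x‖} :=
        fun x hx => by
          by_contra h
          refine hx ?_
          have h' : ‖x‖ < k := not_le.1 h
          simp only []
          rw [hχin k x (by push_cast; linarith), smul_zero]
      rw [← eLpNorm_restrict_eq_of_support_subset hs]
      have hnorm : eLpNorm (fun x => f x • ∇ (χ k) x) 2 (volume.restrict {x | (k : ℝ) ≤ ‖x‖}) =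
          eLpNorm ((fun x => ‖∇ (χ k) x‖) • f) 2 (volume.restrict {x | (k : ℝ) ≤ ‖x‖}) :=
        eLpNorm_congr_norm_ae (Filter.Eventually.of_forall fun x => by
          simp [norm_smul, mul_comm])
      rw [hnorm]
      -- Hölder's inequality with 1/2 = 1/n + (n−2)/(2n). The Lⁿ norm stays bounded while the tail
      -- of f tends to zero.
      refine (eLpNorm_smul_le_mul_eLpNorm (p := n) (q := sobExp n)
        hf.continuous.aestronglyMeasurable
        (continuous_gradient (hχ k)).norm.aestronglyMeasurable).trans ?_
      gcongr
      rw [eLpNorm_norm]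
      exact (eLpNorm_mono_measure _ Measure.restrict_le_self).trans (hχn k)
  have hlim : Filter.Tendsto (fun k : ℕ => S * (eLpNorm (∇ f) 2 volume +
        M * eLpNorm f (sobExp n) (volume.restrict {x | (k : ℝ) ≤ ‖x‖}))) Filter.atTop
      (nhds (S * (eLpNorm (∇ f) 2 volume + M * 0))) := by
    refine ENNReal.Tendsto.const_mul (Filter.Tendsto.add tendsto_const_nhds
      (ENNReal.Tendsto.const_mul (tendsto_eLpNorm_restrict_compl_ball (sobExp_ne_zero hn)
        sobExp_ne_top hfp) (Or.inr hMtop))) (Or.inr ENNReal.ofReal_ne_top)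
  rw [mul_zero, add_zero] at hlim
  have hfatou := Lp.eLpNorm_lim_le_liminf_eLpNorm (p := sobExp n) (μ := volume)
    (f := fun k x => χ k x * f x)
    (fun k => ((hχ k).continuous.mul hf.continuous).aestronglyMeasurable) f
    (Filter.Eventually.of_forall fun x => by
      refine tendsto_const_nhds.congr' ?_
      filter_upwards [Filter.eventually_ge_atTop ⌈‖x‖⌉₊] with k hk
      rw [hχone k x ((Nat.le_ceil _).trans (by push_cast; exact (Nat.cast_le.2 hk).trans (by simp))),
        one_mul])
  exact hfatou.trans ((Filter.liminf_le_liminf (Filter.Eventually.of_forall hbound)).trans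
    (le_of_eq hlim.liminf_eq))

end Approximation

/-! ### From smooth functions to weak gradients by mollification -/

section Mollification

variable {n : ℕ}

open scoped Convolution

/-- Young's inequality for the convolution with a probability density. -/
theorem eLpNorm_convolution_le {E : Type*} [NormedAddCommGroup E] [NormedSpace ℝ E]
    [MeasurableSpace E] [BorelSpace E] {ρ : Euc n → ℝ}
    (hρ : Continuous ρ) (hρ0 : ∀ x, 0 ≤ ρ x) (hρi : Integrable ρ) (hρ1 : ∫ x, ρ x = 1)
    {f : Euc n → E} (hf : StronglyMeasurable f) {p : ℝ≥0∞} (hp1 : 1 ≤ p) (hp : p ≠ ⊤) :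
    eLpNorm (ρ ⋆[ContinuousLinearMap.lsmul ℝ ℝ, volume] f) p volume ≤ eLpNorm f p volume := by
  have hp0 : p ≠ 0 := (zero_lt_one.trans_le hp1).ne'
  have hpr := ENNReal.toReal_pos hp0 hp
  set ν := (volume : Measure (Euc n)).withDensity fun t => ENNReal.ofReal (ρ t) with hν
  have hρm : Measurable fun t => ENNReal.ofReal (ρ t) := hρ.measurable.ennreal_ofReal
  have hνp : IsProbabilityMeasure ν := ⟨by
    rw [hν, withDensity_apply _ MeasurableSet.univ, setLIntegral_univ,
      ← ofReal_integral_eq_lintegral_ofReal hρi (Filter.Eventually.of_forall hρ0), hρ1,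
      ENNReal.ofReal_one]⟩
  have hsm : ∀ x, StronglyMeasurable fun t => f (x - t) := fun x =>
    hf.comp_measurable (measurable_const.sub measurable_id)
  -- Jensen's inequality: for the probability measure ρ dt the L¹ norm is at most the L^p norm.
  have h1 : ∀ x, ‖(ρ ⋆[ContinuousLinearMap.lsmul ℝ ℝ, volume] f) x‖ₑ ^ p.toReal ≤
      ∫⁻ t, ‖f (x - t)‖ₑ ^ p.toReal ∂ν := fun x => by
    have h2 : ‖(ρ ⋆[ContinuousLinearMap.lsmul ℝ ℝ, volume] f) x‖ₑ ≤
        eLpNorm (fun t => f (x - t)) 1 ν := by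
      rw [convolution_lsmul, eLpNorm_one_eq_lintegral_enorm, hν,
        lintegral_withDensity_eq_lintegral_mul _ hρm (hsm x).enorm]
      refine (enorm_integral_le_lintegral_enorm _).trans (le_of_eq (lintegral_congr fun t => ?_))
      rw [enorm_smul, Real.enorm_of_nonneg (hρ0 t), Pi.mul_apply]
    have h3 := h2.trans (eLpNorm_le_eLpNorm_of_exponent_le hp1 (hsm x).aestronglyMeasurable)
    rw [eLpNorm_eq_lintegral_rpow_enorm_toReal hp0 hp] at h3
    have := ENNReal.rpow_le_rpow h3 hpr.le
    rwa [← ENNReal.rpow_mul, one_div_mul_cancel hpr.ne', ENNReal.rpow_one] at this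
  rw [eLpNorm_eq_lintegral_rpow_enorm_toReal hp0 hp, eLpNorm_eq_lintegral_rpow_enorm_toReal hp0 hp]
  refine ENNReal.rpow_le_rpow ((lintegral_mono h1).trans ?_) (by positivity)
  rw [lintegral_lintegral_swap]
  · have h4 : ∀ t, ∫⁻ x, ‖f (x - t)‖ₑ ^ p.toReal = ∫⁻ x, ‖f x‖ₑ ^ p.toReal := fun t =>
      lintegral_sub_right_eq_self (fun x => ‖f x‖ₑ ^ p.toReal) t
    simp only [h4, lintegral_const, measure_univ, mul_one, le_refl]
  · exact ((hf.comp_measurable (measurable_fst.sub measurable_snd)).enorm.pow_const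
      _).aemeasurable

theorem IsWeakGradient.congr {u u' : Euc n → ℝ} {g g' : Euc n → Euc n} (h : IsWeakGradient u g)
    (hu : u =ᵐ[volume] u') (hg : g =ᵐ[volume] g') : IsWeakGradient u' g' := fun φ hφ => by
  have h1 : ∫ x, u' x • ∇ φ x = ∫ x, u x • ∇ φ x :=
    integral_congr_ae (hu.mono fun x hx => by simp only [hx])
  have h2 : ∫ x, φ x • g' x = ∫ x, φ x • g x :=
    integral_congr_ae (hg.mono fun x hx => by simp only [hx])
  rw [h1, h2, h φ hφ]

/-- Mollification commutes with the weak gradient. -/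
theorem gradient_convolution {ρ : Euc n → ℝ} (hρ : ContDiff ℝ ∞ ρ) (hρs : HasCompactSupport ρ)
    {u : Euc n → ℝ} {g : Euc n → Euc n} (hu : LocallyIntegrable u)
    (h : IsWeakGradient u g) : ∇ (ρ ⋆[ContinuousLinearMap.lsmul ℝ ℝ, volume] u) =
      ρ ⋆[ContinuousLinearMap.lsmul ℝ ℝ, volume] g := by
  funext x
  -- The reflected translate of ρ is the test function; its gradient changes sign, which absorbs the
  -- minus sign in the weak gradient.
  set φ : Euc n → ℝ := fun y => ρ (x - y) with hφ
  have hφt : IsTestFunction univ φ := by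
    refine ⟨hρ.comp (contDiff_const.sub contDiff_id), ?_, subset_univ _⟩
    exact hρs.comp_homeomorph (Homeomorph.subLeft x)
  have hfd : ∀ y, ∇ φ y = -∇ ρ (x - y) := fun y => by
    have h1 : HasFDerivAt φ ((fderiv ℝ ρ (x - y)).comp (-ContinuousLinearMap.id ℝ (Euc n))) y :=
      ((hρ.differentiable (by simp)) _).hasFDerivAt.comp y ((hasFDerivAt_id y).const_sub x)
    rw [gradient, h1.fderiv, gradient, ← map_neg]
    congr 1
    ext v
    simp
  let L : (Euc n →L[ℝ] ℝ) →L[ℝ] ℝ →L[ℝ] Euc n →L[ℝ] ℝ :=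
    ContinuousLinearMap.precompL (Euc n) (ContinuousLinearMap.lsmul ℝ ℝ)
  have hconv : HasFDerivAt _ ((fderiv ℝ ρ ⋆[L, volume] u) x) x := hρs.hasFDerivAt_convolution_left (ContinuousLinearMap.lsmul ℝ ℝ)
    (hρ.of_le (by simp)) hu x
  have hgc := continuous_gradient hρ
  refine ext_inner_right ℝ fun v => ?_
  have hdi : Integrable fun t => u (x - t) • ∇ ρ t := by
    have := (hasCompactSupport_gradient hρs).convolutionExists_left
      (ContinuousLinearMap.lsmul ℝ ℝ).flip hgc hu x
    simpa [ConvolutionExistsAt] using this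
  have e1 : ⟪∇ (ρ ⋆[ContinuousLinearMap.lsmul ℝ ℝ, volume] u) x, v⟫_ℝ =
      ∫ t, u (x - t) * ⟪∇ ρ t, v⟫_ℝ := by
    rw [gradient, InnerProductSpace.toDual_symm_apply, hconv.fderiv, convolution_def,
      ContinuousLinearMap.integral_apply (hρs.fderiv ℝ |>.convolutionExists_left L
        (hρ.continuous_fderiv (by simp)) hu x :)]
    refine integral_congr_ae (Filter.Eventually.of_forall fun t => ?_)
    simp only [L, ContinuousLinearMap.precompL_apply, ContinuousLinearMap.lsmul_apply, smul_eq_mul,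
      gradient, InnerProductSpace.toDual_symm_apply]
    ring
  have e2 : ∫ t, u (x - t) • ∇ ρ t = -∫ y, u y • ∇ φ y := by
    rw [← integral_sub_left_eq_self (fun t => u (x - t) • ∇ ρ t) volume x, ← integral_neg]
    refine integral_congr_ae (Filter.Eventually.of_forall fun y => ?_)
    simp only [sub_sub_cancel, hfd, smul_neg, neg_neg]
  have e3 : ∫ t, ρ t • g (x - t) = ∫ y, φ y • g y := by
    rw [← integral_sub_left_eq_self (fun t => ρ t • g (x - t)) volume x]
    simp only [sub_sub_cancel, hφ]
  rw [e1, convolution_lsmul, e3, ← neg_eq_iff_eq_neg.2 (h φ hφt), ← e2, real_inner_comm,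
    ← integral_inner hdi]
  refine integral_congr_ae (Filter.Eventually.of_forall fun t => ?_)
  simp only [inner_smul_right, real_inner_comm v]

/-- The sharp Sobolev inequality on `ℝⁿ`. -/
theorem eLpNorm_le_of_isWeakGradient (hn : 3 ≤ n) {u : Euc n → ℝ} {g : Euc n → Euc n}
    (hu : MemLp u (sobExp n) volume) (hg : MemLp g 2 volume) (h : IsWeakGradient u g) :
    eLpNorm u (sobExp n) volume ≤
      ENNReal.ofReal (sharpConst n ^ (-(1 / 2) : ℝ)) * eLpNorm g 2 volume := by
  -- All terms depend only on classes modulo null sets, and the convolution estimate wants strongly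
  -- measurable representatives.
  wlog hm : StronglyMeasurable u ∧ StronglyMeasurable g generalizing u g
  · have hu' := hu.1.ae_eq_mk
    have hg' := hg.1.ae_eq_mk
    rw [eLpNorm_congr_ae hu', eLpNorm_congr_ae hg']
    exact this ((memLp_congr_ae hu').1 hu) ((memLp_congr_ae hg').1 hg) (h.congr hu' hg')
      ⟨hu.1.stronglyMeasurable_mk, hg.1.stronglyMeasurable_mk⟩
  have hul : LocallyIntegrable u := hu.locallyIntegrable (one_le_sobExp hn)
  -- The ratio of the radii is the constant 2, as the almost everywhere convergence of the
  -- mollifications requires.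
  let b : ℕ → ContDiffBump (0 : Euc n) := fun k =>
    ⟨1 / (k + 1), 2 / (k + 1), by positivity, by gcongr; norm_num⟩
  set ρ : ℕ → Euc n → ℝ := fun k => (b k).normed volume with hρ
  have hρc : ∀ k, ContDiff ℝ ∞ (ρ k) := fun k => (b k).contDiff_normed
  have hρs : ∀ k, HasCompactSupport (ρ k) := fun k => (b k).hasCompactSupport_normed
  have hρ0 : ∀ k x, 0 ≤ ρ k x := fun k x => (b k).nonneg_normed x
  have hρi : ∀ k, Integrable (ρ k) := fun k =>
    (hρc k).continuous.integrable_of_hasCompactSupport (hρs k)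
  have hρ1 : ∀ k, ∫ x, ρ k x = 1 := fun k => (b k).integral_normed
  have hcd : ∀ k, ContDiff ℝ ∞ (ρ k ⋆[ContinuousLinearMap.lsmul ℝ ℝ, volume] u) := fun k =>
    (hρs k).contDiff_convolution_left _ (hρc k) hul
  have hk : ∀ k, eLpNorm (ρ k ⋆[ContinuousLinearMap.lsmul ℝ ℝ, volume] u) (sobExp n) volume ≤
      ENNReal.ofReal (sharpConst n ^ (-(1 / 2) : ℝ)) * eLpNorm g 2 volume := fun k => by
    refine (eLpNorm_le_gradient_of_memLp hn (hcd k) ⟨(hcd k).continuous.aestronglyMeasurable,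
      (eLpNorm_convolution_le (hρc k).continuous (hρ0 k) (hρi k) (hρ1 k) hm.1 (one_le_sobExp hn)
        sobExp_ne_top).trans_lt hu.2⟩).trans ?_
    rw [gradient_convolution (hρc k) (hρs k) hul h]
    gcongr
    exact eLpNorm_convolution_le (hρc k).continuous (hρ0 k) (hρi k) (hρ1 k) hm.2 (by norm_num)
      (by norm_num)
  have hlim : Filter.Tendsto (fun k => (b k).rOut) Filter.atTop (nhds 0) := by
    have := (tendsto_one_div_add_atTop_nhds_zero_nat (𝕜 := ℝ)).const_mul 2
    simpa [b, div_eq_mul_inv] using this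
  have hfatou := Lp.eLpNorm_lim_le_liminf_eLpNorm (p := sobExp n) (μ := volume)
    (f := fun k => ρ k ⋆[ContinuousLinearMap.lsmul ℝ ℝ, volume] u)
    (fun k => (hcd k).continuous.aestronglyMeasurable) u
    (ContDiffBump.ae_convolution_tendsto_right_of_locallyIntegrable (K := 2) hlim
      (Filter.Eventually.of_forall fun k => by simp [b]; field_simp; rfl) hul)
  refine hfatou.trans ((Filter.liminf_le_liminf (Filter.Eventually.of_forall hk)).trans ?_)
  simp

end Mollification

/-! ### The bubbles: equation, mass, and the value of the best Sobolev constant -/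

section Bubble

variable {n : ℕ}

theorem gradient_apply (f : Euc n → ℝ) (x : Euc n) (i : Fin n) :
    ∇ f x i = fderiv ℝ f x (EuclideanSpace.single i 1) := by
  have : ∇ f x i = ⟪∇ f x, EuclideanSpace.single i 1⟫_ℝ := by
    rw [EuclideanSpace.inner_single_right]; simp
  rw [this, gradient, InnerProductSpace.toDual_symm_apply]

theorem integral_mul_fderiv_of_hasCompactSupport {f φ : Euc n → ℝ} (hf : ContDiff ℝ ∞ f)
    (hφ : ContDiff ℝ ∞ φ) (hφs : HasCompactSupport φ) (v : Euc n) :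
    ∫ y, f y * fderiv ℝ φ y v = -∫ y, fderiv ℝ f y v * φ y := by
  have hcf : Continuous fun y => fderiv ℝ f y v :=
    (hf.continuous_fderiv (by simp)).clm_apply continuous_const
  have hcφ : Continuous fun y => fderiv ℝ φ y v :=
    (hφ.continuous_fderiv (by simp)).clm_apply continuous_const
  refine integral_mul_fderiv_eq_neg_fderiv_mul_of_integrable ?_ ?_ ?_
    (fun x _ => hf.differentiable (by simp) x) (fun x _ => hφ.differentiable (by simp) x)
  · exact (hcf.mul hφ.continuous).integrable_of_hasCompactSupport hφs.mul_left
  · exact (hf.continuous.mul hcφ).integrable_of_hasCompactSupport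
      (HasCompactSupport.mul_left (hφs.fderiv_apply ℝ v))
  · exact (hf.continuous.mul hφ.continuous).integrable_of_hasCompactSupport hφs.mul_left

theorem isWeakGradient_gradient {f : Euc n → ℝ} (hf : ContDiff ℝ ∞ f) :
    IsWeakGradient f (∇ f) := fun φ hφ => by
  have hφs := hφ.hasCompactSupport
  have h1 : Integrable fun x => f x • ∇ φ x :=
    (hf.continuous.smul (continuous_gradient hφ.contDiff)).integrable_of_hasCompactSupport
      (hasCompactSupport_gradient hφs).smul_left
  have h2 : Integrable fun x => φ x • ∇ f x :=
    (hφ.contDiff.continuous.smul (continuous_gradient hf)).integrable_of_hasCompactSupport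
      hφs.smul_right
  refine ext_inner_left ℝ fun v => ?_
  rw [inner_neg_right, ← integral_inner h1, ← integral_inner h2]
  have := integral_mul_fderiv_of_hasCompactSupport hf hφ.contDiff hφs v
  have hin : ∀ (h : Euc n → ℝ) x, ⟪v, ∇ h x⟫_ℝ = fderiv ℝ h x v := fun h x => by
    rw [real_inner_comm, gradient, InnerProductSpace.toDual_symm_apply]
  simp only [inner_smul_right, hin]
  rw [this]
  simp only [mul_comm]

/-- `1 + λ²|y-a|²`. -/
def bubbleJap (a : Euc n) (l : ℝ) (y : Euc n) : ℝ := 1 + l ^ 2 * ‖y - a‖ ^ 2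

theorem one_le_bubbleJap (a : Euc n) (l : ℝ) (y : Euc n) : 1 ≤ bubbleJap a l y :=
  le_add_of_nonneg_right (by positivity)

theorem bubbleJap_pos (a : Euc n) (l : ℝ) (y : Euc n) : 0 < bubbleJap a l y :=
  one_pos.trans_le (one_le_bubbleJap a l y)

theorem contDiff_bubbleJap_rpow (a : Euc n) (l s : ℝ) :
    ContDiff ℝ ∞ fun y => bubbleJap a l y ^ s :=
  ContDiff.rpow_const_of_ne
    (contDiff_const.add (contDiff_const.mul ((contDiff_id.sub contDiff_const).norm_sq ℝ)))
    fun y => (bubbleJap_pos a l y).ne'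

theorem hasFDerivAt_bubbleJap_rpow (a : Euc n) (l s : ℝ) (y : Euc n) :
    HasFDerivAt (fun y => bubbleJap a l y ^ s)
      ((s * bubbleJap a l y ^ (s - 1) * (2 * l ^ 2)) • innerSL ℝ (y - a)) y := by
  have h1 : HasFDerivAt (bubbleJap a l) ((2 * l ^ 2) • innerSL ℝ (y - a)) y := by
    have h := ((((hasFDerivAt_id y).sub_const a).norm_sq).const_mul (l ^ 2)).const_add 1
    refine h.congr_fderiv ?_
    ext v
    simp
    ring
  have := h1.rpow_const (p := s) (Or.inl (bubbleJap_pos a l y).ne')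
  refine this.congr_fderiv ?_
  rw [smul_smul]

theorem bubble_eq (a : Euc n) (l : ℝ) (y : Euc n) : bubble a l y =
    c₀ n * l ^ (((n : ℝ) - 2) / 2) * bubbleJap a l y ^ (-(((n : ℝ) - 2) / 2)) := by
  rw [bubble, Real.rpow_neg (bubbleJap_pos a l y).le, bubbleJap, div_eq_mul_inv]

theorem c₀_pos (hn : 3 ≤ n) : 0 < c₀ n := by
  have hn' : (3 : ℝ) ≤ n := by exact_mod_cast hn
  exact Real.rpow_pos_of_pos (mul_pos (by linarith) (by linarith)) _

theorem bubble_pos (hn : 3 ≤ n) (a : Euc n) {l : ℝ} (hl : 0 < l) (y : Euc n) :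
    0 < bubble a l y := by
  rw [bubble_eq]
  exact mul_pos (mul_pos (c₀_pos hn) (Real.rpow_pos_of_pos hl _))
    (Real.rpow_pos_of_pos (bubbleJap_pos a l y) _)

theorem gradient_bubble (a : Euc n) (l : ℝ) (y : Euc n) : ∇ (bubble a l) y =
    (-(c₀ n * l ^ (((n : ℝ) - 2) / 2) * (n - 2) * l ^ 2) *
      bubbleJap a l y ^ (-((n : ℝ) / 2))) • (y - a) := by
  have h : HasFDerivAt (bubble a l) _ y :=
    ((hasFDerivAt_bubbleJap_rpow a l (-(((n : ℝ) - 2) / 2)) y).const_mul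
      (c₀ n * l ^ (((n : ℝ) - 2) / 2))).congr_of_eventuallyEq
      (Filter.Eventually.of_forall fun y => bubble_eq a l y)
  refine ext_inner_right ℝ fun v => ?_
  rw [gradient, InnerProductSpace.toDual_symm_apply, h.fderiv, inner_smul_left]
  simp only [smul_apply, innerSL_apply_apply, smul_eq_mul, conj_trivial]
  rw [show -(((n : ℝ) - 2) / 2) - 1 = -((n : ℝ) / 2) by ring]
  ring

theorem critExp_eq (hn : 3 ≤ n) : critExp n = 2 * n / ((n : ℝ) - 2) - 1 := by
  have hn' : (3 : ℝ) ≤ n := by exact_mod_cast hn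
  have hn2 : (n : ℝ) - 2 ≠ 0 := by linarith
  rw [critExp]; field_simp; ring

/-- The normalisation of the bubble: c₀^{4/(n−2)} = n(n−2) is what gives −Δδ = δ^p the coefficient
one. -/
theorem c₀_rpow_critExp (hn : 3 ≤ n) : c₀ n ^ critExp n = n * (n - 2) * c₀ n := by
  have hn' : (3 : ℝ) ≤ n := by exact_mod_cast hn
  have hn2 : (0 : ℝ) < n - 2 := by linarith
  have hb : (0 : ℝ) < n * (n - 2) := by positivity
  have : critExp n = 4 / (n - 2) + 1 := by rw [critExp]; field_simp; ring
  rw [this, Real.rpow_add_one (c₀_pos hn).ne']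
  congr 1
  rw [c₀, ← Real.rpow_mul hb.le, show ((n : ℝ) - 2) / 4 * (4 / (n - 2)) = 1 by field_simp,
    Real.rpow_one]

theorem bubble_rpow_critExp (hn : 3 ≤ n) (a : Euc n) {l : ℝ} (hl : 0 < l) (y : Euc n) :
    bubble a l y ^ critExp n = c₀ n * l ^ (((n : ℝ) - 2) / 2) * (n - 2) * l ^ 2 * n *
      bubbleJap a l y ^ (-((n : ℝ) / 2) - 1) := by
  have hn' : (3 : ℝ) ≤ n := by exact_mod_cast hn
  have hn2 : (0 : ℝ) < n - 2 := by linarith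
  have hX := bubbleJap_pos a l y
  rw [bubble_eq, Real.mul_rpow (mul_pos (c₀_pos hn) (Real.rpow_pos_of_pos hl _)).le
    (Real.rpow_pos_of_pos hX _).le, Real.mul_rpow (c₀_pos hn).le (Real.rpow_pos_of_pos hl _).le,
    c₀_rpow_critExp hn, ← Real.rpow_mul hl.le, ← Real.rpow_mul hX.le,
    show ((n : ℝ) - 2) / 2 * critExp n = (n - 2) / 2 + (2 : ℕ) by
      rw [critExp]; push_cast; field_simp; ring,
    show -(((n : ℝ) - 2) / 2) * critExp n = -(n / 2) - 1 by
      rw [critExp]; field_simp; ring, Real.rpow_add_natCast hl.ne']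
  ring

theorem continuous_bubble (a : Euc n) (l : ℝ) : Continuous (bubble a l) :=
  (contDiff_bubble a l).continuous

theorem continuous_bubble_rpow (hn : 3 ≤ n) (a : Euc n) {l : ℝ} (hl : 0 < l) (s : ℝ) :
    Continuous fun y => bubble a l y ^ s :=
  (continuous_bubble a l).rpow_const fun y => Or.inl (bubble_pos hn a hl y).ne'

/-- The equation `-Δδ = δ^p`, tested against `φ ∈ C_c^∞`. -/
theorem integral_gradient_bubble (hn : 3 ≤ n) (a : Euc n) {l : ℝ} (hl : 0 < l) {φ : Euc n → ℝ}
    (hφ : ContDiff ℝ ∞ φ) (hφs : HasCompactSupport φ) :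
    ∫ y, ⟪∇ (bubble a l) y, ∇ φ y⟫_ℝ = ∫ y, bubble a l y ^ critExp n * φ y := by
  set c : ℝ := c₀ n * l ^ (((n : ℝ) - 2) / 2) * (n - 2) * l ^ 2 with hc
  -- The components of ∇δ; the divergence of this field is computed coordinate by coordinate and
  -- then summed.
  set h : Fin n → Euc n → ℝ := fun i y =>
    -c * (bubbleJap a l y ^ (-((n : ℝ) / 2)) * (y i - a i)) with hh
  have hproj : ∀ i, ContDiff ℝ ∞ fun y : Euc n => y i - a i := fun i =>
    (EuclideanSpace.proj i : Euc n →L[ℝ] ℝ).contDiff.sub contDiff_const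
  have hhc : ∀ i, ContDiff ℝ ∞ (h i) := fun i =>
    contDiff_const.mul ((contDiff_bubbleJap_rpow a l _).mul (hproj i))
  have hhd : ∀ i y, fderiv ℝ (h i) y (EuclideanSpace.single i 1) =
      -c * (bubbleJap a l y ^ (-((n : ℝ) / 2)) -
        n * l ^ 2 * bubbleJap a l y ^ (-((n : ℝ) / 2) - 1) * (y i - a i) ^ 2) := fun i y => by
    have h1 : HasFDerivAt (fun y : Euc n => y i - a i)
        (EuclideanSpace.proj i : Euc n →L[ℝ] ℝ) y :=
      (EuclideanSpace.proj i : Euc n →L[ℝ] ℝ).hasFDerivAt.sub_const _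
    have h2 := ((hasFDerivAt_bubbleJap_rpow a l (-((n : ℝ) / 2)) y).mul h1).const_mul (-c)
    have h3 : HasFDerivAt (h i) _ y := h2
    rw [h3.fderiv]
    simp [EuclideanSpace.inner_single_right]
    ring
  have hi1 : ∀ i, Integrable fun y => h i y * fderiv ℝ φ y (EuclideanSpace.single i 1) := fun i =>
    ((hhc i).continuous.mul ((hφ.continuous_fderiv (by simp)).clm_apply
      continuous_const)).integrable_of_hasCompactSupport
      (HasCompactSupport.mul_left (hφs.fderiv_apply ℝ _))
  have hi2 : ∀ i, Integrable fun y => fderiv ℝ (h i) y (EuclideanSpace.single i 1) * φ y :=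
    fun i => ((((hhc i).continuous_fderiv (by simp)).clm_apply continuous_const).mul
      hφ.continuous).integrable_of_hasCompactSupport hφs.mul_left
  have e1 : ∀ y, ⟪∇ (bubble a l) y, ∇ φ y⟫_ℝ =
      ∑ i, h i y * fderiv ℝ φ y (EuclideanSpace.single i 1) := fun y => by
    rw [gradient_bubble, inner_smul_left, PiLp.inner_apply, Finset.mul_sum]
    refine Finset.sum_congr rfl fun i _ => ?_
    rw [← gradient_apply]
    simp [hh]
    ring
  simp only [e1]
  rw [integral_finsetSum _ fun i _ => hi1 i]
  simp only [fun i => integral_mul_fderiv_of_hasCompactSupport (hhc i) hφ hφs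
    (EuclideanSpace.single i (1 : ℝ))]
  rw [Finset.sum_neg_distrib, ← integral_finsetSum _ fun i _ => hi2 i, ← integral_neg]
  refine integral_congr_ae (Filter.Eventually.of_forall fun y => ?_)
  simp only [hhd, bubble_rpow_critExp hn a hl]
  rw [← Finset.sum_mul, ← neg_mul, ← Finset.mul_sum, Finset.sum_sub_distrib, ← Finset.mul_sum]
  have e2 : ∑ i, (y i - a i) ^ 2 = ‖y - a‖ ^ 2 := by
    simp [EuclideanSpace.norm_sq_eq]
  -- One factor 1 + λ²|y−a|² is split off, so that the terms with λ²|y−a|² cancel in the divergence.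
  have e3 : bubbleJap a l y ^ (-((n : ℝ) / 2)) =
      bubbleJap a l y ^ (-((n : ℝ) / 2) - 1) * (1 + l ^ 2 * ‖y - a‖ ^ 2) := by
    rw [← bubbleJap, ← Real.rpow_add_one (bubbleJap_pos a l y).ne']; congr 1; ring
  rw [e2, e3, Finset.sum_const, Finset.card_univ, Fintype.card_fin, nsmul_eq_mul]
  ring

/-- Change of variables `y = a + x/λ`. -/
theorem integral_comp_bubble_scaling (f : Euc n → ℝ) (a : Euc n) {l : ℝ} (hl : 0 < l) :
    ∫ y, f (l • (y - a)) = (l ^ n)⁻¹ * ∫ x, f x := by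
  rw [integral_sub_right_eq_self (fun y => f (l • y)) a, Measure.integral_comp_smul,
    finrank_euclideanSpace_fin, abs_of_pos (by positivity), smul_eq_mul]

theorem integrable_comp_bubble_scaling {f : Euc n → ℝ} (hf : Integrable f) (a : Euc n) {l : ℝ}
    (hl : 0 < l) : Integrable fun y => f (l • (y - a)) :=
  (hf.comp_smul hl.ne').comp_sub_right a

theorem bubbleJap_eq_scaling (a : Euc n) {l : ℝ} (hl : 0 < l) (y : Euc n) :
    bubbleJap a l y = 1 + ‖l • (y - a)‖ ^ 2 := by
  rw [bubbleJap, norm_smul, mul_pow, Real.norm_of_nonneg hl.le]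

theorem integrable_one_add_norm_sq_rpow {s : ℝ} (hs : n < 2 * s) :
    Integrable fun x : Euc n => (1 + ‖x‖ ^ 2) ^ (-s) := by
  have h := integrable_rpow_neg_one_add_norm_sq (E := Euc n) (μ := volume) (r := 2 * s)
    (by simpa using hs)
  refine h.congr (Filter.Eventually.of_forall fun x => ?_)
  simp only []
  congr 1; ring

theorem integrable_bubbleJap_rpow {s : ℝ} (hs : n < 2 * s) (a : Euc n) {l : ℝ} (hl : 0 < l) :
    Integrable fun y => bubbleJap a l y ^ (-s) := by
  simp only [bubbleJap_eq_scaling a hl]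
  exact integrable_comp_bubble_scaling (integrable_one_add_norm_sq_rpow hs) a hl

theorem integral_bubbleJap_rpow (s : ℝ) (a : Euc n) {l : ℝ} (hl : 0 < l) :
    ∫ y, bubbleJap a l y ^ (-s) = (l ^ n)⁻¹ * ∫ x : Euc n, (1 + ‖x‖ ^ 2) ^ (-s) := by
  simp only [bubbleJap_eq_scaling a hl]
  exact integral_comp_bubble_scaling (fun x => (1 + ‖x‖ ^ 2) ^ (-s)) a hl

/-- `∫ δ^{2n/(n-2)}`. -/
def bubbleMass (n : ℕ) : ℝ :=
  (n * ((n : ℝ) - 2)) ^ ((n : ℝ) / 2) * ∫ x : Euc n, (1 + ‖x‖ ^ 2) ^ (-(n : ℝ))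

theorem bubble_rpow_critExp_add_one (hn : 3 ≤ n) (a : Euc n) {l : ℝ} (hl : 0 < l) (y : Euc n) :
    bubble a l y ^ (critExp n + 1) =
      (n * ((n : ℝ) - 2)) ^ ((n : ℝ) / 2) * l ^ n * bubbleJap a l y ^ (-(n : ℝ)) := by
  have hn' : (3 : ℝ) ≤ n := by exact_mod_cast hn
  have hn2 : (0 : ℝ) < n - 2 := by linarith
  have hX := bubbleJap_pos a l y
  have hq : critExp n + 1 = 2 * n / (n - 2) := by rw [critExp_eq hn]; ring
  rw [bubble_eq, hq, Real.mul_rpow (mul_pos (c₀_pos hn) (Real.rpow_pos_of_pos hl _)).le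
    (Real.rpow_pos_of_pos hX _).le, Real.mul_rpow (c₀_pos hn).le (Real.rpow_pos_of_pos hl _).le,
    ← Real.rpow_mul hl.le, ← Real.rpow_mul hX.le, c₀, ← Real.rpow_mul (by positivity),
    show ((n : ℝ) - 2) / 4 * (2 * n / (n - 2)) = n / 2 by field_simp; norm_num,
    show ((n : ℝ) - 2) / 2 * (2 * n / (n - 2)) = n by field_simp,
    show -(((n : ℝ) - 2) / 2) * (2 * n / (n - 2)) = -n by field_simp, Real.rpow_natCast]

theorem integrable_bubble_rpow (hn : 3 ≤ n) (a : Euc n) {l : ℝ} (hl : 0 < l) :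
    Integrable fun y => bubble a l y ^ (critExp n + 1) := by
  have hn' : (3 : ℝ) ≤ n := by exact_mod_cast hn
  simp only [bubble_rpow_critExp_add_one hn a hl]
  exact (integrable_bubbleJap_rpow (by linarith) a hl).const_mul _

theorem integral_bubble_rpow (hn : 3 ≤ n) (a : Euc n) {l : ℝ} (hl : 0 < l) :
    ∫ y, bubble a l y ^ (critExp n + 1) = bubbleMass n := by
  simp only [bubble_rpow_critExp_add_one hn a hl]
  rw [integral_const_mul, integral_bubbleJap_rpow _ a hl, bubbleMass]
  have : l ^ n ≠ 0 := by positivity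
  field_simp

/-- Together with `sobolevConst_eq` this turns S_n^{n/2} into the integral ∫ δ^{p+1} that appears in
the expansion. -/
theorem sharpConst_rpow (hn : 3 ≤ n) : sharpConst n ^ ((n : ℝ) / 2) = bubbleMass n := by
  have hn' : (3 : ℝ) ≤ n := by exact_mod_cast hn
  have hn2 : (0 : ℝ) < n - 2 := by linarith
  have hA := integral_one_add_norm_sq_pos (n := n)
  rw [sharpConst, bubbleMass, Real.mul_rpow (by positivity) (by positivity),
    ← Real.rpow_mul hA.le, show 2 / (n : ℝ) * (n / 2) = 1 by field_simp, Real.rpow_one]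

/-- The integrand is c₀²(n−2)²(1+|y|²)^{−n}|y|², so the value comes from
`sum_integral_japSq_mul_sq`. -/
theorem integrable_norm_sq_gradient_bubble (hn : 3 ≤ n) :
    Integrable (fun y : Euc n => ‖∇ (bubble 0 1) y‖ ^ 2) ∧
      ∫ y : Euc n, ‖∇ (bubble 0 1) y‖ ^ 2 =
        c₀ n ^ 2 * (n * (n - 2) * ∫ y : Euc n, (1 + ‖y‖ ^ 2) ^ (-(n : ℝ))) := by
  have hn' : (3 : ℝ) ≤ n := by exact_mod_cast hn
  have e : ∀ x : Fin n → ℝ, ‖∇ (bubble (0 : Euc n) 1) (WithLp.toLp 2 x)‖ ^ 2 =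
      c₀ n ^ 2 * ((n - 2) ^ 2 * ∑ i, japSq x ^ (-(n : ℝ)) * x i ^ 2) := fun x => by
    have hb : bubbleJap (0 : Euc n) 1 (WithLp.toLp 2 x) = japSq x := by
      rw [japSq_eq_norm, bubbleJap]; simp
    have h2 : japSq x ^ (-(n : ℝ)) = (japSq x ^ (-((n : ℝ) / 2))) ^ 2 := by
      rw [← Real.rpow_natCast, ← Real.rpow_mul (japSq_pos x).le]; congr 1; push_cast; ring
    rw [gradient_bubble, norm_smul, mul_pow, Real.norm_eq_abs, sq_abs, hb, ← Finset.mul_sum, h2,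
      sub_zero, EuclideanSpace.norm_sq_eq]
    simp
    ring
  have hi : Integrable fun x : Fin n → ℝ => ‖∇ (bubble (0 : Euc n) 1) (WithLp.toLp 2 x)‖ ^ 2 := by
    simp only [e]
    exact ((integrable_finsetSum _ fun i _ => integrable_japSq_mul_sq hn i).const_mul _).const_mul _
  refine ⟨((PiLp.volume_preserving_toLp (Fin n)).integrable_comp_emb
    (MeasurableEquiv.toLp 2 (Fin n → ℝ)).measurableEmbedding).1 hi, ?_⟩
  rw [← integral_comp_toLp]
  simp only [e]
  rw [integral_const_mul, integral_const_mul,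
    integral_finsetSum _ fun i _ => integrable_japSq_mul_sq hn i, sum_integral_japSq_mul_sq hn,
    ← integral_comp_toLp]
  simp only [japSq_eq_norm]

/-- The best Sobolev constant. -/
theorem sobolevConst_eq (hn : 3 ≤ n) : sobolevConst n = sharpConst n := by
  have hn' : (3 : ℝ) ≤ n := by exact_mod_cast hn
  have hn2 : (0 : ℝ) < n - 2 := by linarith
  have hK := sharpConst_pos hn
  have hA := integral_one_add_norm_sq_pos (n := n)
  have hlow : ∀ r ∈ {r | ∃ (u : Euc n → ℝ) (g : Euc n → Euc n),
      MemLp u (ENNReal.ofReal (2 * n / ((n : ℝ) - 2))) volume ∧ ¬ (u =ᵐ[volume] 0) ∧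
      IsWeakGradient u g ∧ MemLp g 2 volume ∧
      r = (eLpNorm g 2 volume).toReal ^ 2 /
        (eLpNorm u (ENNReal.ofReal (2 * n / ((n : ℝ) - 2))) volume).toReal ^ 2},
      sharpConst n ≤ r := by
    rintro r ⟨u, g, hu, hu0, hw, hg, rfl⟩
    rw [← sobExp] at *
    have h := eLpNorm_le_of_isWeakGradient hn hu hg hw
    have hpos : 0 < (eLpNorm u (sobExp n) volume).toReal :=
      ENNReal.toReal_pos (fun h0 => hu0 ((eLpNorm_eq_zero_iff hu.1 (sobExp_ne_zero hn)).1 h0))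
        hu.2.ne
    have h2 := ENNReal.toReal_mono (ENNReal.mul_ne_top ENNReal.ofReal_ne_top hg.2.ne) h
    rw [ENNReal.toReal_mul, ENNReal.toReal_ofReal (by positivity)] at h2
    rw [le_div_iff₀ (by positivity)]
    have h3 := pow_le_pow_left₀ hpos.le h2 2
    rw [mul_pow, ← Real.rpow_natCast (sharpConst n ^ _) 2, ← Real.rpow_mul hK.le,
      show (-(1 / 2) : ℝ) * (2 : ℕ) = -1 by norm_num, Real.rpow_neg_one, inv_mul_eq_div,
      le_div_iff₀ hK] at h3
    linarith
  have hmem : sharpConst n ∈ {r | ∃ (u : Euc n → ℝ) (g : Euc n → Euc n),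
      MemLp u (ENNReal.ofReal (2 * n / ((n : ℝ) - 2))) volume ∧ ¬ (u =ᵐ[volume] 0) ∧
      IsWeakGradient u g ∧ MemLp g 2 volume ∧
      r = (eLpNorm g 2 volume).toReal ^ 2 /
        (eLpNorm u (ENNReal.ofReal (2 * n / ((n : ℝ) - 2))) volume).toReal ^ 2} := by
    have hpos := bubble_pos hn (0 : Euc n) one_pos
    have hgi := integrable_norm_sq_gradient_bubble hn
    have hq : critExp n + 1 = 2 * n / ((n : ℝ) - 2) := by rw [critExp_eq hn]; ring
    have hq0 : (0 : ℝ) < 2 * n / ((n : ℝ) - 2) := by positivity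
    have hc := contDiff_bubble (0 : Euc n) 1
    have hg2 : MemLp (∇ (bubble (0 : Euc n) 1)) 2 volume :=
      (memLp_two_iff_integrable_sq_norm (continuous_gradient hc).aestronglyMeasurable).2 hgi.1
    have hbi := integrable_bubble_rpow hn (0 : Euc n) one_pos
    have hb : MemLp (bubble (0 : Euc n) 1) (sobExp n) volume := by
      rw [← integrable_norm_rpow_iff hc.continuous.aestronglyMeasurable (sobExp_ne_zero hn)
        sobExp_ne_top, toReal_sobExp hn, ← hq]
      refine hbi.congr (Filter.Eventually.of_forall fun y => ?_)
      simp only [Real.norm_of_nonneg (hpos y).le]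
    refine ⟨bubble 0 1, ∇ (bubble 0 1), hb, fun h0 => ?_, isWeakGradient_gradient hc, hg2, ?_⟩
    · obtain ⟨y, hy⟩ := h0.exists
      exact (hpos y).ne' hy
    · rw [← sobExp, hb.eLpNorm_eq_integral_rpow_norm (sobExp_ne_zero hn) sobExp_ne_top,
        hg2.eLpNorm_eq_integral_rpow_norm two_ne_zero ENNReal.ofNat_ne_top, toReal_sobExp hn,
        ENNReal.toReal_ofReal (by positivity), ENNReal.toReal_ofReal (by positivity)]
      simp only [ENNReal.toReal_ofNat, Real.rpow_two, fun y => Real.norm_of_nonneg (hpos y).le,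
        ← hq, integral_bubble_rpow hn (0 : Euc n) one_pos, hgi.2]
      rw [hq]
      set A := ∫ y : Euc n, (1 + ‖y‖ ^ 2) ^ (-(n : ℝ)) with hAdef
      have e1 : (bubbleMass n ^ (2 * n / ((n : ℝ) - 2))⁻¹) ^ 2 =
          c₀ n ^ 2 * A ^ (((n : ℝ) - 2) / n) := by
        rw [bubbleMass, ← hAdef, ← Real.rpow_natCast, ← Real.rpow_mul (by positivity),
          Real.mul_rpow (by positivity) hA.le, ← Real.rpow_mul (by positivity), c₀,
          ← Real.rpow_natCast _ 2, ← Real.rpow_mul (by positivity)]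
        congr 2 <;> field_simp
        · norm_num
        · push_cast; norm_num
      have e2 : ((c₀ n ^ 2 * (n * (n - 2) * A)) ^ (2 : ℝ)⁻¹) ^ 2 =
          c₀ n ^ 2 * (n * (n - 2) * A) := by
        rw [← Real.rpow_natCast, ← Real.rpow_mul (by positivity)]
        norm_num
      rw [e1, e2, sharpConst, ← hAdef]
      have hc0 := c₀_pos hn
      have hAA : A = A ^ (((n : ℝ) - 2) / n) * A ^ (2 / (n : ℝ)) := by
        rw [← Real.rpow_add hA, show ((n : ℝ) - 2) / n + 2 / n = 1 by field_simp; ring,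
          Real.rpow_one]
      have hAp : 0 < A ^ (((n : ℝ) - 2) / n) := Real.rpow_pos_of_pos hA _
      rw [eq_div_iff (by positivity)]
      conv_rhs => rw [hAA]
      ring
  exact le_antisymm (csInf_le ⟨_, hlow⟩ hmem) (le_csInf ⟨_, hmem⟩ hlow)

theorem sobolevConst_rpow (hn : 3 ≤ n) : sobolevConst n ^ ((n : ℝ) / 2) = bubbleMass n := by
  rw [sobolevConst_eq hn, sharpConst_rpow hn]

end Bubble

/-! ### Density of test functions, the Sobolev embedding and the equation for Pδ -/

section H10

open Filter Topology

variable {n : ℕ} {hn : 3 ≤ n} {Ω : Set (Euc n)} {hΩ : IsSmoothBoundedDomain Ω}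

theorem memLp_of_continuous {E : Type*} [NormedAddCommGroup E] [NormedSpace ℝ E]
    [FiniteDimensional ℝ E] (hΩ : IsSmoothBoundedDomain Ω) {f : Euc n → E} (hf : Continuous f)
    (p : ℝ≥0∞) : MemLp f p (volume.restrict Ω) := by
  have hK : IsCompact (closure Ω) := hΩ.isBounded.isCompact_closure
  obtain ⟨B, hB⟩ := hK.exists_bound_of_continuousOn hf.continuousOn
  have h : MemLp f p (volume.restrict (closure Ω)) := by
    have : IsFiniteMeasure (volume.restrict (closure Ω)) :=
      isFiniteMeasure_restrict.2 hK.measure_ne_top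
    exact MemLp.of_bound hf.aestronglyMeasurable B
      ((ae_restrict_iff' isClosed_closure.measurableSet).2 (Eventually.of_forall hB))
  exact h.mono_measure (Measure.restrict_mono subset_closure le_rfl)

/-- A test function, as an element of `H¹₀(Ω)`. -/
def H10.ofTest (hn : 3 ≤ n) (hΩ : IsSmoothBoundedDomain Ω) {φ : Euc n → ℝ}
    (hφ : IsTestFunction Ω φ) : H10 hn hΩ :=
  ⟨(MemLp.toLp φ (memLp_of_continuous hΩ hφ.contDiff.continuous 2),
    MemLp.toLp (∇ φ) (memLp_of_continuous hΩ (continuous_gradient hφ.contDiff) 2)),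
    subset_closure ⟨φ, hφ, MemLp.coeFn_toLp (memLp_of_continuous hΩ hφ.contDiff.continuous 2),
      MemLp.coeFn_toLp (memLp_of_continuous hΩ (continuous_gradient hφ.contDiff) 2)⟩⟩

theorem H10.fn_ofTest {φ : Euc n → ℝ} (hφ : IsTestFunction Ω φ) :
    H10.fn (H10.ofTest hn hΩ hφ) =ᵐ[volume.restrict Ω] φ :=
  MemLp.coeFn_toLp (memLp_of_continuous hΩ hφ.contDiff.continuous 2)

theorem H10.grad_ofTest {φ : Euc n → ℝ} (hφ : IsTestFunction Ω φ) :
    H10.grad (H10.ofTest hn hΩ hφ) =ᵐ[volume.restrict Ω] ∇ φ :=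
  MemLp.coeFn_toLp (memLp_of_continuous hΩ (continuous_gradient hφ.contDiff) 2)

/-- `u ↦ u` as a continuous map `H¹₀(Ω) → L²(Ω)`. -/
def H10.fnL : H10 hn hΩ →L[ℝ] Lp ℝ 2 (volume.restrict Ω) :=
  H10.fn.mkContinuousOfExistsBound (by
    obtain ⟨C, hC⟩ := H10.norm_fn_le (hn := hn) (hΩ := hΩ)
    exact ⟨C, hC⟩)

theorem H10.fnL_apply (u : H10 hn hΩ) : H10.fnL u = H10.fn u := rfl

theorem H10.exists_seq_ofTest (u : H10 hn hΩ) : ∃ (φ : ℕ → Euc n → ℝ)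
    (hφ : ∀ k, IsTestFunction Ω (φ k)), Tendsto (fun k => H10.ofTest hn hΩ (hφ k)) atTop (𝓝 u) := by
  obtain ⟨w, hw, hlim⟩ := mem_closure_iff_seq_limit.1 u.2
  choose φ hφ h1 h2 using hw
  refine ⟨φ, hφ, ?_⟩
  have he : ∀ k, H10.grad (H10.ofTest hn hΩ (hφ k)) = (w k).2 := fun k =>
    Lp.ext ((H10.grad_ofTest (hφ k)).trans (h2 k).symm)
  rw [tendsto_iff_norm_sub_tendsto_zero]
  have h3 : Tendsto (fun k => ‖(w k).2 - H10.grad u‖) atTop (𝓝 0) :=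
    tendsto_iff_norm_sub_tendsto_zero.1 ((continuous_snd.tendsto _).comp hlim)
  refine h3.congr fun k => ?_
  rw [H10.norm_eq, map_sub, he]

theorem H10.tendsto_fn_ae {φ : ℕ → Euc n → ℝ} (hφ : ∀ k, IsTestFunction Ω (φ k)) {u : H10 hn hΩ}
    (h : Tendsto (fun k => H10.ofTest hn hΩ (hφ k)) atTop (𝓝 u)) : ∃ ns : ℕ → ℕ, StrictMono ns ∧
      ∀ᵐ x ∂volume.restrict Ω, Tendsto (fun k => φ (ns k) x) atTop (𝓝 (H10.fn u x)) := by
  have h1 : Tendsto (fun k => H10.fn (H10.ofTest hn hΩ (hφ k))) atTop (𝓝 (H10.fn u)) :=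
    (H10.fnL.continuous.tendsto u).comp h
  obtain ⟨ns, hns, hae⟩ := (tendstoInMeasure_of_tendsto_Lp h1).exists_seq_tendsto_ae
  refine ⟨ns, hns, ?_⟩
  have h2 : ∀ᵐ x ∂volume.restrict Ω, ∀ k, H10.fn (H10.ofTest hn hΩ (hφ k)) x = φ k x :=
    ae_all_iff.2 fun k => H10.fn_ofTest (hφ k)
  filter_upwards [hae, h2] with x hx hx2
  simpa only [hx2] using hx

/-- The Sobolev embedding `H¹₀(Ω) → L^{2n/(n-2)}(Ω)`. -/
theorem H10.eLpNorm_fn_le (u : H10 hn hΩ) : eLpNorm (H10.fn u) (sobExp n) (volume.restrict Ω) ≤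
    ENNReal.ofReal (sharpConst n ^ (-(1 / 2) : ℝ) * ‖u‖) := by
  obtain ⟨φ, hφ, hlim⟩ := H10.exists_seq_ofTest u
  obtain ⟨ns, hns, hae⟩ := H10.tendsto_fn_ae hφ hlim
  have hK := sharpConst_pos hn
  have hk : ∀ k, eLpNorm (φ k) (sobExp n) (volume.restrict Ω) ≤
      ENNReal.ofReal (sharpConst n ^ (-(1 / 2) : ℝ) * ‖H10.ofTest hn hΩ (hφ k)‖) := fun k => by
    refine (eLpNorm_mono_measure _ Measure.restrict_le_self).trans
      ((eLpNorm_le_gradient_of_contDiff hn (hφ k).contDiff (hφ k).hasCompactSupport).trans ?_)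
    have hs : Function.support (∇ (φ k)) ⊆ Ω := (subset_tsupport _).trans
      ((tsupport_gradient_subset _).trans (hφ k).tsupport_subset)
    rw [ENNReal.ofReal_mul (by positivity), H10.norm_eq, Lp.norm_def,
      ENNReal.ofReal_toReal (Lp.eLpNorm_ne_top _), eLpNorm_congr_ae (H10.grad_ofTest (hφ k)),
      eLpNorm_restrict_eq_of_support_subset hs]
  have hfatou := Lp.eLpNorm_lim_le_liminf_eLpNorm (p := sobExp n) (μ := volume.restrict Ω)
    (f := fun k => φ (ns k)) (fun k => (hφ (ns k)).contDiff.continuous.aestronglyMeasurable)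
    (H10.fn u) hae
  have hl2 : Tendsto (fun k => ENNReal.ofReal (sharpConst n ^ (-(1 / 2) : ℝ) *
      ‖H10.ofTest hn hΩ (hφ (ns k))‖)) atTop
      (𝓝 (ENNReal.ofReal (sharpConst n ^ (-(1 / 2) : ℝ) * ‖u‖))) :=
    ENNReal.tendsto_ofReal ((hlim.norm.comp hns.tendsto_atTop).const_mul _)
  exact hfatou.trans ((liminf_le_liminf (Eventually.of_forall fun k => hk (ns k))).trans
    (le_of_eq hl2.liminf_eq))

theorem H10.memLp_fn (u : H10 hn hΩ) : MemLp (H10.fn u) (sobExp n) (volume.restrict Ω) :=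
  ⟨(Lp.memLp _).1, (H10.eLpNorm_fn_le u).trans_lt ENNReal.ofReal_lt_top⟩

theorem inner_toLp_gradient_bubble (a : Euc n) (l : ℝ) (v : H10 hn hΩ) :
    ⟪(memLp_gradient_bubble hΩ.isBounded a l).toLp, H10.grad v⟫_ℝ =
      ⟪projBubble hn hΩ a l, v⟫_ℝ := by
  rw [projBubble, InnerProductSpace.toDual_symm_apply]
  rfl

/-- On test functions this is the equation −Δδ = δ^p. Both sides are continuous in v, the right one
because δ^p is bounded on Ω and H¹₀(Ω) maps continuously into L²(Ω), and test functions are dense.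
-/
theorem inner_projBubble_eq_integral (a : Euc n) {l : ℝ} (hl : 0 < l) (v : H10 hn hΩ) :
    ⟪projBubble hn hΩ a l, v⟫_ℝ = ∫ x in Ω, bubble a l x ^ critExp n * H10.fn v x := by
  have hb := memLp_of_continuous hΩ (continuous_bubble_rpow hn a hl (critExp n)) 2
  have e : ∀ v : H10 hn hΩ, ∫ x in Ω, bubble a l x ^ critExp n * H10.fn v x =
      ⟪hb.toLp, H10.fnL v⟫_ℝ := fun v => by
    rw [L2.inner_def]
    refine integral_congr_ae ?_
    filter_upwards [hb.coeFn_toLp] with x hx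
    rw [hx, H10.fnL_apply]
    simp [mul_comm]
  obtain ⟨φ, hφ, hlim⟩ := H10.exists_seq_ofTest v
  rw [e]
  refine tendsto_nhds_unique ((tendsto_const_nhds (x := projBubble hn hΩ a l)).inner (𝕜 := ℝ) hlim)
    (((tendsto_const_nhds (x := hb.toLp)).inner (𝕜 := ℝ)
      ((H10.fnL.continuous.tendsto v).comp hlim)).congr fun k => ?_)
  rw [Function.comp_apply, ← e, inner_projBubble]
  have h1 : ∫ x in Ω, bubble a l x ^ critExp n * H10.fn (H10.ofTest hn hΩ (hφ k)) x =
      ∫ x, bubble a l x ^ critExp n * φ k x := by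
    refine Eq.trans ?_ (setIntegral_eq_integral_of_forall_compl_eq_zero (s := Ω)
      (f := fun x => bubble a l x ^ critExp n * φ k x) ?_)
    · refine integral_congr_ae ?_
      filter_upwards [H10.fn_ofTest (hn := hn) (hΩ := hΩ) (hφ k)] with x hx
      rw [hx]
    · intro x hx
      rw [image_eq_zero_of_notMem_tsupport fun h => hx ((hφ k).tsupport_subset h), mul_zero]
  have h2 : ∫ x in Ω, ⟪∇ (bubble a l) x, H10.grad (H10.ofTest hn hΩ (hφ k)) x⟫_ℝ =
      ∫ x, ⟪∇ (bubble a l) x, ∇ (φ k) x⟫_ℝ := by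
    refine Eq.trans ?_ (setIntegral_eq_integral_of_forall_compl_eq_zero (s := Ω)
      (f := fun x => ⟪∇ (bubble a l) x, ∇ (φ k) x⟫_ℝ) ?_)
    · refine integral_congr_ae ?_
      filter_upwards [H10.grad_ofTest (hn := hn) (hΩ := hΩ) (hφ k)] with x hx
      rw [hx]
    · intro x hx
      rw [image_eq_zero_of_notMem_tsupport fun h => hx
        ((hφ k).tsupport_subset (tsupport_gradient_subset _ h)), inner_zero_right]
  rw [h1, h2, integral_gradient_bubble hn a hl (hφ k).contDiff (hφ k).hasCompactSupport]

/-! ### The weak maximum principle and pointwise bounds for Pδ -/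

/-- A smooth nondecreasing convex function that vanishes exactly on `(-∞, 0]`. -/
def smoothPos (s : ℝ) : ℝ := ∫ t in (0 : ℝ)..s, Real.smoothTransition t

theorem hasDerivAt_smoothPos (s : ℝ) : HasDerivAt smoothPos (Real.smoothTransition s) s :=
  intervalIntegral.integral_hasDerivAt_right
    (Real.smoothTransition.continuous.intervalIntegrable _ _)
    (Real.smoothTransition.continuous.stronglyMeasurableAtFilter _ _)
    Real.smoothTransition.continuousAt

theorem contDiff_smoothPos : ContDiff ℝ ∞ smoothPos := by
  rw [contDiff_infty_iff_deriv]
  refine ⟨fun s => (hasDerivAt_smoothPos s).differentiableAt, ?_⟩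
  rw [show deriv smoothPos = Real.smoothTransition from
    funext fun s => (hasDerivAt_smoothPos s).deriv]
  exact Real.smoothTransition.contDiff (n := ⊤)

theorem monotone_smoothPos : Monotone smoothPos :=
  monotone_of_deriv_nonneg (fun s => (hasDerivAt_smoothPos s).differentiableAt) fun s => by
    rw [(hasDerivAt_smoothPos s).deriv]; exact Real.smoothTransition.nonneg s

theorem smoothPos_of_nonpos {s : ℝ} (hs : s ≤ 0) : smoothPos s = 0 := by
  rw [smoothPos, intervalIntegral.integral_symm,
    intervalIntegral.integral_congr (g := fun _ => (0 : ℝ)) fun t ht => ?_]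
  · simp
  · rw [uIcc_of_le hs] at ht
    exact Real.smoothTransition.zero_of_nonpos ht.2

theorem smoothPos_nonneg (s : ℝ) : 0 ≤ smoothPos s := by
  rcases le_total s 0 with h | h
  · rw [smoothPos_of_nonpos h]
  · rw [← smoothPos_of_nonpos le_rfl]; exact monotone_smoothPos h

theorem nonpos_of_smoothPos_eq_zero {s : ℝ} (h : smoothPos s = 0) : s ≤ 0 := by
  by_contra! hs
  have : 0 < smoothPos s := intervalIntegral.intervalIntegral_pos_of_pos_on
    (Real.smoothTransition.continuous.intervalIntegrable _ _)
    (fun t ht => Real.smoothTransition.pos_of_pos ht.1) hs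
  exact this.ne' h

/-- Weak maximum principle: a subharmonic function `b - P`, where `P ∈ H¹₀(Ω)` and `b` is smooth
and nonpositive off a compact subset of `Ω`, is nonpositive. -/
theorem le_fn_of_subharmonic {b : Euc n → ℝ} (hb : ContDiff ℝ ∞ b) {K : Set (Euc n)}
    (hK : IsCompact K) (hKΩ : K ⊆ Ω) (hbK : ∀ x, x ∉ K → b x ≤ 0) (P : H10 hn hΩ)
    (hsub : ∀ (ψ : Euc n → ℝ) (hψ : IsTestFunction Ω ψ), (∀ x, 0 ≤ ψ x) →
      ⟪(memLp_of_continuous hΩ (continuous_gradient hb) 2).toLp - H10.grad P,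
        H10.grad (H10.ofTest hn hΩ hψ)⟫_ℝ ≤ 0) :
    ∀ᵐ x ∂volume.restrict Ω, b x ≤ H10.fn P x := by
  obtain ⟨φ, hφ, hlim⟩ := H10.exists_seq_ofTest P
  have hbm := memLp_of_continuous hΩ (continuous_gradient hb) 2
  -- Off K ∪ supp φ_k the argument is b ≤ 0, so the truncation is compactly supported in Ω.
  have hψ : ∀ k, IsTestFunction Ω fun x => smoothPos (b x - φ k x) := fun k => by
    have hcl : IsClosed (K ∪ tsupport (φ k)) := hK.isClosed.union (isClosed_tsupport _)
    have hsupp : tsupport (fun x => smoothPos (b x - φ k x)) ⊆ K ∪ tsupport (φ k) := by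
      refine closure_minimal (fun x hx => ?_) hcl
      by_contra hx'
      rw [mem_union, not_or] at hx'
      refine hx (smoothPos_of_nonpos ?_)
      rw [image_eq_zero_of_notMem_tsupport hx'.2, sub_zero]
      exact hbK x hx'.1
    exact ⟨contDiff_smoothPos.comp (hb.sub (hφ k).contDiff),
      (hK.union (hφ k).hasCompactSupport).of_isClosed_subset (isClosed_tsupport _) hsupp,
      hsupp.trans (union_subset hKΩ (hφ k).tsupport_subset)⟩
  have hgψ : ∀ k x, ∇ (fun x => smoothPos (b x - φ k x)) x =
      Real.smoothTransition (b x - φ k x) • (∇ b x - ∇ (φ k) x) := fun k x => by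
    have h1 := ((hb.differentiable (by simp)) x).hasFDerivAt.sub
      (((hφ k).contDiff.differentiable (by simp)) x).hasFDerivAt
    have h2 := (hasDerivAt_smoothPos (b x - φ k x)).comp_hasFDerivAt x h1
    have h3 : HasFDerivAt (fun x => smoothPos (b x - φ k x))
      (Real.smoothTransition (b x - φ k x) • (fderiv ℝ b x - fderiv ℝ (φ k) x)) x := h2
    rw [gradient, h3.fderiv]
    simp [gradient]
  -- the energy of the truncations tends to zero
  have hnorm : ∀ k, ‖H10.ofTest hn hΩ (hψ k)‖ ≤ ‖P - H10.ofTest hn hΩ (hφ k)‖ := fun k => by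
    set Ψ := H10.grad (H10.ofTest hn hΩ (hψ k)) with hΨ
    set Φ := H10.grad (H10.ofTest hn hΩ (hφ k)) with hΦ
    -- Here Ψ = θ(∇b − ∇φ_k) with 0 ≤ θ ≤ 1, hence |Ψ|² = θ²|∇b − ∇φ_k|² ≤ θ|∇b − ∇φ_k|².
    have h1 : ‖Ψ‖ ^ 2 ≤ ⟪hbm.toLp - Φ, Ψ⟫_ℝ := by
      rw [← real_inner_self_eq_norm_sq, L2.inner_def, L2.inner_def]
      refine integral_mono_ae (L2.integrable_inner (𝕜 := ℝ) Ψ Ψ)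
        (L2.integrable_inner (𝕜 := ℝ) (hbm.toLp - Φ) Ψ) ?_
      filter_upwards [H10.grad_ofTest (hn := hn) (hΩ := hΩ) (hψ k),
        H10.grad_ofTest (hn := hn) (hΩ := hΩ) (hφ k), hbm.coeFn_toLp,
        Lp.coeFn_sub hbm.toLp Φ] with x h1 h2 h3 h4
      rw [h4, Pi.sub_apply, h3, hΦ, h2, hΨ, h1, hgψ, inner_smul_left, inner_smul_right]
      have hs0 := Real.smoothTransition.nonneg (b x - φ k x)
      have hs1 := Real.smoothTransition.le_one (b x - φ k x)
      have hi := real_inner_self_nonneg (x := ∇ b x - ∇ (φ k) x)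
      simp only [conj_trivial]
      exact mul_le_of_le_one_left (mul_nonneg hs0 hi) hs1
    have h2 := hsub _ (hψ k) fun x => smoothPos_nonneg _
    rw [← hΨ] at h2
    have h3 : ⟪hbm.toLp - Φ, Ψ⟫_ℝ = ⟪hbm.toLp - H10.grad P, Ψ⟫_ℝ + ⟪H10.grad P - Φ, Ψ⟫_ℝ := by
      rw [← inner_add_left, sub_add_sub_cancel]
    have h4 : ⟪H10.grad P - Φ, Ψ⟫_ℝ ≤ ‖H10.grad P - Φ‖ * ‖Ψ‖ := real_inner_le_norm _ _
    have h5 : ‖Ψ‖ * ‖Ψ‖ ≤ ‖H10.grad P - Φ‖ * ‖Ψ‖ := by nlinarith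
    rw [H10.norm_eq, H10.norm_eq, map_sub, ← hΨ, ← hΦ]
    rcases (norm_nonneg Ψ).eq_or_lt with h0 | h0
    · rw [← h0]; exact norm_nonneg _
    · exact le_of_mul_le_mul_right h5 h0
  have hψlim : Tendsto (fun k => H10.ofTest hn hΩ (hψ k)) atTop (𝓝 0) := by
    refine squeeze_zero_norm hnorm ?_
    have := (tendsto_const_nhds (x := P)).sub hlim
    rw [sub_self] at this
    simpa using this.norm
  obtain ⟨ns, hns, hae⟩ := H10.tendsto_fn_ae hφ hlim
  obtain ⟨ms, hms, hae2⟩ := H10.tendsto_fn_ae (fun k => hψ (ns k)) (hψlim.comp hns.tendsto_atTop)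
  rw [map_zero] at hae2
  filter_upwards [hae, hae2, Lp.coeFn_zero ℝ 2 (volume.restrict Ω)] with x h1 h2 h3
  rw [h3, Pi.zero_apply] at h2
  have h4 := (contDiff_smoothPos.continuous.tendsto _).comp
    ((tendsto_const_nhds (x := b x)).sub (h1.comp hms.tendsto_atTop))
  exact sub_nonpos.1 (nonpos_of_smoothPos_eq_zero (tendsto_nhds_unique h4 h2))

section projBubble

variable (hn hΩ) (a : Euc n) {l : ℝ}

/-- The maximum principle with b = 0, as −ΔPδ = δ^p ≥ 0. -/
theorem fn_projBubble_nonneg (hl : 0 < l) :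
    ∀ᵐ x ∂volume.restrict Ω, 0 ≤ H10.fn (projBubble hn hΩ a l) x := by
  refine le_fn_of_subharmonic (b := fun _ => 0) contDiff_const isCompact_empty (empty_subset Ω)
    (fun _ _ => le_rfl) _ fun ψ hψ hψ0 => ?_
  have h0 : (memLp_of_continuous hΩ (continuous_gradient
      (contDiff_const : ContDiff ℝ ∞ fun _ : Euc n => (0 : ℝ))) 2).toLp = 0 := by
    refine Lp.ext ((MemLp.coeFn_toLp _).trans (EventuallyEq.trans ?_ (Lp.coeFn_zero _ _ _).symm))
    exact Eventually.of_forall fun x => gradient_fun_const x (0 : ℝ)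
  rw [h0, zero_sub, inner_neg_left, neg_nonpos]
  have h1 : ⟪H10.grad (projBubble hn hΩ a l), H10.grad (H10.ofTest hn hΩ hψ)⟫_ℝ =
      ⟪projBubble hn hΩ a l, H10.ofTest hn hΩ hψ⟫_ℝ := by rw [L2.inner_def]; rfl
  rw [h1, inner_projBubble_eq_integral a hl]
  refine integral_nonneg_of_ae ?_
  filter_upwards [H10.fn_ofTest (hn := hn) (hΩ := hΩ) hψ] with x hx
  rw [hx]
  exact mul_nonneg (Real.rpow_nonneg (bubble_pos hn a hl x).le _) (hψ0 x)

/-- δ − Pδ is weakly harmonic in Ω. Only ∇b enters, so b may differ from δ by a constant. -/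
theorem inner_gradient_sub_projBubble {b : Euc n → ℝ} (hb : ContDiff ℝ ∞ b)
    (h : ∀ x, ∇ b x = ∇ (bubble a l) x) (v : H10 hn hΩ) :
    ⟪(memLp_of_continuous hΩ (continuous_gradient hb) 2).toLp - H10.grad (projBubble hn hΩ a l),
      H10.grad v⟫_ℝ = 0 := by
  have h0 : (memLp_of_continuous hΩ (continuous_gradient hb) 2).toLp =
      (memLp_gradient_bubble hΩ.isBounded a l).toLp :=
    MemLp.toLp_congr _ _ (Eventually.of_forall h)
  have h1 : ⟪H10.grad (projBubble hn hΩ a l), H10.grad v⟫_ℝ = ⟪projBubble hn hΩ a l, v⟫_ℝ := by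
    rw [L2.inner_def]; rfl
  rw [inner_sub_left, h0, inner_toLp_gradient_bubble, h1, sub_self]

/-- The maximum principle for −δ and −Pδ: the difference is harmonic and −δ is negative everywhere,
so the compact set may be empty. -/
theorem fn_projBubble_le (hl : 0 < l) :
    ∀ᵐ x ∂volume.restrict Ω, H10.fn (projBubble hn hΩ a l) x ≤ bubble a l x := by
  have hb : ContDiff ℝ ∞ fun x => -bubble a l x := (contDiff_bubble a l).neg
  have h := le_fn_of_subharmonic (hn := hn) (hΩ := hΩ) hb isCompact_empty (empty_subset Ω)
    (fun x _ => neg_nonpos.2 (bubble_pos hn a hl x).le) (-projBubble hn hΩ a l)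
    fun ψ hψ hψ0 => ?_
  · filter_upwards [h, Lp.coeFn_neg (H10.fn (projBubble hn hΩ a l))] with x h1 h2
    rw [map_neg, h2, Pi.neg_apply] at h1
    exact neg_le_neg_iff.1 h1
  · have h0 : (memLp_of_continuous hΩ (continuous_gradient hb) 2).toLp =
        -(memLp_of_continuous hΩ (continuous_gradient (contDiff_bubble a l)) 2).toLp := by
      rw [← MemLp.toLp_neg]
      refine MemLp.toLp_congr _ _ (Eventually.of_forall fun x => ?_)
      simp [gradient, fderiv_fun_neg]
    have h2 := inner_gradient_sub_projBubble hn hΩ a (contDiff_bubble a l) (fun _ => rfl)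
      (H10.ofTest hn hΩ hψ)
    rw [h0, map_neg, ← neg_add', ← sub_eq_add_neg, inner_neg_left, h2, neg_zero]

/-- The maximum principle for the harmonic difference of δ − M and Pδ; M is chosen so that δ − M ≤ 0
near the boundary. -/
theorem bubble_sub_le_fn_projBubble {M : ℝ} {K : Set (Euc n)} (hK : IsCompact K)
    (hKΩ : K ⊆ Ω) (hM : ∀ x, x ∉ K → bubble a l x ≤ M) :
    ∀ᵐ x ∂volume.restrict Ω, bubble a l x - M ≤ H10.fn (projBubble hn hΩ a l) x := by
  have hb : ContDiff ℝ ∞ fun x => bubble a l x - M := (contDiff_bubble a l).sub contDiff_const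
  refine le_fn_of_subharmonic hb hK hKΩ (fun x hx => sub_nonpos.2 (hM x hx)) _
    fun ψ hψ hψ0 => ?_
  refine (inner_gradient_sub_projBubble hn hΩ a hb (fun x => ?_) _).le
  simp [gradient, fderiv_sub_const]

end projBubble

/-- The ball is connected and does not meet the frontier, so it stays on the side of its centre. -/
theorem ball_bdist_subset (hΩ : IsOpen Ω) {a : Euc n} (ha : a ∈ Ω) :
    Metric.ball a (bdist Ω a) ⊆ Ω := by
  rcases le_or_gt (bdist Ω a) 0 with h | h
  · rw [Metric.ball_eq_empty.2 h]; exact empty_subset _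
  have hdis : ∀ x ∈ Metric.ball a (bdist Ω a), x ∉ frontier Ω := fun x hx hf => by
    have := Metric.infDist_le_dist_of_mem (x := a) hf
    rw [Metric.mem_ball, dist_comm] at hx
    exact absurd hx (not_lt.2 this)
  refine (convex_ball a _).isPreconnected.subset_left_of_subset_union hΩ
    isClosed_closure.isOpen_compl (v := (closure Ω)ᶜ)
    (disjoint_compl_right.mono_left subset_closure) (fun x hx => ?_)
    ⟨a, Metric.mem_ball_self h, ha⟩
  by_cases hc : x ∈ closure Ω
  · refine Or.inl ?_
    by_contra hx'
    exact hdis x hx ⟨hc, by rwa [hΩ.interior_eq]⟩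
  · exact Or.inr hc

end H10

/-! ### Growth and Lipschitz bounds for f_ε, uniform in ε -/

section Nonlinearity

open Filter Topology

variable {n : ℕ}

theorem one_lt_critExp (hn : 3 ≤ n) : 1 < critExp n := by
  have : (3 : ℝ) ≤ n := by exact_mod_cast hn
  rw [critExp, lt_div_iff₀ (by linarith)]; linarith

theorem one_le_log_exp_one_add {s : ℝ} (hs : 0 ≤ s) : 1 ≤ Real.log (Real.exp 1 + s) := by
  rw [Real.le_log_iff_exp_le (by positivity)]; linarith

theorem nonlin_neg (ε s : ℝ) : nonlin n ε (-s) = -nonlin n ε s := by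
  simp only [nonlin, abs_neg]; ring

theorem nonlin_of_nonneg (hn : 3 ≤ n) (ε : ℝ) {s : ℝ} (hs : 0 ≤ s) :
    nonlin n ε s = s ^ critExp n * Real.log (Real.exp 1 + s) ^ (-ε) := by
  have hp := one_lt_critExp hn
  rw [nonlin, abs_of_nonneg hs, Real.rpow_neg (zero_le_one.trans (one_le_log_exp_one_add hs)),
    div_eq_mul_inv]
  congr 1
  rcases hs.eq_or_lt with rfl | h
  · rw [mul_zero, Real.zero_rpow (by linarith)]
  · rw [← Real.rpow_add_one h.ne', sub_add_cancel]

theorem abs_nonlin_le (hn : 3 ≤ n) {ε : ℝ} (hε : 0 ≤ ε) (s : ℝ) :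
    |nonlin n ε s| ≤ |s| ^ critExp n := by
  have key : ∀ s : ℝ, 0 ≤ s → |nonlin n ε s| ≤ |s| ^ critExp n := fun s hs => by
    have hL := one_le_log_exp_one_add hs
    rw [nonlin_of_nonneg hn ε hs, abs_of_nonneg hs, abs_of_nonneg (mul_nonneg
      (Real.rpow_nonneg hs _) (Real.rpow_nonneg (zero_le_one.trans hL) _))]
    exact mul_le_of_le_one_right (Real.rpow_nonneg hs _)
      (Real.rpow_le_one_of_one_le_of_nonpos hL (neg_nonpos.2 hε))
  rcases le_total 0 s with h | h
  · exact key s h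
  · have := key (-s) (neg_nonneg.2 h)
    rwa [nonlin_neg, abs_neg, abs_neg] at this

theorem nonlin_zero (ε : ℝ) : nonlin n ε 0 = 0 := by simp [nonlin]

/-- With L = ln(e+s) the derivative is s^{p−1}(pL^{−ε} − ε (s/(e+s)) L^{−ε−1}), and the bracket lies
between −1 and p for every ε ≥ 0. A bound free of ε here is what makes the final constant
independent of ε. -/
theorem exists_hasDerivAt_nonlin_of_pos (hn : 3 ≤ n) {ε : ℝ} (hε : 0 ≤ ε) {s : ℝ} (hs : 0 < s) :
    ∃ d, HasDerivAt (nonlin n ε) d s ∧ |d| ≤ critExp n * s ^ (critExp n - 1) := by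
  have hp := one_lt_critExp hn
  set p := critExp n with hpdef
  set L := Real.log (Real.exp 1 + s) with hLdef
  have hL : 1 ≤ L := one_le_log_exp_one_add hs.le
  have hL0 : 0 < L := by linarith
  have he : 0 < Real.exp 1 + s := by positivity
  have h1 : HasDerivAt (fun t : ℝ => t ^ p) (p * s ^ (p - 1)) s :=
    Real.hasDerivAt_rpow_const (Or.inl hs.ne')
  have h2 : HasDerivAt (fun t : ℝ => Real.log (Real.exp 1 + t)) (1 / (Real.exp 1 + s)) s :=
    ((hasDerivAt_id s).const_add (Real.exp 1)).log he.ne'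
  have h3 := h2.rpow_const (p := -ε) (Or.inl hL0.ne')
  have h4 := h1.mul h3
  refine ⟨_, h4.congr_of_eventuallyEq ?_, ?_⟩
  · filter_upwards [lt_mem_nhds hs] with t ht
    exact nonlin_of_nonneg hn ε ht.le
  have hsp : s ^ p = s ^ (p - 1) * s := by rw [← Real.rpow_add_one hs.ne', sub_add_cancel]
  have hs1 : 0 < s ^ (p - 1) := Real.rpow_pos_of_pos hs _
  have hLe : L ^ (-ε) ≤ 1 := Real.rpow_le_one_of_one_le_of_nonpos hL (neg_nonpos.2 hε)
  have hLe0 : 0 < L ^ (-ε) := Real.rpow_pos_of_pos hL0 _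
  -- L − 1 = ln((e+s)/e), bounded below by ln x ≥ 1 − 1/x.
  have hq : s / (Real.exp 1 + s) ≤ L - 1 := by
    have := Real.one_sub_inv_le_log_of_pos (x := (Real.exp 1 + s) / Real.exp 1) (by positivity)
    rw [Real.log_div he.ne' (Real.exp_pos 1).ne', Real.log_exp, inv_div] at this
    have e : s / (Real.exp 1 + s) = 1 - Real.exp 1 / (Real.exp 1 + s) := by field_simp; ring
    rw [e]; exact this
  have hq0 : 0 ≤ s / (Real.exp 1 + s) := by positivity
  -- Bernoulli's inequality for (1 + (L−1))^{1+ε}.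
  have hB : ε * (L - 1) ≤ L ^ (1 + ε) := by
    have := one_add_mul_self_le_rpow_one_add (s := L - 1) (by linarith) (p := 1 + ε) (by linarith)
    rw [add_sub_cancel] at this
    nlinarith
  have hLm : L ^ (-ε - 1) = (L ^ (1 + ε))⁻¹ := by
    rw [← Real.rpow_neg hL0.le]; congr 1; ring
  have hD : ε * (s / (Real.exp 1 + s)) * L ^ (-ε - 1) ≤ 1 := by
    rw [hLm, ← div_eq_mul_inv, div_le_one (Real.rpow_pos_of_pos hL0 _)]
    exact (mul_le_mul_of_nonneg_left hq hε).trans hB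
  have hD0 : 0 ≤ ε * (s / (Real.exp 1 + s)) * L ^ (-ε - 1) :=
    mul_nonneg (mul_nonneg hε hq0) (Real.rpow_nonneg hL0.le _)
  have e : p * s ^ (p - 1) * L ^ (-ε) + s ^ p * (1 / (Real.exp 1 + s) * -ε * L ^ (-ε - 1)) =
      s ^ (p - 1) * (p * L ^ (-ε) - ε * (s / (Real.exp 1 + s)) * L ^ (-ε - 1)) := by
    rw [hsp]; ring
  rw [← hLdef, e, abs_mul, abs_of_pos hs1, mul_comm]
  refine mul_le_mul_of_nonneg_right (abs_le.2 ⟨?_, ?_⟩) hs1.le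
  · nlinarith
  · nlinarith

theorem exists_hasDerivAt_nonlin (hn : 3 ≤ n) {ε : ℝ} (hε : 0 ≤ ε) (s : ℝ) :
    ∃ d, HasDerivAt (nonlin n ε) d s ∧ |d| ≤ critExp n * |s| ^ (critExp n - 1) := by
  have hp := one_lt_critExp hn
  rcases lt_trichotomy s 0 with h | rfl | h
  · obtain ⟨d, hd, hd'⟩ := exists_hasDerivAt_nonlin_of_pos hn hε (neg_pos.2 h)
    refine ⟨d, ?_, by rwa [abs_of_neg h]⟩
    have h1 := (hd.scomp s (hasDerivAt_neg s)).neg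
    have h2 : nonlin n ε = -(nonlin n ε ∘ Neg.neg) := by
      funext t; simp [nonlin_neg]
    rw [h2]
    simpa using h1
  · refine ⟨0, ?_, by rw [abs_zero, Real.zero_rpow (by linarith), mul_zero]⟩
    rw [hasDerivAt_iff_isLittleO]
    simp only [nonlin_zero, sub_zero, smul_zero]
    refine (Asymptotics.IsBigO.of_bound 1 (g := fun s : ℝ => |s| ^ (critExp n - 1) * |s|)
      (Eventually.of_forall fun s => ?_)).trans_isLittleO ?_
    · rw [one_mul, Real.norm_eq_abs, Real.norm_eq_abs]
      refine (abs_nonlin_le hn hε s).trans (le_trans ?_ (le_abs_self _))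
      rcases eq_or_ne s 0 with rfl | hs
      · rw [abs_zero, mul_zero, Real.zero_rpow (by linarith)]
      · rw [← Real.rpow_add_one (abs_ne_zero.2 hs), sub_add_cancel]
    · have h1 : (fun s : ℝ => |s| ^ (critExp n - 1)) =o[𝓝 0] fun _ => (1 : ℝ) := by
        rw [Asymptotics.isLittleO_one_iff]
        have : Continuous fun s : ℝ => |s| ^ (critExp n - 1) :=
          continuous_abs.rpow_const fun _ => Or.inr (by linarith)
        have h2 := this.tendsto 0
        rwa [abs_zero, Real.zero_rpow (by linarith)] at h2
      have h2 : (fun s : ℝ => |s|) =O[𝓝 0] fun s => s := Asymptotics.isBigO_of_le _ fun s => by simp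
      simpa using h1.mul_isBigO h2
  · obtain ⟨d, hd, hd'⟩ := exists_hasDerivAt_nonlin_of_pos hn hε h
    exact ⟨d, hd, by rwa [abs_of_pos h]⟩

theorem continuous_nonlin (hn : 3 ≤ n) {ε : ℝ} (hε : 0 ≤ ε) : Continuous (nonlin n ε) :=
  continuous_iff_continuousAt.2 fun s =>
    (exists_hasDerivAt_nonlin hn hε s).choose_spec.1.continuousAt

theorem abs_nonlin_sub_le (hn : 3 ≤ n) {ε : ℝ} (hε : 0 ≤ ε) {s t r : ℝ} (hs : |s| ≤ r)
    (ht : |t| ≤ r) :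
    |nonlin n ε s - nonlin n ε t| ≤ critExp n * r ^ (critExp n - 1) * |s - t| := by
  have hp := one_lt_critExp hn
  choose d hd hd' using exists_hasDerivAt_nonlin hn hε
  refine (convex_Icc (-r) r).norm_image_sub_le_of_norm_hasDerivWithin_le (𝕜 := ℝ)
    (f := nonlin n ε) (f' := d) (fun x _ => (hd x).hasDerivWithinAt) (fun x hx => ?_)
    (abs_le.1 ht) (abs_le.1 hs)
  refine (hd' x).trans (mul_le_mul_of_nonneg_left ?_ (by linarith))
  exact Real.rpow_le_rpow (abs_nonneg _) (abs_le.2 hx) (by linarith)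

theorem hasDerivAt_nonlinPrim (hn : 3 ≤ n) {ε : ℝ} (hε : 0 ≤ ε) (s : ℝ) :
    HasDerivAt (nonlinPrim n ε) (nonlin n ε s) s :=
  intervalIntegral.integral_hasDerivAt_right
    ((continuous_nonlin hn hε).intervalIntegrable _ _)
    ((continuous_nonlin hn hε).stronglyMeasurableAtFilter _ _)
    (continuous_nonlin hn hε).continuousAt

theorem nonlinPrim_zero (ε : ℝ) : nonlinPrim n ε 0 = 0 := by simp [nonlinPrim]

theorem continuous_nonlinPrim (hn : 3 ≤ n) {ε : ℝ} (hε : 0 ≤ ε) : Continuous (nonlinPrim n ε) :=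
  continuous_iff_continuousAt.2 fun s => (hasDerivAt_nonlinPrim hn hε s).continuousAt

/-- Second order Taylor bound, from the mean value inequality for F_ε(x) − f_ε(s)x and the Lipschitz
bound for f_ε. The exponent 2 is real to match the Hölder estimate `integral_rpow_mul_rpow_le`. -/
theorem abs_nonlinPrim_sub_le (hn : 3 ≤ n) {ε : ℝ} (hε : 0 ≤ ε) (s t : ℝ) :
    |nonlinPrim n ε (s + t) - nonlinPrim n ε s - nonlin n ε s * t| ≤
      critExp n * ((|s| + |t|) ^ (critExp n - 1) * |t| ^ (2 : ℝ)) := by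
  have hp := one_lt_critExp hn
  have h := (convex_uIcc s (s + t)).norm_image_sub_le_of_norm_hasDerivWithin_le (𝕜 := ℝ)
    (f := fun x => nonlinPrim n ε x - nonlin n ε s * x)
    (f' := fun x => nonlin n ε x - nonlin n ε s)
    (C := critExp n * (|s| + |t|) ^ (critExp n - 1) * |t|)
    (fun x _ => ((hasDerivAt_nonlinPrim hn hε x).sub (by
      simpa using (hasDerivAt_id x).const_mul (nonlin n ε s))).hasDerivWithinAt)
    (fun x hx => ?_) left_mem_uIcc right_mem_uIcc
  · rw [Real.norm_eq_abs, Real.norm_eq_abs, add_sub_cancel_left] at h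
    rw [Real.rpow_two, sq]
    calc _ = |nonlinPrim n ε (s + t) - nonlin n ε s * (s + t) -
          (nonlinPrim n ε s - nonlin n ε s * s)| := by congr 1; ring
      _ ≤ _ := h
      _ = _ := by ring
  · have h1 : |x - s| ≤ |t| := by
      have := abs_sub_left_of_mem_uIcc hx
      rwa [add_sub_cancel_left] at this
    have h2 : |x| ≤ |s| + |t| := by
      have : |x| ≤ |s| + |x - s| := by
        have := abs_add_le s (x - s); rwa [add_sub_cancel] at this
      linarith
    refine (abs_nonlin_sub_le hn hε h2 (by linarith [abs_nonneg t])).trans ?_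
    exact mul_le_mul_of_nonneg_left h1 (mul_nonneg (by linarith)
      (Real.rpow_nonneg (by positivity) _))

theorem abs_nonlinPrim_le (hn : 3 ≤ n) {ε : ℝ} (hε : 0 ≤ ε) (t : ℝ) :
    |nonlinPrim n ε t| ≤ critExp n * (|t| ^ (critExp n - 1) * |t| ^ (2 : ℝ)) := by
  simpa [nonlinPrim_zero, nonlin_zero] using abs_nonlinPrim_sub_le hn hε 0 t

end Nonlinearity

/-! ### Hölder's inequality at the critical exponent -/

section Hoelder

variable {n : ℕ} {α : Type*} [MeasurableSpace α] {μ : Measure α}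

/-- Hölder with weights a/(p+1) and b/(p+1), where p + 1 = 2n/(n−2), so that both factors are
measured in the Sobolev space of the embedding. -/
theorem lintegral_rpow_mul_rpow_le (hn : 3 ≤ n) {f g : α → ℝ} (hf : AEStronglyMeasurable f μ)
    (hg : AEStronglyMeasurable g μ) {a b : ℝ} (ha : 0 ≤ a) (hb : 0 ≤ b)
    (hab : a + b = critExp n + 1) :
    ∫⁻ x, ‖f x‖ₑ ^ a * ‖g x‖ₑ ^ b ∂μ ≤ eLpNorm f (sobExp n) μ ^ a * eLpNorm g (sobExp n) μ ^ b := by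
  have hr : (sobExp n).toReal = critExp n + 1 := by rw [toReal_sobExp hn, critExp_eq hn]; ring
  have hp := one_lt_critExp hn
  set r := critExp n + 1
  have hr0 : r ≠ 0 := by linarith
  have h := ENNReal.lintegral_mul_norm_pow_le (hf.enorm.pow_const r) (hg.enorm.pow_const r)
    (p := a / r) (q := b / r) (by positivity) (by positivity) (by field_simp; exact hab)
  simp only [← ENNReal.rpow_mul, mul_div_cancel₀ _ hr0] at h
  rw [eLpNorm_eq_lintegral_rpow_enorm_toReal (sobExp_ne_zero hn) (sobExp_ne_top),
    eLpNorm_eq_lintegral_rpow_enorm_toReal (sobExp_ne_zero hn) (sobExp_ne_top), hr,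
    ← ENNReal.rpow_mul, ← ENNReal.rpow_mul, one_div_mul_eq_div, one_div_mul_eq_div]
  exact h

theorem enorm_abs_rpow_mul {a b : ℝ} (ha : 0 ≤ a) (hb : 0 ≤ b) (s t : ℝ) :
    ‖|s| ^ a * |t| ^ b‖ₑ = ‖s‖ₑ ^ a * ‖t‖ₑ ^ b := by
  rw [enorm_mul, Real.enorm_rpow_of_nonneg (abs_nonneg _) ha,
    Real.enorm_rpow_of_nonneg (abs_nonneg _) hb, Real.enorm_abs, Real.enorm_abs]

theorem integrable_rpow_mul_rpow (hn : 3 ≤ n) {f g : α → ℝ} (hf : MemLp f (sobExp n) μ)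
    (hg : MemLp g (sobExp n) μ) {a b : ℝ} (ha : 0 ≤ a) (hb : 0 ≤ b) (hab : a + b = critExp n + 1) :
    Integrable (fun x => |f x| ^ a * |g x| ^ b) μ := by
  refine ⟨((continuous_abs.rpow_const fun _ => Or.inr ha).comp_aestronglyMeasurable hf.1).mul
    ((continuous_abs.rpow_const fun _ => Or.inr hb).comp_aestronglyMeasurable hg.1), ?_⟩
  simp only [HasFiniteIntegral, enorm_abs_rpow_mul ha hb]
  exact (lintegral_rpow_mul_rpow_le hn hf.1 hg.1 ha hb hab).trans_lt (ENNReal.mul_lt_top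
    (ENNReal.rpow_lt_top_of_nonneg ha hf.2.ne) (ENNReal.rpow_lt_top_of_nonneg hb hg.2.ne))

theorem integral_rpow_mul_rpow_le (hn : 3 ≤ n) {f g : α → ℝ} (hf : MemLp f (sobExp n) μ)
    (hg : MemLp g (sobExp n) μ) {a b : ℝ} (ha : 0 ≤ a) (hb : 0 ≤ b) (hab : a + b = critExp n + 1) :
    ∫ x, |f x| ^ a * |g x| ^ b ∂μ ≤
      (eLpNorm f (sobExp n) μ).toReal ^ a * (eLpNorm g (sobExp n) μ).toReal ^ b := by
  rw [integral_eq_lintegral_of_nonneg_ae (Filter.Eventually.of_forall fun x => by positivity)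
    (integrable_rpow_mul_rpow hn hf hg ha hb hab).1, ENNReal.toReal_rpow, ENNReal.toReal_rpow,
    ← ENNReal.toReal_mul]
  refine ENNReal.toReal_mono (ENNReal.mul_ne_top
    (ENNReal.rpow_lt_top_of_nonneg ha hf.2.ne).ne (ENNReal.rpow_lt_top_of_nonneg hb hg.2.ne).ne) ?_
  refine le_trans (le_of_eq (lintegral_congr fun x => ?_))
    (lintegral_rpow_mul_rpow_le hn hf.1 hg.1 ha hb hab)
  rw [← enorm_abs_rpow_mul ha hb, Real.enorm_of_nonneg (by positivity)]

end Hoelder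

/-! ### Differentiability of the energy -/

section Energy

open Filter Topology

variable {n : ℕ} {hn : 3 ≤ n} {Ω : Set (Euc n)} {hΩ : IsSmoothBoundedDomain Ω}

/-- The constant of the Sobolev embedding `H¹₀(Ω) → L^{2n/(n-2)}(Ω)`. -/
def embConst (n : ℕ) : ℝ := sharpConst n ^ (-(1 / 2) : ℝ)

theorem embConst_pos (hn : 3 ≤ n) : 0 < embConst n := Real.rpow_pos_of_pos (sharpConst_pos hn) _

theorem H10.toReal_eLpNorm_fn_le (u : H10 hn hΩ) :
    (eLpNorm (H10.fn u) (sobExp n) (volume.restrict Ω)).toReal ≤ embConst n * ‖u‖ :=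
  ENNReal.toReal_le_of_le_ofReal (mul_nonneg (embConst_pos hn).le (norm_nonneg _))
    (H10.eLpNorm_fn_le u)

theorem H10.fn_add (u v : H10 hn hΩ) :
    H10.fn (u + v) =ᵐ[volume.restrict Ω] fun x => H10.fn u x + H10.fn v x := by
  rw [map_add]; exact Lp.coeFn_add _ _

theorem H10.fn_smul (c : ℝ) (u : H10 hn hΩ) :
    H10.fn (c • u) =ᵐ[volume.restrict Ω] fun x => c * H10.fn u x := by
  rw [map_smul]; exact Lp.coeFn_smul _ _

theorem integrable_rpow_critExp_mul {f g : Euc n → ℝ} (hn : 3 ≤ n) {μ : Measure (Euc n)}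
    (hf : MemLp f (sobExp n) μ) (hg : MemLp g (sobExp n) μ) :
    Integrable (fun x => |f x| ^ critExp n * |g x|) μ := by
  simpa using integrable_rpow_mul_rpow hn hf hg (b := 1)
    (by linarith [one_lt_critExp hn]) zero_le_one rfl

theorem integral_rpow_critExp_mul_le {f g : Euc n → ℝ} (hn : 3 ≤ n) {μ : Measure (Euc n)}
    (hf : MemLp f (sobExp n) μ) (hg : MemLp g (sobExp n) μ) :
    ∫ x, |f x| ^ critExp n * |g x| ∂μ ≤
      (eLpNorm f (sobExp n) μ).toReal ^ critExp n * (eLpNorm g (sobExp n) μ).toReal := by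
  simpa using integral_rpow_mul_rpow_le hn hf hg (b := 1)
    (by linarith [one_lt_critExp hn]) zero_le_one rfl

theorem integrable_nonlin_mul {ε : ℝ} (hε : 0 ≤ ε) (u w : H10 hn hΩ) :
    Integrable (fun x => nonlin n ε (H10.fn u x) * H10.fn w x) (volume.restrict Ω) := by
  refine (integrable_rpow_critExp_mul hn u.memLp_fn w.memLp_fn).mono'
    (((continuous_nonlin hn hε).comp_aestronglyMeasurable u.memLp_fn.1).mul w.memLp_fn.1)
    (Eventually.of_forall fun x => ?_)
  rw [Real.norm_eq_abs, abs_mul]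
  exact mul_le_mul_of_nonneg_right (abs_nonlin_le hn hε _) (abs_nonneg _)

theorem abs_integral_nonlin_mul_le {ε : ℝ} (hε : 0 ≤ ε) (u w : H10 hn hΩ) :
    |∫ x in Ω, nonlin n ε (H10.fn u x) * H10.fn w x| ≤
      (embConst n * ‖u‖) ^ critExp n * embConst n * ‖w‖ := by
  have hp := one_lt_critExp hn
  calc |∫ x in Ω, nonlin n ε (H10.fn u x) * H10.fn w x|
      ≤ ∫ x in Ω, |nonlin n ε (H10.fn u x) * H10.fn w x| := abs_integral_le_integral_abs
    _ ≤ ∫ x in Ω, |H10.fn u x| ^ critExp n * |H10.fn w x| := by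
        refine integral_mono (integrable_nonlin_mul hε u w).abs
          (integrable_rpow_critExp_mul hn u.memLp_fn w.memLp_fn) fun x => ?_
        simp only [abs_mul]
        exact mul_le_mul_of_nonneg_right (abs_nonlin_le hn hε _) (abs_nonneg _)
    _ ≤ _ := integral_rpow_critExp_mul_le hn u.memLp_fn w.memLp_fn
    _ ≤ (embConst n * ‖u‖) ^ critExp n * (embConst n * ‖w‖) := by
        have := u.toReal_eLpNorm_fn_le
        have := w.toReal_eLpNorm_fn_le
        have := embConst_pos hn
        have : 0 ≤ (embConst n * ‖u‖) ^ critExp n := by positivity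
        gcongr
    _ = _ := by ring

/-- The derivative of `u ↦ ∫_Ω F_ε(u)`. -/
def nonlinDeriv {ε : ℝ} (hε : 0 ≤ ε) (u : H10 hn hΩ) : H10 hn hΩ →L[ℝ] ℝ :=
  LinearMap.mkContinuous
    { toFun := fun w => ∫ x in Ω, nonlin n ε (H10.fn u x) * H10.fn w x
      map_add' := fun w w' => by
        rw [← integral_add (integrable_nonlin_mul hε u w) (integrable_nonlin_mul hε u w')]
        refine integral_congr_ae ?_
        filter_upwards [H10.fn_add w w'] with x hx
        rw [hx, mul_add]
      map_smul' := fun c w => by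
        rw [RingHom.id_apply, smul_eq_mul, ← integral_const_mul]
        refine integral_congr_ae ?_
        filter_upwards [H10.fn_smul c w] with x hx
        rw [hx]; ring }
    ((embConst n * ‖u‖) ^ critExp n * embConst n) (abs_integral_nonlin_mul_le hε u)

theorem nonlinDeriv_apply {ε : ℝ} (hε : 0 ≤ ε) (u w : H10 hn hΩ) :
    nonlinDeriv hε u w = ∫ x in Ω, nonlin n ε (H10.fn u x) * H10.fn w x := rfl

theorem integrable_nonlinPrim {ε : ℝ} (hε : 0 ≤ ε) (u : H10 hn hΩ) :
    Integrable (fun x => nonlinPrim n ε (H10.fn u x)) (volume.restrict Ω) := by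
  have hp := one_lt_critExp hn
  refine ((integrable_rpow_mul_rpow hn u.memLp_fn u.memLp_fn (a := critExp n - 1) (b := 2)
    (by linarith) (by norm_num) (by ring)).const_mul (critExp n)).mono'
    ((continuous_nonlinPrim hn hε).comp_aestronglyMeasurable u.memLp_fn.1)
    (Eventually.of_forall fun x => abs_nonlinPrim_le hn hε _)

theorem abs_integral_nonlinPrim_sub_le {ε : ℝ} (hε : 0 ≤ ε) (u w : H10 hn hΩ) :
    |(∫ x in Ω, nonlinPrim n ε (H10.fn (u + w) x)) - (∫ x in Ω, nonlinPrim n ε (H10.fn u x)) -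
        nonlinDeriv hε u w| ≤
      critExp n * ((embConst n * (‖u‖ + ‖w‖)) ^ (critExp n - 1) * (embConst n * ‖w‖) ^ 2) := by
  have hp := one_lt_critExp hn
  set f := fun x => |H10.fn u x| + |H10.fn w x| with hf
  have hfm : MemLp f (sobExp n) (volume.restrict Ω) := u.memLp_fn.norm.add w.memLp_fn.norm
  have hfn : (eLpNorm f (sobExp n) (volume.restrict Ω)).toReal ≤ embConst n * (‖u‖ + ‖w‖) := by
    have h1 := eLpNorm_add_le (μ := volume.restrict Ω) u.memLp_fn.norm.1 w.memLp_fn.norm.1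
      (one_le_sobExp hn)
    rw [eLpNorm_norm, eLpNorm_norm] at h1
    have h2 := ENNReal.toReal_mono (ENNReal.add_ne_top.2 ⟨u.memLp_fn.2.ne, w.memLp_fn.2.ne⟩) h1
    rw [ENNReal.toReal_add u.memLp_fn.2.ne w.memLp_fn.2.ne] at h2
    have h3 := u.toReal_eLpNorm_fn_le
    have h4 := w.toReal_eLpNorm_fn_le
    rw [mul_add]
    exact h2.trans (by linarith)
  have hint := integrable_rpow_mul_rpow hn hfm w.memLp_fn (a := critExp n - 1) (b := 2)
    (by linarith) (by norm_num) (by ring)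
  have hle := integral_rpow_mul_rpow_le hn hfm w.memLp_fn (a := critExp n - 1) (b := 2)
    (by linarith) (by norm_num) (by ring)
  rw [nonlinDeriv_apply, ← integral_sub (integrable_nonlinPrim hε _) (integrable_nonlinPrim hε _),
    ← integral_sub (f := fun x => nonlinPrim n ε (H10.fn (u + w) x) - nonlinPrim n ε (H10.fn u x))
      ((integrable_nonlinPrim hε _).sub (integrable_nonlinPrim hε _))
      (integrable_nonlin_mul hε u w)]
  refine abs_integral_le_integral_abs.trans ((integral_mono_ae ((((integrable_nonlinPrim hε _).sub
    (integrable_nonlinPrim hε _)).sub (integrable_nonlin_mul hε u w)).abs)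
    (hint.const_mul (critExp n)) ?_).trans ?_)
  · filter_upwards [H10.fn_add u w] with x hx
    simp only [Pi.sub_apply, hx]
    refine (abs_nonlinPrim_sub_le hn hε _ _).trans (le_of_eq ?_)
    rw [hf, abs_of_nonneg (by positivity : 0 ≤ |H10.fn u x| + |H10.fn w x|)]
  · rw [integral_const_mul]
    refine mul_le_mul_of_nonneg_left (hle.trans ?_) (by linarith)
    rw [Real.rpow_two]
    have := w.toReal_eLpNorm_fn_le
    have h0 : 0 ≤ critExp n - 1 := by linarith
    have := embConst_pos hn
    have : 0 ≤ (embConst n * (‖u‖ + ‖w‖)) ^ (critExp n - 1) := by positivity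
    gcongr

/-- The remainder is O(‖w − u‖²) on the unit ball around u, and adding the linear part to this
remainder recovers the functional. -/
theorem hasFDerivAt_integral_nonlinPrim {ε : ℝ} (hε : 0 ≤ ε) (u : H10 hn hΩ) :
    HasFDerivAt (fun w : H10 hn hΩ => ∫ x in Ω, nonlinPrim n ε (H10.fn w x))
      (nonlinDeriv hε u) u := by
  have hp := one_lt_critExp hn
  set G : H10 hn hΩ → ℝ := fun w => ∫ x in Ω, nonlinPrim n ε (H10.fn w x) with hG
  have h1 : (fun w => G w - G u - nonlinDeriv hε u (w - u)) =O[𝓝 u] fun w => ‖w - u‖ ^ 2 := by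
    refine Asymptotics.IsBigO.of_bound
      (critExp n * ((embConst n * (‖u‖ + 1)) ^ (critExp n - 1) * embConst n ^ 2)) ?_
    filter_upwards [Metric.ball_mem_nhds u one_pos] with w hw
    rw [mem_ball_iff_norm] at hw
    have h2 := abs_integral_nonlinPrim_sub_le hε u (w - u)
    rw [add_sub_cancel] at h2
    rw [Real.norm_eq_abs, Real.norm_of_nonneg (by positivity)]
    have hc := embConst_pos hn
    have h0 : 0 ≤ critExp n - 1 := by linarith
    calc _ ≤ _ := h2
      _ ≤ critExp n * ((embConst n * (‖u‖ + 1)) ^ (critExp n - 1) *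
            (embConst n * ‖w - u‖) ^ 2) := by gcongr
      _ = _ := by ring
  have h2 : HasFDerivAt (fun w => G w - G u - nonlinDeriv hε u (w - u)) (0 : H10 hn hΩ →L[ℝ] ℝ) u :=
    h1.hasFDerivAt one_lt_two
  have h3 := (h2.add (ContinuousLinearMap.hasFDerivAt (𝕜 := ℝ) (nonlinDeriv hε u)
    (x := u))).add_const (G u - nonlinDeriv hε u u)
  rw [zero_add] at h3
  refine h3.congr_of_eventuallyEq (Eventually.of_forall fun w => ?_)
  simp only [Pi.add_apply, map_sub]
  ring

theorem energy_eq (ε : ℝ) (u : H10 hn hΩ) :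
    energy ε u = 1 / 2 * ‖u‖ ^ 2 - ∫ x in Ω, nonlinPrim n ε (H10.fn u x) := by
  rw [energy, H10.norm_eq, ← real_inner_self_eq_norm_sq, L2.inner_def]
  simp only [real_inner_self_eq_norm_sq]

theorem hasFDerivAt_energy {ε : ℝ} (hε : 0 ≤ ε) (u : H10 hn hΩ) :
    HasFDerivAt (energy (hn := hn) (hΩ := hΩ) ε) (innerSL ℝ u - nonlinDeriv hε u) u := by
  have h1 := ((hasStrictFDerivAt_norm_sq u).hasFDerivAt.const_mul (1 / 2 : ℝ)).sub
    (hasFDerivAt_integral_nonlinPrim hε u)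
  have h2 : energy (hn := hn) (hΩ := hΩ) ε = _ := funext fun w => energy_eq ε w
  rw [h2]
  have h3 : (1 / 2 : ℝ) • (2 : ℕ) • innerSL ℝ u = innerSL ℝ u := by
    rw [← Nat.cast_smul_eq_nsmul ℝ, smul_smul]; norm_num
  rw [h3] at h1
  exact h1

/-- The gradient of the energy. -/
theorem inner_gradient_energy {ε : ℝ} (hε : 0 ≤ ε) (u w : H10 hn hΩ) :
    ⟪∇ (energy (hn := hn) (hΩ := hΩ) ε) u, w⟫_ℝ =
      ⟪u, w⟫_ℝ - ∫ x in Ω, nonlin n ε (H10.fn u x) * H10.fn w x := by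
  rw [gradient, InnerProductSpace.toDual_symm_apply, (hasFDerivAt_energy hε u).fderiv]
  rfl

end Energy

/-! ### The size of a bubble away from its centre -/

section Tail

open Filter Topology

variable {n : ℕ}

/-- The value of the bubble on the sphere of radius `d / 2` around its centre. -/
def bubbleTail (n : ℕ) (l d : ℝ) : ℝ :=
  c₀ n * l ^ (((n : ℝ) - 2) / 2) * (1 + l ^ 2 * (d / 2) ^ 2) ^ (-(((n : ℝ) - 2) / 2))

theorem bubbleTail_pos (hn : 3 ≤ n) {l : ℝ} (hl : 0 < l) (d : ℝ) : 0 < bubbleTail n l d :=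
  mul_pos (mul_pos (c₀_pos hn) (Real.rpow_pos_of_pos hl _))
    (Real.rpow_pos_of_pos (by positivity) _)

theorem bubble_le_bubbleTail (hn : 3 ≤ n) {a x : Euc n} {l d : ℝ} (hl : 0 < l) (hd : 0 ≤ d)
    (hx : x ∉ Metric.closedBall a (d / 2)) : bubble a l x ≤ bubbleTail n l d := by
  have hn' : (3 : ℝ) ≤ n := by exact_mod_cast hn
  rw [Metric.mem_closedBall, dist_eq_norm, not_le] at hx
  rw [bubble_eq, bubbleTail]
  refine mul_le_mul_of_nonneg_left ?_ (mul_pos (c₀_pos hn) (Real.rpow_pos_of_pos hl _)).le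
  refine Real.rpow_le_rpow_of_nonpos (by positivity) ?_ (by linarith)
  rw [bubbleJap]
  gcongr

theorem bubble_le (hn : 3 ≤ n) (a x : Euc n) {l : ℝ} (hl : 0 < l) :
    bubble a l x ≤ c₀ n * l ^ (((n : ℝ) - 2) / 2) := by
  have hn' : (3 : ℝ) ≤ n := by exact_mod_cast hn
  rw [bubble_eq]
  exact mul_le_of_le_one_right (mul_pos (c₀_pos hn) (Real.rpow_pos_of_pos hl _)).le
    (Real.rpow_le_one_of_one_le_of_nonpos (one_le_bubbleJap a l x) (by linarith))

theorem integrable_bubble_rpow_critExp (hn : 3 ≤ n) (a : Euc n) {l : ℝ} (hl : 0 < l) :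
    Integrable fun y => bubble a l y ^ critExp n := by
  simp only [bubble_rpow_critExp hn a hl]
  have h := integrable_bubbleJap_rpow (s := (n : ℝ) / 2 + 1) (by linarith) a hl
  rw [neg_add] at h
  exact h.const_mul _

/-- The constant in the estimate of the energy lost by projecting a bubble. -/
def tailConst (n : ℕ) : ℝ :=
  c₀ n ^ 2 * (n - 2) * n * 2 ^ ((n : ℝ) - 2) * ∫ x : Euc n, (1 + ‖x‖ ^ 2) ^ (-((n : ℝ) / 2 + 1))

theorem rpow_half_mul_pow (n : ℕ) {l : ℝ} (hl : 0 < l) :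
    l ^ (((n : ℝ) - 2) / 2) * l ^ (((n : ℝ) - 2) / 2) * l ^ 2 = l ^ n := by
  rw [← Real.rpow_add hl, ← Real.rpow_natCast l 2, ← Real.rpow_add hl, ← Real.rpow_natCast]
  congr 1; push_cast; ring

theorem integral_bubble_rpow_critExp (hn : 3 ≤ n) (a : Euc n) {l : ℝ} (hl : 0 < l) :
    ∫ y, bubble a l y ^ critExp n = c₀ n * l ^ (((n : ℝ) - 2) / 2) * (n - 2) * l ^ 2 * n *
      ((l ^ n)⁻¹ * ∫ x : Euc n, (1 + ‖x‖ ^ 2) ^ (-((n : ℝ) / 2 + 1))) := by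
  simp only [bubble_rpow_critExp hn a hl]
  rw [integral_const_mul, ← integral_bubbleJap_rpow _ a hl, neg_add]
  rfl

/-- The powers of λ combine to λ^{(n−2)/2} λ^{(n−2)/2} λ² λ^{−n} = 1; what is left is (1 +
λ²d²/4)^{−(n−2)/2} ≤ (λd/2)^{−(n−2)}. -/
theorem bubbleTail_mul_integral_le (hn : 3 ≤ n) (a : Euc n) {l d : ℝ} (hl : 0 < l) (hd : 0 < d) :
    bubbleTail n l d * ∫ y, bubble a l y ^ critExp n ≤
      tailConst n * (1 / (l * d) ^ ((n : ℝ) - 2)) := by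
  have hn' : (3 : ℝ) ≤ n := by exact_mod_cast hn
  have hn2 : (0 : ℝ) < n - 2 := by linarith
  have hln := rpow_half_mul_pow n hl
  set k := ((n : ℝ) - 2) / 2 with hk
  have hJ : 0 ≤ ∫ x : Euc n, (1 + ‖x‖ ^ 2) ^ (-((n : ℝ) / 2 + 1)) :=
    integral_nonneg fun x => Real.rpow_nonneg (by positivity) _
  rw [integral_bubble_rpow_critExp hn a hl, bubbleTail, tailConst, ← hk]
  set J := ∫ x : Euc n, (1 + ‖x‖ ^ 2) ^ (-((n : ℝ) / 2 + 1))
  have hld : 0 < l * d / 2 := by positivity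
  have h1 : (1 + l ^ 2 * (d / 2) ^ 2) ^ (-k) ≤ 2 ^ ((n : ℝ) - 2) * (1 / (l * d) ^ ((n : ℝ) - 2)) := by
    calc (1 + l ^ 2 * (d / 2) ^ 2) ^ (-k) ≤ ((l * d / 2) ^ 2) ^ (-k) :=
          Real.rpow_le_rpow_of_nonpos (by positivity) (by nlinarith) (by rw [hk]; linarith)
      _ = _ := by
          rw [← Real.rpow_natCast, ← Real.rpow_mul hld.le, show ((2 : ℕ) : ℝ) * -k = -((n : ℝ) - 2) by
            rw [hk]; push_cast; ring, Real.rpow_neg hld.le, Real.div_rpow (by positivity) (by norm_num)]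
          field_simp
  have hlp : 0 < l ^ n := by positivity
  have hc := c₀_pos hn
  calc c₀ n * l ^ k * (1 + l ^ 2 * (d / 2) ^ 2) ^ (-k) *
        (c₀ n * l ^ k * (n - 2) * l ^ 2 * n * ((l ^ n)⁻¹ * J))
      = c₀ n ^ 2 * (n - 2) * n * J * ((l ^ k * l ^ k * l ^ 2) * (l ^ n)⁻¹) *
          (1 + l ^ 2 * (d / 2) ^ 2) ^ (-k) := by ring
    _ = c₀ n ^ 2 * (n - 2) * n * J * (1 + l ^ 2 * (d / 2) ^ 2) ^ (-k) := by
          rw [hln, mul_inv_cancel₀ hlp.ne', mul_one]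
    _ ≤ c₀ n ^ 2 * (n - 2) * n * J * (2 ^ ((n : ℝ) - 2) * (1 / (l * d) ^ ((n : ℝ) - 2))) :=
          mul_le_mul_of_nonneg_left h1 (by positivity)
    _ = _ := by ring

theorem tailConst_nonneg (hn : 3 ≤ n) : 0 ≤ tailConst n := by
  have hn' : (3 : ℝ) ≤ n := by exact_mod_cast hn
  have hn2 : (0 : ℝ) < n - 2 := by linarith
  have hJ : 0 ≤ ∫ x : Euc n, (1 + ‖x‖ ^ 2) ^ (-((n : ℝ) / 2 + 1)) :=
    integral_nonneg fun x => Real.rpow_nonneg (by positivity) _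
  unfold tailConst
  positivity

/-- Convexity of t ↦ t^q at s, that is, Bernoulli's inequality for t/s. -/
theorem rpow_sub_rpow_le {s t q : ℝ} (ht : 0 ≤ t) (hts : t ≤ s) (hq : 1 ≤ q) :
    s ^ q - t ^ q ≤ q * (s ^ (q - 1) * (s - t)) := by
  rcases (ht.trans hts).eq_or_lt with rfl | hs
  · rw [le_antisymm hts ht]; simp
  have h := one_add_mul_self_le_rpow_one_add (s := t / s - 1) (by
    have := div_nonneg ht hs.le; linarith) hq
  rw [add_sub_cancel, Real.div_rpow ht hs.le, le_div_iff₀ (Real.rpow_pos_of_pos hs _)] at h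
  have e : s ^ q = s ^ (q - 1) * s := by rw [← Real.rpow_add_one hs.ne', sub_add_cancel]
  have e2 : (1 + q * (t / s - 1)) * s ^ q = s ^ q - q * (s ^ (q - 1) * (s - t)) := by
    rw [e]; field_simp; ring
  linarith

end Tail

/-! ### The energy and the critical norm of a projected bubble -/

section ProjectedBubble

open Filter Topology

variable {n : ℕ} (hn : 3 ≤ n) {Ω : Set (Euc n)} (hΩ : IsSmoothBoundedDomain Ω) {a : Euc n} {l : ℝ}

/-- Halving the radius makes the closed ball a compact subset of Ω, off which δ is at most its value
on the sphere. -/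
theorem sub_bubbleTail_le_fn_projBubble (ha : a ∈ Ω) (hl : 0 < l) (hd : 0 < bdist Ω a) :
    ∀ᵐ x ∂volume.restrict Ω,
      bubble a l x - bubbleTail n l (bdist Ω a) ≤ H10.fn (projBubble hn hΩ a l) x :=
  bubble_sub_le_fn_projBubble hn hΩ a (isCompact_closedBall a (bdist Ω a / 2))
    ((Metric.closedBall_subset_ball (by linarith)).trans (ball_bdist_subset hΩ.isOpen ha))
    fun _ hx => bubble_le_bubbleTail hn hl hd.le hx

theorem integral_compl_bubble_rpow_le (hn : 3 ≤ n) (hΩ : IsSmoothBoundedDomain Ω) (ha : a ∈ Ω) (hl : 0 < l) (hd : 0 < bdist Ω a) :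
    ∫ x in Ωᶜ, bubble a l x ^ (critExp n + 1) ≤
      bubbleTail n l (bdist Ω a) * ∫ x, bubble a l x ^ critExp n := by
  have hpos := bubble_pos hn a hl
  have hi := integrable_bubble_rpow_critExp hn a hl
  have hM := bubbleTail_pos hn hl (bdist Ω a)
  calc ∫ x in Ωᶜ, bubble a l x ^ (critExp n + 1)
      ≤ ∫ x in Ωᶜ, bubbleTail n l (bdist Ω a) * bubble a l x ^ critExp n := by
        refine setIntegral_mono_on (integrable_bubble_rpow hn a hl).integrableOn
          (hi.const_mul _).integrableOn hΩ.isOpen.measurableSet.compl fun x hx => ?_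
        rw [Real.rpow_add_one (hpos x).ne', mul_comm]
        refine mul_le_mul_of_nonneg_right (bubble_le_bubbleTail hn hl hd.le fun h => hx ?_)
          (Real.rpow_nonneg (hpos x).le _)
        exact ball_bdist_subset hΩ.isOpen ha (Metric.closedBall_subset_ball (by linarith) h)
    _ ≤ ∫ x, bubbleTail n l (bdist Ω a) * bubble a l x ^ critExp n :=
        setIntegral_le_integral (hi.const_mul _) (Eventually.of_forall fun x =>
          mul_nonneg hM.le (Real.rpow_nonneg (hpos x).le _))
    _ = _ := integral_const_mul _ _

theorem integrable_bubble_rpow_mul_fn (hl : 0 < l) (v : H10 hn hΩ) :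
    Integrable (fun x => bubble a l x ^ critExp n * H10.fn v x) (volume.restrict Ω) := by
  have hb := memLp_of_continuous hΩ (continuous_bubble_rpow hn a hl (critExp n)) 2
  exact hb.integrable_mul (Lp.memLp (H10.fn v))

theorem integral_bubble_rpow_mul_sub_le (ha : a ∈ Ω) (hl : 0 < l) (hd : 0 < bdist Ω a) :
    ∫ x in Ω, bubble a l x ^ critExp n * (bubble a l x - H10.fn (projBubble hn hΩ a l) x) ≤
      bubbleTail n l (bdist Ω a) * ∫ x, bubble a l x ^ critExp n := by
  have hpos := bubble_pos hn a hl
  have hi := integrable_bubble_rpow_critExp hn a hl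
  have hM := bubbleTail_pos hn hl (bdist Ω a)
  have hi2 : Integrable (fun x => bubble a l x ^ critExp n * bubble a l x) := by
    simp only [← fun x => Real.rpow_add_one (hpos x).ne' (critExp n)]
    exact integrable_bubble_rpow hn a hl
  calc _ ≤ ∫ x in Ω, bubbleTail n l (bdist Ω a) * bubble a l x ^ critExp n := by
        refine integral_mono_ae ?_ (hi.const_mul _).integrableOn ?_
        · simp only [mul_sub]
          exact hi2.integrableOn.sub (integrable_bubble_rpow_mul_fn hn hΩ hl _)
        · filter_upwards [sub_bubbleTail_le_fn_projBubble hn hΩ ha hl hd] with x hx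
          rw [mul_comm]
          exact mul_le_mul_of_nonneg_right (by linarith) (Real.rpow_nonneg (hpos x).le _)
    _ ≤ ∫ x, bubbleTail n l (bdist Ω a) * bubble a l x ^ critExp n :=
        setIntegral_le_integral (hi.const_mul _) (Eventually.of_forall fun x =>
          mul_nonneg hM.le (Real.rpow_nonneg (hpos x).le _))
    _ = _ := integral_const_mul _ _

theorem integral_bubble_rpow_eq_add (hn : 3 ≤ n) (hΩ : IsSmoothBoundedDomain Ω) (hl : 0 < l) :
    bubbleMass n = (∫ x in Ω, bubble a l x ^ (critExp n + 1)) +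
      ∫ x in Ωᶜ, bubble a l x ^ (critExp n + 1) := by
  rw [integral_add_compl hΩ.isOpen.measurableSet (integrable_bubble_rpow hn a hl),
    integral_bubble_rpow hn a hl]

theorem integral_compl_bubble_rpow_nonneg (hn : 3 ≤ n) (hl : 0 < l) :
    0 ≤ ∫ x in Ωᶜ, bubble a l x ^ (critExp n + 1) :=
  integral_nonneg fun x => Real.rpow_nonneg (bubble_pos hn a hl x).le _

/-- The equation gives ‖Pδ‖² = ∫_Ω δ^p Pδ, and Pδ = δ − (δ − Pδ) separates the mass in Ω from the
projection error. -/
theorem norm_sq_projBubble_eq (hl : 0 < l) : ‖projBubble hn hΩ a l‖ ^ 2 =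
    (∫ x in Ω, bubble a l x ^ (critExp n + 1)) -
      ∫ x in Ω, bubble a l x ^ critExp n * (bubble a l x - H10.fn (projBubble hn hΩ a l) x) := by
  have hpos := bubble_pos hn a hl
  have hi2 : Integrable (fun x => bubble a l x ^ critExp n * bubble a l x) := by
    simp only [← fun x => Real.rpow_add_one (hpos x).ne' (critExp n)]
    exact integrable_bubble_rpow hn a hl
  simp only [mul_sub, fun x => Real.rpow_add_one (hpos x).ne' (critExp n)]
  rw [integral_sub hi2.integrableOn (integrable_bubble_rpow_mul_fn hn hΩ hl _),
    ← inner_projBubble_eq_integral a hl, real_inner_self_eq_norm_sq]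
  ring

theorem norm_sq_projBubble_le (hl : 0 < l) : ‖projBubble hn hΩ a l‖ ^ 2 ≤ bubbleMass n := by
  have h1 : 0 ≤ ∫ x in Ω, bubble a l x ^ critExp n *
      (bubble a l x - H10.fn (projBubble hn hΩ a l) x) := by
    refine integral_nonneg_of_ae ?_
    filter_upwards [fn_projBubble_le hn hΩ a hl] with x hx
    exact mul_nonneg (Real.rpow_nonneg (bubble_pos hn a hl x).le _) (sub_nonneg.2 hx)
  have h2 := integral_compl_bubble_rpow_nonneg (Ω := Ω) (a := a) hn hl
  rw [norm_sq_projBubble_eq hn hΩ hl, integral_bubble_rpow_eq_add hn hΩ hl (a := a)]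
  linarith

/-- One tail accounts for the mass outside Ω and one for δ − Pδ. -/
theorem le_norm_sq_projBubble (ha : a ∈ Ω) (hl : 0 < l) (hd : 0 < bdist Ω a) :
    bubbleMass n - 2 * (tailConst n * (1 / (l * bdist Ω a) ^ ((n : ℝ) - 2))) ≤
      ‖projBubble hn hΩ a l‖ ^ 2 := by
  have h1 := integral_bubble_rpow_mul_sub_le hn hΩ ha hl hd
  have h2 := integral_compl_bubble_rpow_le hn hΩ ha hl hd
  have h3 := bubbleTail_mul_integral_le hn a hl hd
  rw [norm_sq_projBubble_eq hn hΩ hl, integral_bubble_rpow_eq_add hn hΩ hl (a := a)]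
  linarith

theorem integrable_fn_projBubble_rpow (hl : 0 < l) :
    Integrable (fun x => H10.fn (projBubble hn hΩ a l) x ^ (critExp n + 1))
      (volume.restrict Ω) := by
  have h := integrable_rpow_critExp_mul hn (projBubble hn hΩ a l).memLp_fn
    (projBubble hn hΩ a l).memLp_fn
  refine h.congr ?_
  filter_upwards [fn_projBubble_nonneg hn hΩ a hl] with x hx
  have hp := one_lt_critExp hn
  rw [abs_of_nonneg hx, Real.rpow_add_one' hx (by linarith)]

theorem integral_fn_projBubble_rpow_le (hl : 0 < l) :
    ∫ x in Ω, H10.fn (projBubble hn hΩ a l) x ^ (critExp n + 1) ≤ bubbleMass n := by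
  have hp := one_lt_critExp hn
  have h2 := integral_compl_bubble_rpow_nonneg (Ω := Ω) (a := a) hn hl
  have h1 : ∫ x in Ω, H10.fn (projBubble hn hΩ a l) x ^ (critExp n + 1) ≤
      ∫ x in Ω, bubble a l x ^ (critExp n + 1) := by
    refine integral_mono_ae (integrable_fn_projBubble_rpow hn hΩ hl)
      (integrable_bubble_rpow hn a hl).integrableOn ?_
    filter_upwards [fn_projBubble_nonneg hn hΩ a hl, fn_projBubble_le hn hΩ a hl] with x h0 h1
    exact Real.rpow_le_rpow h0 h1 (by linarith)
  rw [integral_bubble_rpow_eq_add hn hΩ hl (a := a)]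
  linarith

/-- One tail for the mass outside Ω and p + 1 of them from δ^{p+1} − (Pδ)^{p+1} ≤ (p+1) δ^p (δ −
Pδ). -/
theorem le_integral_fn_projBubble_rpow (ha : a ∈ Ω) (hl : 0 < l) (hd : 0 < bdist Ω a) :
    bubbleMass n - (critExp n + 2) * (tailConst n * (1 / (l * bdist Ω a) ^ ((n : ℝ) - 2))) ≤
      ∫ x in Ω, H10.fn (projBubble hn hΩ a l) x ^ (critExp n + 1) := by
  have hp := one_lt_critExp hn
  have hpos := bubble_pos hn a hl
  have hi2 : Integrable (fun x => bubble a l x ^ critExp n * bubble a l x) := by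
    simp only [← fun x => Real.rpow_add_one (hpos x).ne' (critExp n)]
    exact integrable_bubble_rpow hn a hl
  have h1 := integral_bubble_rpow_mul_sub_le hn hΩ ha hl hd
  have h2 := integral_compl_bubble_rpow_le hn hΩ ha hl hd
  have h3 := bubbleTail_mul_integral_le hn a hl hd
  have h4 : (∫ x in Ω, bubble a l x ^ (critExp n + 1)) -
      ∫ x in Ω, H10.fn (projBubble hn hΩ a l) x ^ (critExp n + 1) ≤
      (critExp n + 1) * ∫ x in Ω, bubble a l x ^ critExp n *
        (bubble a l x - H10.fn (projBubble hn hΩ a l) x) := by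
    rw [← integral_sub (integrable_bubble_rpow hn a hl).integrableOn
      (integrable_fn_projBubble_rpow hn hΩ hl), ← integral_const_mul]
    refine integral_mono_ae ((integrable_bubble_rpow hn a hl).integrableOn.sub
      (integrable_fn_projBubble_rpow hn hΩ hl)) ?_ ?_
    · simp only [mul_sub (bubble a l _ ^ critExp n)]
      exact (hi2.integrableOn.sub (integrable_bubble_rpow_mul_fn hn hΩ hl _)).const_mul _
    · filter_upwards [fn_projBubble_nonneg hn hΩ a hl, fn_projBubble_le hn hΩ a hl] with x h0 h1
      have := rpow_sub_rpow_le h0 h1 (q := critExp n + 1) (by linarith)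
      rwa [add_sub_cancel_right] at this
  rw [integral_bubble_rpow_eq_add hn hΩ hl (a := a)]
  have h5 : (critExp n + 1) * ∫ x in Ω, bubble a l x ^ critExp n *
        (bubble a l x - H10.fn (projBubble hn hΩ a l) x) ≤
      (critExp n + 1) * (tailConst n * (1 / (l * bdist Ω a) ^ ((n : ℝ) - 2))) :=
    mul_le_mul_of_nonneg_left (h1.trans h3) (by linarith)
  linarith

end ProjectedBubble

/-! ### Interaction of two bubbles -/

section Interaction

variable {n : ℕ}

theorem interaction_comm (a b : Euc n) (l m : ℝ) : interaction a b l m = interaction b a m l := by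
  rw [interaction, interaction, norm_sub_rev, add_comm (l / m), mul_comm l m]

theorem interaction_pos {a b : Euc n} {l m : ℝ} (hl : 0 < l) (hm : 0 < m) :
    0 < interaction a b l m := Real.rpow_pos_of_pos (by positivity) _

theorem rpow_mul_rpow_le_add {s t p q : ℝ} (hs : 0 ≤ s) (ht : 0 ≤ t) (hp : 0 < p) (hq : 0 < q) :
    s ^ p * t ^ q ≤ s ^ (p + q) + t ^ (p + q) := by
  rcases le_total s t with h | h
  · have h1 : s ^ p * t ^ q ≤ t ^ p * t ^ q := by gcongr
    rw [← Real.rpow_add' ht (by positivity)] at h1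
    linarith [Real.rpow_nonneg hs (p + q)]
  · have h1 : s ^ p * t ^ q ≤ s ^ p * s ^ q := by gcongr
    rw [← Real.rpow_add' hs (by positivity)] at h1
    linarith [Real.rpow_nonneg ht (p + q)]

/-- Let X, Y be the two Japanese brackets and μ = m/l ≤ 1. The triangle inequality gives μ(l/m + m/l
+ lm|a−b|²) ≤ 4 max(Y, μ²X). Where Y wins, it cancels the factor of the flatter bubble. Where μ²X
wins, Y/μ² is at least the bracket at b with the larger scale l. The right side thus lives at the
single scale l, and its integral is a multiple of l^{−n}. -/
theorem rpow_mul_bubbleJap_le (hn : 3 ≤ n) (a b y : Euc n) {l m : ℝ} (hm : 0 < m) (hml : m ≤ l) :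
    (m / l * (l / m + m / l + l * m * ‖a - b‖ ^ 2)) ^ (((n : ℝ) - 2) / 2) *
      (bubbleJap a l y ^ (-((n : ℝ) / 2 + 1)) * bubbleJap b m y ^ (-(((n : ℝ) - 2) / 2))) ≤
    4 ^ (((n : ℝ) - 2) / 2) * (2 * bubbleJap a l y ^ (-((n : ℝ) / 2 + 1)) +
      bubbleJap b l y ^ (-((n : ℝ) / 2 + 1))) := by
  have hn' : (3 : ℝ) ≤ n := by exact_mod_cast hn
  have hl := hm.trans_le hml
  set k := ((n : ℝ) - 2) / 2 with hk
  have hk0 : 0 < k := by rw [hk]; linarith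
  have hnk : (n : ℝ) / 2 + 1 = 2 + k := by rw [hk]; ring
  rw [hnk]
  have hX := bubbleJap_pos a l y
  have hY := bubbleJap_pos b m y
  have hY1 := bubbleJap_pos b l y
  set X := bubbleJap a l y with hXd
  set Y := bubbleJap b m y with hYd
  set Y1 := bubbleJap b l y with hY1d
  set μ := m / l with hμ
  have hμ0 : 0 < μ := by positivity
  have hμ1 : μ ≤ 1 := (div_le_one hl).2 hml
  have hμsq : μ ^ 2 ≤ 1 := pow_le_one₀ hμ0.le hμ1
  have hmμ : m = μ * l := by rw [hμ]; field_simp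
  have hZ : μ * (l / m + μ + l * m * ‖a - b‖ ^ 2) = 1 + μ ^ 2 + m ^ 2 * ‖a - b‖ ^ 2 := by
    rw [hμ]; field_simp
  have htri : ‖a - b‖ ^ 2 ≤ 2 * (‖y - a‖ ^ 2 + ‖y - b‖ ^ 2) := by
    have h1 : ‖a - b‖ ≤ ‖y - a‖ + ‖y - b‖ := by
      rw [show a - b = (y - b) - (y - a) by abel]
      exact (norm_sub_le _ _).trans (by rw [add_comm])
    have := pow_le_pow_left₀ (norm_nonneg _) h1 2
    nlinarith [sq_nonneg (‖y - a‖ - ‖y - b‖)]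
  have hZle : μ * (l / m + μ + l * m * ‖a - b‖ ^ 2) ≤ 4 * max Y (μ ^ 2 * X) := by
    have h1 : 1 + μ ^ 2 + m ^ 2 * ‖a - b‖ ^ 2 ≤ 2 * Y + 2 * (μ ^ 2 * X) := by
      have h2 := mul_le_mul_of_nonneg_left htri (sq_nonneg m)
      have h3 : μ ^ 2 * X = μ ^ 2 + m ^ 2 * ‖y - a‖ ^ 2 := by
        rw [hXd, bubbleJap, hmμ]; ring
      rw [h3, hYd, bubbleJap]
      nlinarith
    rw [hZ]
    have := le_max_left Y (μ ^ 2 * X)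
    have := le_max_right Y (μ ^ 2 * X)
    linarith
  have hYY : μ ^ 2 * Y1 ≤ Y := by
    rw [hY1d, hYd, bubbleJap, bubbleJap, hmμ]
    nlinarith
  have hmaxk : max Y (μ ^ 2 * X) ^ k ≤ Y ^ k + (μ ^ 2 * X) ^ k := by
    rcases max_choice Y (μ ^ 2 * X) with h | h <;> rw [h]
    · linarith [Real.rpow_nonneg (by positivity : 0 ≤ μ ^ 2 * X) k]
    · linarith [Real.rpow_nonneg hY.le k]
  have hZk : (μ * (l / m + μ + l * m * ‖a - b‖ ^ 2)) ^ k ≤ 4 ^ k * (Y ^ k + (μ ^ 2 * X) ^ k) := by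
    have h1 : (μ * (l / m + μ + l * m * ‖a - b‖ ^ 2)) ^ k ≤ (4 * max Y (μ ^ 2 * X)) ^ k :=
      Real.rpow_le_rpow (by positivity) hZle hk0.le
    rw [Real.mul_rpow (by norm_num) (le_max_of_le_left hY.le)] at h1
    exact h1.trans (mul_le_mul_of_nonneg_left hmaxk (by positivity))
  have e1 : Y ^ k * Y ^ (-k) = 1 := by rw [← Real.rpow_add hY, add_neg_cancel, Real.rpow_zero]
  have e2 : (μ ^ 2 * X) ^ k * (X ^ (-(2 + k)) * Y ^ (-k)) = X ^ (-2 : ℝ) * (Y / μ ^ 2) ^ (-k) := by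
    rw [Real.mul_rpow (by positivity) hX.le, Real.div_rpow hY.le (by positivity),
      Real.rpow_neg (by positivity : 0 ≤ μ ^ 2), div_inv_eq_mul,
      show (-2 : ℝ) = k + -(2 + k) by ring, Real.rpow_add hX]
    ring
  have e3 : (Y / μ ^ 2) ^ (-k) ≤ Y1 ^ (-k) :=
    Real.rpow_le_rpow_of_nonpos hY1 (by rw [le_div_iff₀ (by positivity)]; linarith) (by linarith)
  -- The mixed product with exponents 2 and k is split into pure powers with exponent 2 + k = n/2 +
  -- 1.
  have e4 : X ^ (-2 : ℝ) * Y1 ^ (-k) ≤ X ^ (-(2 + k)) + Y1 ^ (-(2 + k)) := by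
    have := rpow_mul_rpow_le_add (inv_nonneg.2 hX.le) (inv_nonneg.2 hY1.le) two_pos hk0
    rwa [Real.inv_rpow hX.le, Real.inv_rpow hY1.le, Real.inv_rpow hX.le, Real.inv_rpow hY1.le,
      ← Real.rpow_neg hX.le, ← Real.rpow_neg hY1.le, ← Real.rpow_neg hX.le,
      ← Real.rpow_neg hY1.le] at this
  calc _ ≤ 4 ^ k * (Y ^ k + (μ ^ 2 * X) ^ k) * (X ^ (-(2 + k)) * Y ^ (-k)) :=
        mul_le_mul_of_nonneg_right hZk (by positivity)
    _ = 4 ^ k * (X ^ (-(2 + k)) * (Y ^ k * Y ^ (-k)) +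
          (μ ^ 2 * X) ^ k * (X ^ (-(2 + k)) * Y ^ (-k))) := by ring
    _ = 4 ^ k * (X ^ (-(2 + k)) + X ^ (-2 : ℝ) * (Y / μ ^ 2) ^ (-k)) := by rw [e1, e2, mul_one]
    _ ≤ 4 ^ k * (2 * X ^ (-(2 + k)) + Y1 ^ (-(2 + k))) := by
        refine mul_le_mul_of_nonneg_left ?_ (by positivity)
        have := mul_le_mul_of_nonneg_left e3 (Real.rpow_nonneg hX.le (-2))
        linarith

/-- The constant in the estimate of the interaction of two bubbles. -/
def interConst (n : ℕ) : ℝ :=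
  c₀ n ^ 2 * (n - 2) * n * 4 ^ (((n : ℝ) - 2) / 2) * 3 *
    ∫ x : Euc n, (1 + ‖x‖ ^ 2) ^ (-((n : ℝ) / 2 + 1))

theorem interConst_nonneg (hn : 3 ≤ n) : 0 ≤ interConst n := by
  have hn' : (3 : ℝ) ≤ n := by exact_mod_cast hn
  have hn2 : (0 : ℝ) < n - 2 := by linarith
  have hJ : 0 ≤ ∫ x : Euc n, (1 + ‖x‖ ^ 2) ^ (-((n : ℝ) / 2 + 1)) :=
    integral_nonneg fun x => Real.rpow_nonneg (by positivity) _
  unfold interConst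
  positivity

theorem integrable_bubble_rpow_mul_bubble (hn : 3 ≤ n) (a b : Euc n) {l m : ℝ} (hl : 0 < l)
    (hm : 0 < m) : Integrable fun y => bubble a l y ^ critExp n * bubble b m y := by
  refine (integrable_bubble_rpow_critExp hn a hl).mul_bdd
    (continuous_bubble b m).aestronglyMeasurable
    (c := c₀ n * m ^ (((n : ℝ) - 2) / 2)) (Filter.Eventually.of_forall fun y => ?_)
  rw [Real.norm_of_nonneg (bubble_pos hn b hm y).le]
  exact bubble_le hn b y hm

theorem integral_bubble_rpow_mul_bubble_le (hn : 3 ≤ n) (a b : Euc n) {l m : ℝ} (hm : 0 < m)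
    (hml : m ≤ l) :
    ∫ y, bubble a l y ^ critExp n * bubble b m y ≤ interConst n * interaction a b l m := by
  have hn' : (3 : ℝ) ≤ n := by exact_mod_cast hn
  have hn2 : (0 : ℝ) < n - 2 := by linarith
  have hl := hm.trans_le hml
  have hln := rpow_half_mul_pow n hl
  have hkey := fun y => rpow_mul_bubbleJap_le hn a b y hm hml
  set k := ((n : ℝ) - 2) / 2 with hk
  set Z := l / m + m / l + l * m * ‖a - b‖ ^ 2 with hZ
  have hZ0 : 0 < Z := by positivity
  have hint : interaction a b l m = (Z ^ k)⁻¹ := by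
    rw [interaction, ← Real.rpow_neg hZ0.le]; congr 1; rw [hk]; ring
  set J := ∫ x : Euc n, (1 + ‖x‖ ^ 2) ^ (-((n : ℝ) / 2 + 1)) with hJ
  have hs : (n : ℝ) < 2 * ((n : ℝ) / 2 + 1) := by linarith
  have hc := c₀_pos hn
  have hmk : 0 < m ^ k := Real.rpow_pos_of_pos hm _
  have hlk : 0 < l ^ k := Real.rpow_pos_of_pos hl _
  have hZk : 0 < Z ^ k := Real.rpow_pos_of_pos hZ0 _
  have hlp : 0 < l ^ n := by positivity
  set D := c₀ n ^ 2 * (n - 2) * n * (l ^ k * l ^ 2 * m ^ k) with hD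
  have hD0 : 0 ≤ D := by positivity
  -- Dividing by this factor replaces m^k by l^k in D and leaves l^n Z^{−k}; the l^n is cancelled by
  -- the integrals at scale l.
  set T := (m / l * Z) ^ k with hT
  have hTe : T = m ^ k / l ^ k * Z ^ k := by
    rw [hT, Real.mul_rpow (by positivity) hZ0.le, Real.div_rpow hm.le hl.le]
  have hT0 : 0 < T := Real.rpow_pos_of_pos (by positivity) _
  have e : ∀ y, bubble a l y ^ critExp n * bubble b m y =
      D * (bubbleJap a l y ^ (-((n : ℝ) / 2 + 1)) * bubbleJap b m y ^ (-k)) := fun y => by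
    rw [bubble_rpow_critExp hn a hl, bubble_eq, ← hk, hD, neg_add, ← sub_eq_add_neg]; ring
  have hpt : ∀ y, bubble a l y ^ critExp n * bubble b m y ≤ D / T * (4 ^ k *
      (2 * bubbleJap a l y ^ (-((n : ℝ) / 2 + 1)) + bubbleJap b l y ^ (-((n : ℝ) / 2 + 1)))) :=
    fun y => by
      rw [e, div_mul_eq_mul_div, le_div_iff₀ hT0, mul_assoc]
      refine mul_le_mul_of_nonneg_left ?_ hD0
      rw [mul_comm _ T]
      exact hkey y
  have hia := integrable_bubbleJap_rpow hs a hl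
  have hib := integrable_bubbleJap_rpow hs b hl
  calc ∫ y, bubble a l y ^ critExp n * bubble b m y
      ≤ ∫ y, D / T * (4 ^ k * (2 * bubbleJap a l y ^ (-((n : ℝ) / 2 + 1)) +
          bubbleJap b l y ^ (-((n : ℝ) / 2 + 1)))) :=
        integral_mono (integrable_bubble_rpow_mul_bubble hn a b hl hm)
          ((((hia.const_mul 2).add hib).const_mul _).const_mul _) hpt
    _ = D / T * (4 ^ k * (3 * ((l ^ n)⁻¹ * J))) := by
        rw [integral_const_mul, integral_const_mul, integral_add (hia.const_mul 2) hib,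
          integral_const_mul, integral_bubbleJap_rpow _ a hl, integral_bubbleJap_rpow _ b hl]
        ring
    _ = interConst n * interaction a b l m := by
        rw [hint, interConst, ← hk, ← hJ, hTe, ← hln, hD]
        field_simp

variable {hn : 3 ≤ n} {Ω : Set (Euc n)} {hΩ : IsSmoothBoundedDomain Ω}

theorem inner_projBubble_nonneg (a b : Euc n) {l m : ℝ} (hl : 0 < l) (hm : 0 < m) :
    0 ≤ ⟪projBubble hn hΩ a l, projBubble hn hΩ b m⟫_ℝ := by
  rw [inner_projBubble_eq_integral a hl]
  refine integral_nonneg_of_ae ?_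
  filter_upwards [fn_projBubble_nonneg hn hΩ b hm] with x hx
  exact mul_nonneg (Real.rpow_nonneg (bubble_pos hn a hl x).le _) hx

/-- The scalar product is symmetric, so the equation can be used for the more concentrated bubble,
which then carries the power p. -/
theorem inner_projBubble_le (a b : Euc n) {l m : ℝ} (hl : 0 < l) (hm : 0 < m) :
    ⟪projBubble hn hΩ a l, projBubble hn hΩ b m⟫_ℝ ≤ interConst n * interaction a b l m := by
  have key : ∀ (a b : Euc n) {l m : ℝ}, 0 < m → m ≤ l →
      ⟪projBubble hn hΩ a l, projBubble hn hΩ b m⟫_ℝ ≤ interConst n * interaction a b l m := by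
    intro a b l m hm hml
    have hl := hm.trans_le hml
    have hi := integrable_bubble_rpow_mul_bubble hn a b hl hm
    refine le_trans ?_ (integral_bubble_rpow_mul_bubble_le hn a b hm hml)
    rw [inner_projBubble_eq_integral a hl]
    refine le_trans (integral_mono_ae (integrable_bubble_rpow_mul_fn hn hΩ hl _)
      hi.integrableOn ?_) (setIntegral_le_integral hi (Filter.Eventually.of_forall fun y =>
        mul_nonneg (Real.rpow_nonneg (bubble_pos hn a hl y).le _) (bubble_pos hn b hm y).le))
    filter_upwards [fn_projBubble_le hn hΩ b hm] with x hx
    exact mul_le_mul_of_nonneg_left hx (Real.rpow_nonneg (bubble_pos hn a hl x).le _)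
  rcases le_total m l with h | h
  · exact key a b hm h
  · rw [real_inner_comm, interaction_comm]
    exact key b a hl h

theorem integrable_fn_projBubble_rpow_mul (a : Euc n) {l : ℝ} (hl : 0 < l) (v : H10 hn hΩ) :
    Integrable (fun x => H10.fn (projBubble hn hΩ a l) x ^ critExp n * H10.fn v x)
      (volume.restrict Ω) := by
  have hp := one_lt_critExp hn
  have hm : AEStronglyMeasurable (fun x => H10.fn (projBubble hn hΩ a l) x ^ critExp n)
      (volume.restrict Ω) :=
    (Real.continuous_rpow_const (by linarith)).comp_aestronglyMeasurable (H10.memLp_fn _).1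
  refine (integrable_rpow_critExp_mul hn (H10.memLp_fn (projBubble hn hΩ a l))
    v.memLp_fn).mono (hm.mul v.memLp_fn.1) ?_
  filter_upwards [fn_projBubble_nonneg hn hΩ a hl] with x hx
  rw [norm_mul, norm_mul, abs_of_nonneg hx, norm_abs_eq_norm]

/-- As Pδ ≤ δ, the integral is at most ⟨Pδ, Pδ'⟩; no order between l and m is needed. -/
theorem integral_fn_projBubble_rpow_mul_le (a b : Euc n) {l m : ℝ} (hl : 0 < l) (hm : 0 < m) :
    ∫ x in Ω, H10.fn (projBubble hn hΩ a l) x ^ critExp n * H10.fn (projBubble hn hΩ b m) x ≤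
      interConst n * interaction a b l m := by
  have hp := one_lt_critExp hn
  refine le_trans ?_ (inner_projBubble_le (hn := hn) (hΩ := hΩ) a b hl hm)
  rw [inner_projBubble_eq_integral a hl]
  refine integral_mono_ae (integrable_fn_projBubble_rpow_mul a hl _)
    (integrable_bubble_rpow_mul_fn hn hΩ hl _) ?_
  filter_upwards [fn_projBubble_nonneg hn hΩ a hl, fn_projBubble_le hn hΩ a hl,
    fn_projBubble_nonneg hn hΩ b hm] with x h0 h1 h2
  exact mul_le_mul_of_nonneg_right (Real.rpow_le_rpow h0 h1 (by linarith)) h2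

end Interaction

/-! ### Expansion of the nonlinear term -/

section Expansion

open Filter Topology

variable {n : ℕ} {hn : 3 ≤ n} {Ω : Set (Euc n)} {hΩ : IsSmoothBoundedDomain Ω}

/-- The constant in the estimate of `ln (ln (e + 2δ))`. -/
def logConst (n : ℕ) : ℝ :=
  Real.log (Real.log (Real.exp 1 + 2 * c₀ n) + ((n : ℝ) - 2) / 2) + 1

theorem one_le_log_add (hn : 3 ≤ n) :
    1 ≤ Real.log (Real.exp 1 + 2 * c₀ n) + ((n : ℝ) - 2) / 2 := by
  have hn' : (3 : ℝ) ≤ n := by exact_mod_cast hn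
  have := one_le_log_exp_one_add (s := 2 * c₀ n) (mul_pos two_pos (c₀_pos hn)).le
  linarith

theorem logConst_pos (hn : 3 ≤ n) : 0 < logConst n :=
  add_pos_of_nonneg_of_pos (Real.log_nonneg (one_le_log_add hn)) one_pos

/-- With B = ln(e+2c₀) + (n−2)/2 one has ln(e+t) ≤ B ln λ, because ln λ ≥ 1, and then ln B + ln ln λ
≤ (ln B + 1) ln ln λ, because ln ln λ ≥ 1. Both use λ ≥ e^e. -/
theorem log_log_le (hn : 3 ≤ n) {l t : ℝ} (hl : Real.exp (Real.exp 1) ≤ l) (ht : 0 ≤ t)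
    (htl : t ≤ 2 * (c₀ n * l ^ (((n : ℝ) - 2) / 2))) :
    Real.log (Real.log (Real.exp 1 + t)) ≤ logConst n * Real.log (Real.log l) := by
  have hn' : (3 : ℝ) ≤ n := by exact_mod_cast hn
  have hB := one_le_log_add hn
  have hL1 := one_le_log_exp_one_add (s := 2 * c₀ n) (mul_pos two_pos (c₀_pos hn)).le
  have hc := c₀_pos hn
  rw [logConst]
  set k := ((n : ℝ) - 2) / 2 with hk
  have hk0 : 0 < k := by rw [hk]; linarith
  have he : 1 ≤ Real.exp 1 := Real.one_le_exp zero_le_one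
  have hl0 : 0 < l := (Real.exp_pos _).trans_le hl
  have hl1 : 1 ≤ l := (Real.one_le_exp (Real.exp_pos 1).le).trans hl
  have hll : Real.exp 1 ≤ Real.log l := (Real.le_log_iff_exp_le hl0).2 hl
  have hll0 : 0 < Real.log l := (Real.exp_pos 1).trans_le hll
  have hlll : 1 ≤ Real.log (Real.log l) := (Real.le_log_iff_exp_le hll0).2 hll
  have hlk : 1 ≤ l ^ k := Real.one_le_rpow hl1 hk0.le
  set B := Real.log (Real.exp 1 + 2 * c₀ n) + k with hBd
  have h1 : Real.exp 1 + t ≤ (Real.exp 1 + 2 * c₀ n) * l ^ k := by nlinarith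
  have h2 : Real.log (Real.exp 1 + t) ≤ B * Real.log l := by
    have := Real.log_le_log (by positivity) h1
    rw [Real.log_mul (by positivity) (by positivity), Real.log_rpow hl0] at this
    rw [hBd]
    nlinarith
  have h3 := Real.log_le_log (by linarith [one_le_log_exp_one_add ht]) h2
  rw [Real.log_mul (by linarith) hll0.ne'] at h3
  have h4 := Real.log_nonneg hB
  nlinarith

theorem one_sub_rpow_neg_le {x ε : ℝ} (hx : 0 < x) : 1 - x ^ (-ε) ≤ ε * Real.log x := by
  rw [Real.rpow_def_of_pos hx]
  have := Real.add_one_le_exp (Real.log x * -ε)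
  linarith

/-- The Lipschitz bound leaves (P+q)^{p−1} q P with q = ∑ Q_j. The larger of P and q absorbs the
power, giving P^p q + q^p P, and the power mean inequality distributes q^p over the Q_j. Each
resulting term integrates to an interaction. -/
theorem abs_nonlin_sub_mul_le (hn : 3 ≤ n) {ι : Type*} (t : Finset ι) {ε s R P c : ℝ} {Q : ι → ℝ}
    (hε : 0 ≤ ε) (hP : 0 ≤ P) (hQ : ∀ j ∈ t, 0 ≤ Q j) (hs : |s| ≤ 2 * P)
    (hR : |R| ≤ 2 * ∑ j ∈ t, Q j) (hc : 1 ≤ c) (htc : (t.card : ℝ) ≤ c) :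
    |(nonlin n ε (s + R) - nonlin n ε s) * P| ≤
      critExp n * 2 * 4 ^ (critExp n - 1) * c ^ (critExp n - 1) *
        ∑ j ∈ t, (P ^ critExp n * Q j + Q j ^ critExp n * P) := by
  have hp := one_lt_critExp hn
  set p := critExp n
  set q := ∑ j ∈ t, Q j with hq
  have hq0 : 0 ≤ q := Finset.sum_nonneg hQ
  have h1 := abs_nonlin_sub_le hn hε (s := s + R) (t := s) (r := 2 * (P + q))
    ((abs_add_le s R).trans (by linarith)) (by linarith)
  rw [add_sub_cancel_left] at h1
  have hmul : ∀ x : ℝ, 0 ≤ x → x ^ (p - 1) * x = x ^ p := fun x hx => by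
    rw [← Real.rpow_add_one' hx (by linarith), sub_add_cancel]
  have h2 : (2 * (P + q)) ^ (p - 1) * (q * P) ≤
      4 ^ (p - 1) * (P ^ p * q + q ^ p * P) := by
    rcases le_total q P with h | h
    · have h3 : (2 * (P + q)) ^ (p - 1) ≤ (4 * P) ^ (p - 1) :=
        Real.rpow_le_rpow (by positivity) (by linarith) (by linarith)
      rw [Real.mul_rpow (by norm_num) hP] at h3
      calc _ ≤ 4 ^ (p - 1) * P ^ (p - 1) * (q * P) := by gcongr
        _ = 4 ^ (p - 1) * (P ^ (p - 1) * P * q) := by ring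
        _ ≤ _ := by
          rw [hmul P hP]
          exact mul_le_mul_of_nonneg_left (le_add_of_nonneg_right (by positivity)) (by positivity)
    · have h3 : (2 * (P + q)) ^ (p - 1) ≤ (4 * q) ^ (p - 1) :=
        Real.rpow_le_rpow (by positivity) (by linarith) (by linarith)
      rw [Real.mul_rpow (by norm_num) hq0] at h3
      calc _ ≤ 4 ^ (p - 1) * q ^ (p - 1) * (q * P) := by gcongr
        _ = 4 ^ (p - 1) * (q ^ (p - 1) * q * P) := by ring
        _ ≤ _ := by
          rw [hmul q hq0]
          exact mul_le_mul_of_nonneg_left (le_add_of_nonneg_left (by positivity)) (by positivity)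
  have hc1 : 1 ≤ c ^ (p - 1) := Real.one_le_rpow hc (by linarith)
  have hsum0 : 0 ≤ ∑ j ∈ t, Q j ^ p :=
    Finset.sum_nonneg fun j hj => Real.rpow_nonneg (hQ j hj) _
  have h3 : q ^ p ≤ c ^ (p - 1) * ∑ j ∈ t, Q j ^ p :=
    (Real.rpow_sum_le_const_mul_sum_rpow_of_nonneg t hp.le hQ).trans
      (mul_le_mul_of_nonneg_right (Real.rpow_le_rpow (by positivity) htc (by linarith)) hsum0)
  have h4 : P ^ p * q + q ^ p * P ≤ c ^ (p - 1) * ∑ j ∈ t, (P ^ p * Q j + Q j ^ p * P) := by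
    rw [Finset.sum_add_distrib, ← Finset.mul_sum, ← Finset.sum_mul, ← hq]
    have h5 : P ^ p * q ≤ c ^ (p - 1) * (P ^ p * q) :=
      le_mul_of_one_le_left (by positivity) hc1
    have h6 := mul_le_mul_of_nonneg_right h3 hP
    linarith
  rw [abs_mul, abs_of_nonneg hP]
  calc |nonlin n ε (s + R) - nonlin n ε s| * P
      ≤ p * (2 * (P + q)) ^ (p - 1) * (2 * q) * P := by
        refine mul_le_mul_of_nonneg_right (h1.trans ?_) hP
        exact mul_le_mul_of_nonneg_left hR (by positivity)
    _ = p * 2 * ((2 * (P + q)) ^ (p - 1) * (q * P)) := by ring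
    _ ≤ p * 2 * (4 ^ (p - 1) * (c ^ (p - 1) * ∑ j ∈ t, (P ^ p * Q j + Q j ^ p * P))) := by
        refine mul_le_mul_of_nonneg_left (h2.trans ?_) (by positivity)
        exact mul_le_mul_of_nonneg_left h4 (by positivity)
    _ = _ := by ring

/-- Replacing `S + v` by `S` in the nonlinear term costs `O(‖v‖)`. -/
theorem abs_integral_nonlin_add_sub_le {ε : ℝ} (hε : 0 ≤ ε) (S v w T : H10 hn hΩ)
    (hS : ∀ᵐ x ∂volume.restrict Ω, |H10.fn S x| ≤ H10.fn T x)
    (hw : ∀ᵐ x ∂volume.restrict Ω, |H10.fn w x| ≤ H10.fn T x) :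
    |(∫ x in Ω, nonlin n ε (H10.fn (S + v) x) * H10.fn w x) -
        ∫ x in Ω, nonlin n ε (H10.fn S x) * H10.fn w x| ≤
      critExp n * (embConst n * (‖T‖ + ‖v‖)) ^ critExp n * embConst n * ‖v‖ := by
  have hp := one_lt_critExp hn
  have hK := embConst_pos hn
  set f := fun x => |H10.fn T x| + |H10.fn v x| with hf
  have hfm : MemLp f (sobExp n) (volume.restrict Ω) := T.memLp_fn.norm.add v.memLp_fn.norm
  have hfn : (eLpNorm f (sobExp n) (volume.restrict Ω)).toReal ≤ embConst n * (‖T‖ + ‖v‖) := by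
    have h1 := eLpNorm_add_le (μ := volume.restrict Ω) T.memLp_fn.norm.1 v.memLp_fn.norm.1
      (one_le_sobExp hn)
    rw [eLpNorm_norm, eLpNorm_norm] at h1
    have h2 := ENNReal.toReal_mono (ENNReal.add_ne_top.2 ⟨T.memLp_fn.2.ne, v.memLp_fn.2.ne⟩) h1
    rw [ENNReal.toReal_add T.memLp_fn.2.ne v.memLp_fn.2.ne] at h2
    have h3 := T.toReal_eLpNorm_fn_le
    have h4 := v.toReal_eLpNorm_fn_le
    rw [mul_add]
    exact h2.trans (by linarith)
  have hint := integrable_rpow_critExp_mul hn hfm v.memLp_fn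
  have hle := integral_rpow_critExp_mul_le hn hfm v.memLp_fn
  have hi1 := integrable_nonlin_mul hε (S + v) w
  have hi2 := integrable_nonlin_mul hε S w
  rw [← integral_sub hi1 hi2]
  refine abs_integral_le_integral_abs.trans ((integral_mono_ae (hi1.sub hi2).abs
    (hint.const_mul (critExp n)) ?_).trans ?_)
  · filter_upwards [H10.fn_add S v, hS, hw] with x hx h1 h2
    rw [Pi.sub_apply, hx]
    have hT := (abs_nonneg _).trans h1
    have hfx : f x = H10.fn T x + |H10.fn v x| := by rw [hf]; simp only [abs_of_nonneg hT]
    have hf0 : 0 ≤ f x := by rw [hfx]; positivity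
    have h3 := abs_nonlin_sub_le hn hε (s := H10.fn S x + H10.fn v x) (t := H10.fn S x)
      (r := f x) ((abs_add_le _ _).trans (by rw [hfx]; linarith))
      (by rw [hfx]; linarith [abs_nonneg (H10.fn v x)])
    rw [add_sub_cancel_left] at h3
    rw [← sub_mul, abs_mul, abs_of_nonneg hf0]
    have h4 : |H10.fn w x| ≤ f x := by rw [hfx]; linarith [abs_nonneg (H10.fn v x)]
    calc _ ≤ critExp n * f x ^ (critExp n - 1) * |H10.fn v x| * f x := by gcongr
      _ = critExp n * (f x ^ (critExp n - 1) * f x * |H10.fn v x|) := by ring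
      _ = _ := by rw [← Real.rpow_add_one' hf0 (by linarith), sub_add_cancel]
  · rw [integral_const_mul]
    have := v.toReal_eLpNorm_fn_le
    have h0 : 0 ≤ (embConst n * (‖T‖ + ‖v‖)) ^ critExp n := by positivity
    calc _ ≤ critExp n * ((embConst n * (‖T‖ + ‖v‖)) ^ critExp n * (embConst n * ‖v‖)) := by
          refine mul_le_mul_of_nonneg_left (hle.trans ?_) (by linarith)
          gcongr
      _ = _ := by ring

/-- The nonlinear term at a multiple of a single projected bubble. -/
theorem abs_integral_nonlin_projBubble_sub_le (hn : 3 ≤ n) (hΩ : IsSmoothBoundedDomain Ω)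
    {ε α l : ℝ} {a : Euc n} (hε : 0 ≤ ε) (ha : a ∈ Ω) (hd : 0 < bdist Ω a)
    (hl : Real.exp (Real.exp 1) ≤ l) (hα : 0 < α) (hα2 : α ≤ 2) :
    |(∫ x in Ω, nonlin n ε (α * H10.fn (projBubble hn hΩ a l) x) *
        H10.fn (projBubble hn hΩ a l) x) - α ^ critExp n * bubbleMass n| ≤
      2 ^ critExp n * ((critExp n + 2) * (tailConst n * (1 / (l * bdist Ω a) ^ ((n : ℝ) - 2))) +
        bubbleMass n * (logConst n * (ε * Real.log (Real.log l)))) := by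
  have hp := one_lt_critExp hn
  have hl0 : 0 < l := (Real.exp_pos _).trans_le hl
  set P := H10.fn (projBubble hn hΩ a l) with hP
  have hiP : Integrable (fun x => P x ^ (critExp n + 1)) (volume.restrict Ω) :=
    integrable_fn_projBubble_rpow hn hΩ hl0
  have hup := integral_fn_projBubble_rpow_le hn hΩ hl0 (a := a)
  have hlow := le_integral_fn_projBubble_rpow hn hΩ ha hl0 hd
  rw [← hP] at hup hlow
  -- The relative loss caused by the logarithmic factor: that factor lies between 1 − B and 1
  -- pointwise.
  set B := ε * (logConst n * Real.log (Real.log l)) with hB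
  have hll : Real.exp 1 ≤ Real.log l := (Real.le_log_iff_exp_le hl0).2 hl
  have hlll : 1 ≤ Real.log (Real.log l) :=
    (Real.le_log_iff_exp_le ((Real.exp_pos 1).trans_le hll)).2 hll
  have hB0 : 0 ≤ B := mul_nonneg hε (mul_nonneg (logConst_pos hn).le (by linarith))
  have hpt : ∀ᵐ x ∂volume.restrict Ω, nonlin n ε (α * P x) * P x ≤
      α ^ critExp n * P x ^ (critExp n + 1) ∧
      α ^ critExp n * ((1 - B) * P x ^ (critExp n + 1)) ≤ nonlin n ε (α * P x) * P x := by
    filter_upwards [fn_projBubble_nonneg hn hΩ a hl0, fn_projBubble_le hn hΩ a hl0] with x h0 h1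
    rw [← hP] at h0 h1
    have hαP : 0 ≤ α * P x := by positivity
    have hL := one_le_log_exp_one_add hαP
    have hle : α * P x ≤ 2 * (c₀ n * l ^ (((n : ℝ) - 2) / 2)) := by
      have := bubble_le hn a x hl0
      have := mul_le_mul hα2 (h1.trans this) h0 zero_le_two
      exact this
    have e : nonlin n ε (α * P x) * P x = α ^ critExp n * (P x ^ (critExp n + 1) *
        Real.log (Real.exp 1 + α * P x) ^ (-ε)) := by
      rw [nonlin_of_nonneg hn ε hαP, Real.mul_rpow hα.le h0, Real.rpow_add_one' h0 (by linarith)]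
      ring
    have hPp : 0 ≤ P x ^ (critExp n + 1) := Real.rpow_nonneg h0 _
    have hαp : 0 ≤ α ^ critExp n := Real.rpow_nonneg hα.le _
    rw [e]
    refine ⟨mul_le_mul_of_nonneg_left (mul_le_of_le_one_right hPp
      (Real.rpow_le_one_of_one_le_of_nonpos hL (neg_nonpos.2 hε))) hαp,
      mul_le_mul_of_nonneg_left ?_ hαp⟩
    rw [mul_comm]
    refine mul_le_mul_of_nonneg_left ?_ hPp
    have h2 := one_sub_rpow_neg_le (x := Real.log (Real.exp 1 + α * P x)) (ε := ε) (by linarith)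
    have h3 := mul_le_mul_of_nonneg_left (log_log_le hn hl hαP hle) hε
    linarith
  have hi : Integrable (fun x => nonlin n ε (α * P x) * P x) (volume.restrict Ω) := by
    have h := integrable_nonlin_mul hε (α • projBubble hn hΩ a l) (projBubble hn hΩ a l)
    refine h.congr ?_
    filter_upwards [H10.fn_smul α (projBubble hn hΩ a l)] with x hx
    rw [hx]
  have h1 : ∫ x in Ω, nonlin n ε (α * P x) * P x ≤
      α ^ critExp n * ∫ x in Ω, P x ^ (critExp n + 1) := by
    rw [← integral_const_mul]
    exact integral_mono_ae hi (hiP.const_mul _) (hpt.mono fun x hx => hx.1)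
  have h2 : α ^ critExp n * ((1 - B) * ∫ x in Ω, P x ^ (critExp n + 1)) ≤
      ∫ x in Ω, nonlin n ε (α * P x) * P x := by
    rw [← integral_const_mul, ← integral_const_mul]
    exact integral_mono_ae ((hiP.const_mul _).const_mul _) hi (hpt.mono fun x hx => hx.2)
  have hA : 0 ≤ ∫ x in Ω, P x ^ (critExp n + 1) := by
    refine integral_nonneg_of_ae ?_
    filter_upwards [fn_projBubble_nonneg hn hΩ a hl0] with x h0
    exact Real.rpow_nonneg h0 _
  set I := ∫ x in Ω, P x ^ (critExp n + 1)
  set E := (critExp n + 2) * (tailConst n * (1 / (l * bdist Ω a) ^ ((n : ℝ) - 2))) with hE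
  have hE0 : 0 ≤ E := by linarith
  have hαp : 0 < α ^ critExp n := Real.rpow_pos_of_pos hα _
  have hα2p : α ^ critExp n ≤ 2 ^ critExp n := Real.rpow_le_rpow hα.le hα2 (by linarith)
  have hBe : bubbleMass n * (logConst n * (ε * Real.log (Real.log l))) = bubbleMass n * B := by
    rw [hB]; ring
  rw [hBe]
  have hM : 0 ≤ bubbleMass n * B := mul_nonneg (hA.trans hup) hB0
  have hIB : B * I ≤ bubbleMass n * B := by
    rw [mul_comm]; exact mul_le_mul_of_nonneg_right hup hB0
  refine le_trans ?_ (mul_le_mul_of_nonneg_right hα2p (by positivity))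
  rw [abs_le]
  constructor
  · have : α ^ critExp n * (bubbleMass n - E - bubbleMass n * B) ≤
        α ^ critExp n * ((1 - B) * I) := mul_le_mul_of_nonneg_left (by linarith) hαp.le
    linarith
  · have h3 := mul_le_mul_of_nonneg_left hup hαp.le
    have h4 : 0 ≤ α ^ critExp n * (E + bubbleMass n * B) := by positivity
    linarith

theorem H10.fn_sum_smul {ι : Type*} (t : Finset ι) (c : ι → ℝ) (w : ι → H10 hn hΩ) :
    H10.fn (∑ j ∈ t, c j • w j) =ᵐ[volume.restrict Ω] fun x => ∑ j ∈ t, c j * H10.fn (w j) x := by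
  classical
  induction t using Finset.induction_on with
  | empty =>
    simp only [Finset.sum_empty, map_zero]
    exact Lp.coeFn_zero _ _ _
  | insert j t hj ih =>
    rw [Finset.sum_insert hj]
    filter_upwards [H10.fn_add (c j • w j) (∑ j ∈ t, c j • w j), H10.fn_smul (c j) (w j), ih]
      with x h1 h2 h3
    rw [h1, h2, h3, Finset.sum_insert hj]

theorem nonlin_sign_mul {g : ℝ} (hg : g = 1 ∨ g = -1) (ε s : ℝ) :
    nonlin n ε (g * s) = g * nonlin n ε s := by
  rcases hg with rfl | rfl
  · simp
  · rw [neg_one_mul, neg_one_mul, nonlin_neg]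

theorem abs_sum_sign_mul_le {ι : Type*} (t : Finset ι) {α γ y : ι → ℝ} (hα : ∀ j, |α j| ≤ 2)
    (hγ : ∀ j, |γ j| = 1) (hy : ∀ j, 0 ≤ y j) :
    |∑ j ∈ t, α j * γ j * y j| ≤ 2 * ∑ j ∈ t, y j := by
  rw [Finset.mul_sum]
  refine (Finset.abs_sum_le_sum_abs _ _).trans (Finset.sum_le_sum fun j _ => ?_)
  rw [abs_mul, abs_mul, hγ, mul_one, abs_of_nonneg (hy j)]
  exact mul_le_mul_of_nonneg_right (hα j) (hy j)

/-- Replacing a sum of projected bubbles by one of them in the nonlinear term, tested against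
that bubble. -/
theorem abs_integral_nonlin_sum_sub_le {m : ℕ} {ε : ℝ} (hε : 0 ≤ ε) {α γ l : Fin m → ℝ}
    {a : Fin m → Euc n} (hl : ∀ j, 0 < l j) (hα : ∀ j, |α j| ≤ 2) (hγ : ∀ j, |γ j| = 1)
    (i : Fin m) :
    |(∫ x in Ω, nonlin n ε (H10.fn (∑ j, (α j * γ j) • projBubble hn hΩ (a j) (l j)) x) *
        H10.fn (projBubble hn hΩ (a i) (l i)) x) -
      ∫ x in Ω, nonlin n ε (H10.fn ((α i * γ i) • projBubble hn hΩ (a i) (l i)) x) *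
        H10.fn (projBubble hn hΩ (a i) (l i)) x| ≤
      critExp n * 2 * 4 ^ (critExp n - 1) * (m : ℝ) ^ (critExp n - 1) * (2 * interConst n) *
        ∑ j ∈ Finset.univ.erase i, interaction (a i) (a j) (l i) (l j) := by
  have hp := one_lt_critExp hn
  set P : Fin m → H10 hn hΩ := fun j => projBubble hn hΩ (a j) (l j) with hP
  set D := critExp n * 2 * 4 ^ (critExp n - 1) * (m : ℝ) ^ (critExp n - 1) with hD
  have hD0 : 0 ≤ D := by positivity
  have hm : (1 : ℝ) ≤ m := by exact_mod_cast (Fin.pos i)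
  have hi1 := integrable_nonlin_mul hε (∑ j, (α j * γ j) • P j) (P i)
  have hi2 := integrable_nonlin_mul hε ((α i * γ i) • P i) (P i)
  have hi3 : ∀ j, Integrable (fun x => H10.fn (P i) x ^ critExp n * H10.fn (P j) x)
      (volume.restrict Ω) := fun j => integrable_fn_projBubble_rpow_mul (a i) (hl i) _
  have hi4 : ∀ j, Integrable (fun x => H10.fn (P j) x ^ critExp n * H10.fn (P i) x)
      (volume.restrict Ω) := fun j => integrable_fn_projBubble_rpow_mul (a j) (hl j) _
  rw [← integral_sub hi1 hi2]
  refine abs_integral_le_integral_abs.trans ((integral_mono_ae (hi1.sub hi2).abs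
    ((integrable_finsetSum (Finset.univ.erase i) fun j _ =>
      (hi3 j).add (hi4 j)).const_mul D) ?_).trans ?_)
  · have hnn : ∀ᵐ x ∂volume.restrict Ω, ∀ j, 0 ≤ H10.fn (P j) x :=
      ae_all_iff.2 fun j => fn_projBubble_nonneg hn hΩ (a j) (hl j)
    filter_upwards [hnn, H10.fn_sum_smul Finset.univ (fun j => α j * γ j) P,
      H10.fn_smul (α i * γ i) (P i)] with x h0 h1 h2
    rw [Pi.sub_apply, h1, h2, ← sub_mul, ← Finset.add_sum_erase _ _ (Finset.mem_univ i)]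
    refine abs_nonlin_sub_mul_le hn (Finset.univ.erase i) (Q := fun j => H10.fn (P j) x) hε (h0 i)
      (fun j _ => h0 j) ?_ (abs_sum_sign_mul_le _ hα hγ h0) hm ?_
    · rw [abs_mul, abs_mul, hγ, mul_one, abs_of_nonneg (h0 i)]
      exact mul_le_mul_of_nonneg_right (hα i) (h0 i)
    · exact_mod_cast (Finset.card_le_univ _).trans (by simp)
  · rw [integral_const_mul, integral_finsetSum _ fun j _ => (hi3 j).add (hi4 j), mul_assoc D]
    refine mul_le_mul_of_nonneg_left ((Finset.sum_le_sum fun j _ => ?_).trans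
      (Finset.mul_sum _ _ _).ge) hD0
    simp only [Pi.add_apply]
    rw [integral_add (hi3 j) (hi4 j)]
    have h1 := integral_fn_projBubble_rpow_mul_le (hn := hn) (hΩ := hΩ) (a i) (a j) (hl i) (hl j)
    have h2 := integral_fn_projBubble_rpow_mul_le (hn := hn) (hΩ := hΩ) (a j) (a i) (hl j) (hl i)
    rw [interaction_comm (a j)] at h2
    linarith

theorem norm_projBubble_le (a : Euc n) {l : ℝ} (hl : 0 < l) :
    ‖projBubble hn hΩ a l‖ ≤ Real.sqrt (bubbleMass n) :=
  Real.le_sqrt_of_sq_le (norm_sq_projBubble_le hn hΩ hl)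

end Expansion

end CriticalBubbles

end

/-! ### The expansion of the gradient along Pδ_i -/

open CriticalBubbles
theorem proposition2 {n : ℕ} (hn : 3 ≤ n) {Ω : Set (Euc n)} (hΩ : IsSmoothBoundedDomain Ω)
    (m : ℕ) (γ : Fin m → ℝ) (hγ : ∀ j, γ j = 1 ∨ γ j = -1) :
    ∃ η₀ > 0, ∃ C > 0, ∀ η : ℝ, 0 < η → η ≤ η₀ → ∀ ε : ℝ, 0 < ε →
      ∀ (u : H10 hn hΩ) (α l : Fin m → ℝ) (a : Fin m → Euc n) (v : H10 hn hΩ),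
        IsVRepresentation γ η u α l a v →
        DifferentiableAt ℝ (energy (hn := hn) (hΩ := hΩ) ε) u ∧
        ∀ i : Fin m,
          |⟪∇ (energy (hn := hn) (hΩ := hΩ) ε) u, projBubble hn hΩ (a i) (l i)⟫_ℝ
              - γ i * α i * (1 - α i ^ (critExp n - 1)) * sobolevConst n ^ ((n : ℝ) / 2)|
            ≤ C * (ε * Real.log (Real.log (l i))
                + ∑ j, 1 / (l j * bdist Ω (a j)) ^ ((n : ℝ) - 2)
                + ∑ j ∈ Finset.univ.erase i, interaction (a i) (a j) (l i) (l j)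
                + ‖v‖) := by
  have hp := one_lt_critExp hn
  have hK := embConst_pos hn
  have hT0 := tailConst_nonneg hn
  have hI0 := interConst_nonneg hn
  have hL0 := logConst_pos hn
  have hA0 : 0 ≤ bubbleMass n := (sq_nonneg _).trans (norm_sq_projBubble_le hn hΩ (a := 0) one_pos)
  set p := critExp n with hpd
  set A := bubbleMass n with hA
  -- Bounds the norm of T = ∑ 2Pδ_j, the common pointwise majorant of |∑ α_j γ_j Pδ_j| and Pδ_i.
  set N := 2 * (m * Real.sqrt A) with hN
  have hN0 : 0 ≤ N := by positivity
  -- C₁, …, C₄ collect the coefficients of (λ_i d_i)^{2−n}, of ∑ ε_ij, of ‖v‖ and of ε ln ln λ_i.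
  set C₁ := 4 * tailConst n + 2 ^ p * ((p + 2) * tailConst n) with hC₁
  set C₂ := 2 * interConst n + p * 2 * 4 ^ (p - 1) * (m : ℝ) ^ (p - 1) * (2 * interConst n) with hC₂
  set C₃ := Real.sqrt A + p * (embConst n * (N + 1)) ^ p * embConst n with hC₃
  set C₄ := 2 ^ p * (A * logConst n) with hC₄
  have hC₁0 : 0 ≤ C₁ := by positivity
  have hC₂0 : 0 ≤ C₂ := by positivity
  have hC₃0 : 0 ≤ C₃ := by positivity
  have hC₄0 : 0 ≤ C₄ := by positivity
  -- The bound 1/2 gives α_j ≤ 2 and ‖v‖ ≤ 1; the bound e^{−e} gives λ_j ≥ e^e, as the iterated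
  -- logarithm requires. The summand 1 only keeps the constant positive.
  refine ⟨min (1 / 2) (Real.exp (-Real.exp 1)), lt_min (by norm_num) (Real.exp_pos _),
    C₁ + C₂ + C₃ + C₄ + 1, by positivity, fun η hη hη₀ ε hε u α l a v hu =>
      ⟨(hasFDerivAt_energy hε.le u).differentiableAt, fun i => ?_⟩⟩
  have hη1 : η ≤ 1 / 2 := hη₀.trans (min_le_left _ _)
  have hη2 : η ≤ Real.exp (-Real.exp 1) := hη₀.trans (min_le_right _ _)
  have hle : ∀ j, Real.exp (Real.exp 1) ≤ l j := fun j => by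
    refine le_trans ?_ (hu.conc j).le
    rw [← inv_inv (Real.exp (Real.exp 1)), ← Real.exp_neg]
    exact inv_anti₀ hη hη2
  have hl : ∀ j, 0 < l j := fun j => (Real.exp_pos _).trans_le (hle j)
  have hd : ∀ j, 0 < bdist Ω (a j) := fun j =>
    pos_of_mul_pos_right ((inv_pos.2 hη).trans (hu.dist j)) (hl j).le
  have hα2 : ∀ j, α j ≤ 2 := fun j => by
    have := (abs_lt.1 (hu.coeff j)).2
    linarith
  have hαa : ∀ j, |α j| ≤ 2 := fun j => by rw [abs_of_pos (hu.coeff_pos j)]; exact hα2 j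
  have hγa : ∀ j, |γ j| = 1 := fun j => by rcases hγ j with h | h <;> simp [h]
  have hv : ‖v‖ ≤ 1 := by linarith [hu.norm_lt]
  set P : Fin m → H10 hn hΩ := fun j => projBubble hn hΩ (a j) (l j) with hP
  set S := ∑ j, (α j * γ j) • P j with hS
  have huS : u = S + v := hu.eq_add
  set T := ∑ j, (2 : ℝ) • P j with hTd
  have hPn : ∀ j, ‖P j‖ ≤ Real.sqrt A := fun j => norm_projBubble_le (a j) (hl j)
  have hTn : ‖T‖ ≤ N := by
    refine (norm_sum_le _ _).trans ((Finset.sum_le_sum (g := fun _ => 2 * Real.sqrt A)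
      fun j _ => ?_).trans (le_of_eq ?_))
    · rw [norm_smul, Real.norm_of_nonneg zero_le_two]
      exact mul_le_mul_of_nonneg_left (hPn j) zero_le_two
    · simp [hN]; ring
  have hnn : ∀ᵐ x ∂volume.restrict Ω, ∀ j, 0 ≤ H10.fn (P j) x :=
    ae_all_iff.2 fun j => fn_projBubble_nonneg hn hΩ (a j) (hl j)
  -- the remainder `v`
  have t4 := abs_integral_nonlin_add_sub_le hε.le S v (P i) T (by
    filter_upwards [hnn, H10.fn_sum_smul Finset.univ (fun j => α j * γ j) P,
      H10.fn_sum_smul Finset.univ (fun _ => (2 : ℝ)) P] with x h0 h1 h2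
    rw [hS, h1, hTd, h2, ← Finset.mul_sum]
    exact abs_sum_sign_mul_le _ hαa hγa h0) (by
    filter_upwards [hnn, H10.fn_sum_smul Finset.univ (fun _ => (2 : ℝ)) P] with x h0 h2
    rw [hTd, h2, ← Finset.mul_sum, abs_of_nonneg (h0 i)]
    have h3 : H10.fn (P i) x ≤ ∑ j, H10.fn (P j) x := Finset.single_le_sum (f := fun j => H10.fn (P j) x) (fun j _ => h0 j)
      (Finset.mem_univ i)
    linarith [h0 i])
  have t4' : p * (embConst n * (‖T‖ + ‖v‖)) ^ p * embConst n * ‖v‖ ≤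
      p * (embConst n * (N + 1)) ^ p * embConst n * ‖v‖ := by gcongr
  -- the other bubbles
  have t5 := abs_integral_nonlin_sum_sub_le (hn := hn) (hΩ := hΩ) hε.le (a := a) hl hαa hγa i
  -- the bubble itself
  have t6 := abs_integral_nonlin_projBubble_sub_le hn hΩ hε.le (hu.mem i) (hd i) (hle i)
    (hu.coeff_pos i) (hα2 i)
  -- f_ε is odd, so the sign γ_i comes out of the integral.
  have e6 : ∫ x in Ω, nonlin n ε (H10.fn ((α i * γ i) • P i) x) * H10.fn (P i) x =
      γ i * ∫ x in Ω, nonlin n ε (α i * H10.fn (P i) x) * H10.fn (P i) x := by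
    rw [← integral_const_mul]
    refine integral_congr_ae ?_
    filter_upwards [H10.fn_smul (α i * γ i) (P i)] with x hx
    rw [hx, mul_comm (α i), mul_assoc, nonlin_sign_mul (hγ i), mul_assoc]
  have t3 : |⟪v, P i⟫_ℝ| ≤ Real.sqrt A * ‖v‖ := by
    refine (abs_real_inner_le_norm _ _).trans ?_
    rw [mul_comm]
    exact mul_le_mul_of_nonneg_right (hPn i) (norm_nonneg _)
  have t2 : |∑ j ∈ Finset.univ.erase i, α j * γ j * ⟪P j, P i⟫_ℝ| ≤
      2 * interConst n * ∑ j ∈ Finset.univ.erase i, interaction (a i) (a j) (l i) (l j) := by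
    refine (abs_sum_sign_mul_le _ hαa hγa
      (fun j => inner_projBubble_nonneg (a j) (a i) (hl j) (hl i))).trans ?_
    rw [mul_assoc]
    refine mul_le_mul_of_nonneg_left ((Finset.sum_le_sum fun j _ => ?_).trans
      (Finset.mul_sum _ _ _).ge) zero_le_two
    rw [interaction_comm]
    exact inner_projBubble_le (a j) (a i) (hl j) (hl i)
  have t1 := le_norm_sq_projBubble hn hΩ (hu.mem i) (hl i) (hd i)
  have t1' := norm_sq_projBubble_le hn hΩ (a := a i) (hl i)
  have t1a : |α i * γ i * (‖P i‖ ^ 2 - A)| ≤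
      4 * tailConst n * (1 / (l i * bdist Ω (a i)) ^ ((n : ℝ) - 2)) := by
    rw [abs_mul, abs_mul, hγa, mul_one]
    have h1 : |‖P i‖ ^ 2 - A| ≤
        2 * (tailConst n * (1 / (l i * bdist Ω (a i)) ^ ((n : ℝ) - 2))) := by
      rw [abs_le]; constructor <;> linarith
    calc _ ≤ 2 * (2 * (tailConst n * (1 / (l i * bdist Ω (a i)) ^ ((n : ℝ) - 2)))) :=
          mul_le_mul (hαa i) h1 (abs_nonneg _) zero_le_two
      _ = _ := by ring
  have hinner : ⟪S, P i⟫_ℝ = α i * γ i * ‖P i‖ ^ 2 +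
      ∑ j ∈ Finset.univ.erase i, α j * γ j * ⟪P j, P i⟫_ℝ := by
    rw [hS, sum_inner, ← Finset.add_sum_erase _ _ (Finset.mem_univ i)]
    simp only [real_inner_smul_left, real_inner_self_eq_norm_sq]
  have hαp : α i * α i ^ (p - 1) = α i ^ p := by
    rw [mul_comm, ← Real.rpow_add_one (hu.coeff_pos i).ne', sub_add_cancel]
  have hd0 : ∀ j, 0 ≤ 1 / (l j * bdist Ω (a j)) ^ ((n : ℝ) - 2) := fun j =>
    one_div_nonneg.2 (Real.rpow_nonneg (mul_pos (hl j) (hd j)).le _)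
  have hsum : 1 / (l i * bdist Ω (a i)) ^ ((n : ℝ) - 2) ≤
      ∑ j, 1 / (l j * bdist Ω (a j)) ^ ((n : ℝ) - 2) :=
    Finset.single_le_sum (f := fun j => 1 / (l j * bdist Ω (a j)) ^ ((n : ℝ) - 2))
      (fun j _ => hd0 j) (Finset.mem_univ i)
  have hE : 0 ≤ ∑ j ∈ Finset.univ.erase i, interaction (a i) (a j) (l i) (l j) :=
    Finset.sum_nonneg fun j _ => (interaction_pos (hl i) (hl j)).le
  have hLL : 0 ≤ ε * Real.log (Real.log (l i)) := by
    have h1 : Real.exp 1 ≤ Real.log (l i) := (Real.le_log_iff_exp_le (hl i)).2 (hle i)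
    exact mul_nonneg hε.le (Real.log_nonneg ((Real.one_le_exp zero_le_one).trans h1))
  rw [inner_gradient_energy hε.le, sobolevConst_rpow hn, huS, inner_add_left, hinner]
  set J₁ := ∫ x in Ω, nonlin n ε (H10.fn (S + v) x) * H10.fn (P i) x
  set J₂ := ∫ x in Ω, nonlin n ε (H10.fn S x) * H10.fn (P i) x
  set J₃ := ∫ x in Ω, nonlin n ε (H10.fn ((α i * γ i) • P i) x) * H10.fn (P i) x
  set J₄ := ∫ x in Ω, nonlin n ε (α i * H10.fn (P i) x) * H10.fn (P i) x
  set s₁ := 1 / (l i * bdist Ω (a i)) ^ ((n : ℝ) - 2)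
  set σ₁ := ∑ j, 1 / (l j * bdist Ω (a j)) ^ ((n : ℝ) - 2)
  set σ₂ := ∑ j ∈ Finset.univ.erase i, interaction (a i) (a j) (l i) (l j)
  set τ := ε * Real.log (Real.log (l i))
  set R := ∑ j ∈ Finset.univ.erase i, α j * γ j * ⟪P j, P i⟫_ℝ
  have t6' : |J₃ - γ i * α i ^ p * A| ≤
      2 ^ p * ((p + 2) * (tailConst n * s₁) + A * (logConst n * τ)) := by
    rw [e6, mul_assoc, ← mul_sub, abs_mul, hγa, one_mul]
    exact t6
  -- Six errors: projection, scalar products with the other bubbles, the scalar product with v, and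
  -- in f_ε(u) the removal of v, then of the other bubbles, then of the logarithm and the
  -- projection.
  have hdecomp : α i * γ i * ‖P i‖ ^ 2 + R + ⟪v, P i⟫_ℝ - J₁ -
      γ i * α i * (1 - α i ^ (p - 1)) * A = α i * γ i * (‖P i‖ ^ 2 - A) + R + ⟪v, P i⟫_ℝ -
        (J₁ - J₂) - (J₂ - J₃) - (J₃ - γ i * α i ^ p * A) := by
    rw [← hαp]; ring
  have hb : ∀ {x y z w r q : ℝ}, |x + y + z - w - r - q| ≤ |x| + |y| + |z| + |w| + |r| + |q| :=
    fun {x y z w r q} => by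
      have hsub : ∀ x y : ℝ, |x - y| ≤ |x| + |y| := fun x y => norm_sub_le x y
      have h1 : |x + y + z - w - r - q| ≤ |x + y + z - w - r| + |q| := hsub _ _
      have h2 : |x + y + z - w - r| ≤ |x + y + z - w| + |r| := hsub _ _
      have h3 : |x + y + z - w| ≤ |x + y + z| + |w| := hsub _ _
      have h4 := (abs_add_le (x + y) z).trans (add_le_add_left (abs_add_le x y) |z|)
      linarith
  rw [hdecomp]
  refine hb.trans ?_
  have hfin : 4 * tailConst n * s₁ + 2 * interConst n * σ₂ + Real.sqrt A * ‖v‖ +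
      p * (embConst n * (N + 1)) ^ p * embConst n * ‖v‖ +
      p * 2 * 4 ^ (p - 1) * (m : ℝ) ^ (p - 1) * (2 * interConst n) * σ₂ +
      2 ^ p * ((p + 2) * (tailConst n * s₁) + A * (logConst n * τ)) =
      C₁ * s₁ + C₂ * σ₂ + C₃ * ‖v‖ + C₄ * τ := by
    rw [hC₁, hC₂, hC₃, hC₄]; ring
  have hs₁ : 0 ≤ s₁ := hd0 i
  have hmain : C₁ * s₁ + C₂ * σ₂ + C₃ * ‖v‖ + C₄ * τ ≤
      (C₁ + C₂ + C₃ + C₄ + 1) * (τ + σ₁ + σ₂ + ‖v‖) := by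
    have hv0 := norm_nonneg v
    have hσ₁ : 0 ≤ σ₁ := hs₁.trans hsum
    calc _ ≤ C₁ * (τ + σ₁ + σ₂ + ‖v‖) + C₂ * (τ + σ₁ + σ₂ + ‖v‖) + C₃ * (τ + σ₁ + σ₂ + ‖v‖) +
          C₄ * (τ + σ₁ + σ₂ + ‖v‖) := by gcongr <;> linarith
      _ ≤ _ := by
        have : 0 ≤ τ + σ₁ + σ₂ + ‖v‖ := by positivity
        linarith
  linarith
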